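/- **Setting.** Subjects $i=1,2,\dots$ are i.i.d. Subject $i$ has jointly measurable processes $Y_i(s)\in\mathbb R$, $X_i(s)\in\mathbb R^p$, $Z_i(s)\in\mathbb R^q$, $s\in[0,1]$, and random observation times $T_{i1},\dots,T_{iL_i}$ (for $Y_i$ and $X_i$) and $S_{i1},\dots,S_{iM_i}$ (for $Z_i$), with $L_i,M_i<\infty$. Put $N_i^*(t,s)=\sum_{j\le L_i}\sum_{k\le M_i}I(T_{ij}\le t,\,S_{ik}\le s)$. Write $Y,X,Z,N^*$ for a generic subject and $C(t)=(X(t)^T,Z(t)^T)^T$, $R(t_1,t_2,t)=(X(t_1)^T,X(t_1)^T(t_1-t),Z(t_2)^T,Z(t_2)^T(t_2-t))^T$. **Model.** For all $s,u\in[0,1]$, $E\{Y(s)\mid X(s),Z(s),Z(u)\}=X(s)^T\beta_0(s)+Z(s)^T\gamma_0(s)$; in particular $E\{Y(s)\mid X(s),Z(s)\}=X(s)^T\beta_0(s)+Z(s)^T\gamma_0(s)$. Moreover $\mathrm{var}\{Y(s)\mid X(s),Z(s)\}=\sigma\{s,X(s),Z(s)\}^2$. Let $\rho_0=(\beta_0^T,\dot\beta_0^T,\gamma_0^T,\dot\gamma_0^T)^T$.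 **Estimator.** With $K_{h_1,h_2}(u,v)=K(u/h_1,v/h_2)/(h_1h_2)$, let $\hat\rho_w(t)=(\hat\beta_w(t),\hat{\dot\beta}_w(t),\hat\gamma_w(t),\hat{\dot\gamma}_w(t))$ be any measurable minimizer over $(b_0,b_1,g_0,g_1)\in\mathbb R^{p}\times\mathbb R^p\times\mathbb R^q\times\mathbb R^q$ of $$\sum_{i=1}^n\iint K_{h_1,h_2}(t_1-t,t_2-t)\{Y_i(t_1)-X_i(t_1)^Tb_0-X_i(t_1)^Tb_1(t_1-t)-Z_i(t_2)^Tg_0-Z_i(t_2)^Tg_1(t_2-t)\}^2\,dN_i^*(t_1,t_2).$$ **Conditions.** (A1) The observation times are independent of $(X_i,Y_i,Z_i)$. $E\{dN^*(t,s)\}=\eta(t,s)\,dt\,ds$ on $[0,1]^2$, with $\eta\ge0$ twice continuously differentiable on $[0,1]^2$ and no points outside. For $t_1\ne s_1$, $t_2\ne s_2$, $P\{dN^*(t_1,t_2)=1\mid N^*\text{ has a point at }(s_1,s_2)\}=f(t_1,t_2,s_1,s_2)\,dt_1dt_2$ (that is, pairs of points differing in both times have joint intensity $f(t_1,t_2,s_1,s_2)\eta(s_1,s_2)$),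 where $f\ge0$ is continuous on $\{t_1\ne s_1,\,t_2\ne s_2\}\subset[0,1]^4$ and, on each of the four regions given by the signs of $t_1-s_1$ and $t_2-s_2$, has limits at all points of the closure of the region. The pairs of distinct points of $N^*$ that share the time $T_{ij}$, or share the time $S_{ik}$, have a bounded joint intensity, i.e. the mean measures of $\sum_j\sum_{k\ne k'}\delta_{(T_{ij},S_{ik},S_{ik'})}$ and $\sum_k\sum_{j\ne j'}\delta_{(S_{ik},T_{ij},T_{ij'})}$ are at most a constant times Lebesgue measure on $\mathbb R^3$. (A2) $\rho_0$ is twice continuously differentiable on $[0,1]$. For each $t\in[0,1]$, $E\{R(t_1,t_2,t)R(s_1,s_2,t)^T\}$ and $E\{R(t_1,t_2,t)\}$ are twice continuously differentiable on $[0,1]^4$ and $[0,1]^2$, respectively. For each $s\in[0,1]$, $E\{C(s)C(s)^T\}\eta(s,s)$ is positive definite and $E[C(s)C(s)^T\sigma\{s,X(s),Z(s)\}^2]$ is finite. At the point $t$ considered, $s\mapsto E[C(s)C(s)^T\sigma\{s,X(s),Z(s)\}^2]$ is continuous; and for some $r>4$, $\sup_{s\in[0,1]}E\{|Y(s)|^r+\|X(s)\|^r+\|Z(s)\|^r\}<\infty$.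 (A3) $K\ge0$ is measurable on $\mathbb R^2$, $\iint K=1$, $\iint z_1K=\iint z_2K=0$, and $\iint K^2$, $\iint z_1^2K$, $\iint z_2^2K$, $\iint z_1^2z_2^2K$ are finite. (A4) The bandwidths $h_1,h_2>0$ (depending on $n$) satisfy $(nh_1h_2)^{1/2}(h_1^2+h_2^2)\to0$ and $nh_1h_2\to\infty$. **Theorem.** Under the model and (A1)–(A4), for every fixed $t\in(0,1)$, as $n\to\infty$, $$\sqrt{nh_1h_2}\,\big[\{\hat\beta_w(t)-\beta_0(t)\}^T,\{\hat\gamma_w(t)-\gamma_0(t)\}^T\big]^T\xrightarrow{d}N\{0,\,A^*(t)^{-1}\Sigma^*(t)A^*(t)^{-1}\},$$ where $A^*(t)=E\{C(t)C(t)^T\}\eta(t,t)$ and $\Sigma^*(t)=\big\{\iint K(z_1,z_2)^2dz_1dz_2\big\}\,E[C(t)C(t)^T\sigma\{t,X(t),Z(t)\}^2]\,\eta(t,t)$. -/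

import Mathlib

open MeasureTheory ProbabilityTheory Filter Topology Set
open scoped ENNReal NNReal

namespace AsyncVC

/-- The unit time interval `[0, 1]`. -/
abbrev unitI : Set ℝ := Icc 0 1

/-- The unit square `[0, 1]²`. -/
abbrev unitSq : Set (ℝ × ℝ) := unitI ×ˢ unitI

/-! ### Observation times and the bivariate counting process -/

/-- The observation times of one subject, `((L, T), (M, S))`: the response and the synchronous
covariates are observed at `T 0, …, T (L - 1)`, the asynchronous ones at `S 0, …, S (M - 1)`.
(The remaining entries of the two sequences play no role.) -/
abbrev ObsTimes : Type := (ℕ × (ℕ → ℝ)) × (ℕ × (ℕ → ℝ))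

/-- The point measure `dN*` of the bivariate counting process
`N*(t, s) = ∑ j < L, ∑ k < M, 1 (T j ≤ t, S k ≤ s)`. -/
noncomputable def dNstar (τ : ObsTimes) : Measure (ℝ × ℝ) :=
  ∑ j ∈ Finset.range τ.1.1, ∑ k ∈ Finset.range τ.2.1, Measure.dirac (τ.1.2 j, τ.2.2 k)

/-- The point measure of the pairs `((t₁, t₂), (s₁, s₂))` of points of `N*` that differ both in
the response time and in the asynchronous time. -/
noncomputable def dPairs (τ : ObsTimes) : Measure ((ℝ × ℝ) × (ℝ × ℝ)) :=
  ∑ j ∈ Finset.range τ.1.1, ∑ j' ∈ (Finset.range τ.1.1).erase j,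
    ∑ k ∈ Finset.range τ.2.1, ∑ k' ∈ (Finset.range τ.2.1).erase k,
      Measure.dirac ((τ.1.2 j, τ.2.2 k), (τ.1.2 j', τ.2.2 k'))

/-- The point measure of the pairs `(t₁, t₂)`, `(t₁, s₂)` of points of `N*` that share the
response time, recorded as `(t₁, t₂, s₂)`. -/
noncomputable def dSharedT (τ : ObsTimes) : Measure (ℝ × ℝ × ℝ) :=
  ∑ j ∈ Finset.range τ.1.1, ∑ k ∈ Finset.range τ.2.1, ∑ k' ∈ (Finset.range τ.2.1).erase k,
    Measure.dirac (τ.1.2 j, τ.2.2 k, τ.2.2 k')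

/-- The point measure of the pairs `(t₁, t₂)`, `(s₁, t₂)` of points of `N*` that share the
asynchronous time, recorded as `(t₂, t₁, s₁)`. -/
noncomputable def dSharedS (τ : ObsTimes) : Measure (ℝ × ℝ × ℝ) :=
  ∑ k ∈ Finset.range τ.2.1, ∑ j ∈ Finset.range τ.1.1, ∑ j' ∈ (Finset.range τ.1.1).erase j,
    Measure.dirac (τ.2.2 k, τ.1.2 j, τ.1.2 j')

/-- The points of `[0, 1]⁴` with `t₁ ≠ s₁` and `t₂ ≠ s₂`. -/
def offDiag : Set ((ℝ × ℝ) × (ℝ × ℝ)) :=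
  {z | z ∈ unitSq ×ˢ unitSq ∧ z.1.1 ≠ z.2.1 ∧ z.1.2 ≠ z.2.2}

/-- The part of `offDiag` where `t₁ - s₁` has the sign of `a` and `t₂ - s₂` the sign of `b`. -/
def offDiagPart (a b : ℝ) : Set ((ℝ × ℝ) × (ℝ × ℝ)) :=
  {z | z ∈ unitSq ×ˢ unitSq ∧ 0 < a * (z.1.1 - z.2.1) ∧ 0 < b * (z.1.2 - z.2.2)}

/-- Condition on the law `ν` of the observation times of a subject. `E dN*(t, s) = η(t, s) dt ds`
on `[0, 1]²`; given a point of `N*` at `(s₁, s₂)`, the conditional intensity of another point at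
`(t₁, t₂)`, `t₁ ≠ s₁`, `t₂ ≠ s₂`, is `f((t₁, t₂), (s₁, s₂))`, which has one-sided limits at the
excluded points; and distinct points of `N*` that share one of the two times have a bounded joint
intensity. -/
structure ObservationCondition (ν : Measure ObsTimes) (η : ℝ × ℝ → ℝ)
    (f : (ℝ × ℝ) × (ℝ × ℝ) → ℝ) : Prop where
  eta_nonneg : ∀ z ∈ unitSq, 0 ≤ η z
  eta_smooth : ContDiffOn ℝ 2 η unitSq
  intensity : ∀ B : Set (ℝ × ℝ), MeasurableSet B →
    ∫⁻ τ, dNstar τ B ∂ν = ∫⁻ z in B ∩ unitSq, ENNReal.ofReal (η z)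
  f_nonneg : ∀ z ∈ offDiag, 0 ≤ f z
  f_cont : ContinuousOn f offDiag
  f_limits : ∀ a ∈ ({1, -1} : Set ℝ), ∀ b ∈ ({1, -1} : Set ℝ),
    ∀ z ∈ closure (offDiagPart a b), ∃ l : ℝ, Tendsto f (𝓝[offDiagPart a b] z) (𝓝 l)
  pair_intensity : ∀ B : Set ((ℝ × ℝ) × (ℝ × ℝ)), MeasurableSet B →
    ∫⁻ τ, dPairs τ B ∂ν = ∫⁻ z in B ∩ offDiag, ENNReal.ofReal (f z * η z.2)
  shared_intensity : ∃ c : ℝ≥0, ∀ B : Set (ℝ × ℝ × ℝ), MeasurableSet B →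
    ∫⁻ τ, dSharedT τ B ∂ν ≤ c * volume B ∧ ∫⁻ τ, dSharedS τ B ∂ν ≤ c * volume B

/-! ### Covariates, coefficients and the estimator -/

/-- Index type of the vectors `(β, β̇, γ, γ̇)`. -/
abbrev RIdx (p q : ℕ) : Type := (Fin p ⊕ Fin p) ⊕ (Fin q ⊕ Fin q)

section

variable {E : Type*} {p q : ℕ}

/-- `R(t₁, t₂, t) = (X(t₁), X(t₁) (t₁ - t), Z(t₂), Z(t₂) (t₂ - t))`, where `e` is the outcome. -/
def R (X : ℝ → E → Fin p → ℝ) (Z : ℝ → E → Fin q → ℝ) (t₁ t₂ t : ℝ) (e : E) : RIdx p q → ℝ :=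
  Sum.elim (Sum.elim (X t₁ e) (fun a => X t₁ e a * (t₁ - t)))
    (Sum.elim (Z t₂ e) (fun b => Z t₂ e b * (t₂ - t)))

/-- `C(t, t) = (X(t), Z(t))`. -/
def C (X : ℝ → E → Fin p → ℝ) (Z : ℝ → E → Fin q → ℝ) (t : ℝ) (e : E) : Fin p ⊕ Fin q → ℝ :=
  Sum.elim (X t e) (Z t e)

/-- `ρ₀ = (β₀, β̇₀, γ₀, γ̇₀)` on `[0, 1]` (one-sided derivatives at the end points). -/
noncomputable def rho (β₀ : ℝ → Fin p → ℝ) (γ₀ : ℝ → Fin q → ℝ) (s : ℝ) : RIdx p q → ℝ :=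
  Sum.elim (Sum.elim (β₀ s) (derivWithin β₀ unitI s)) (Sum.elim (γ₀ s) (derivWithin γ₀ unitI s))

/-- The scaled kernel `K_{h₁,h₂}(u, v) = K(u / h₁, v / h₂) / (h₁ h₂)`. -/
noncomputable def scaledKernel (K : ℝ × ℝ → ℝ) (h₁ h₂ : ℝ) (u v : ℝ) : ℝ :=
  K (u / h₁, v / h₂) / (h₁ * h₂)

/-- The local linear kernel-weighted least-squares criterion for the first `n` subjects: subject
`i` has the trajectory `ξ i` (so `Y_i(s) = Y s (ξ i)`, and so on) and the observation times `τ i`. -/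
noncomputable def criterion (Y : ℝ → E → ℝ) (X : ℝ → E → Fin p → ℝ) (Z : ℝ → E → Fin q → ℝ)
    (K : ℝ × ℝ → ℝ) (h₁ h₂ t : ℝ) (n : ℕ) (ξ : ℕ → E) (τ : ℕ → ObsTimes) (ρ : RIdx p q → ℝ) : ℝ :=
  ∑ i ∈ Finset.range n, ∫ z, scaledKernel K h₁ h₂ (z.1 - t) (z.2 - t) *
    (Y z.1 (ξ i) - R X Z z.1 z.2 t (ξ i) ⬝ᵥ ρ) ^ 2 ∂(dNstar (τ i))

/-! ### The limiting covariance -/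

variable [MeasurableSpace E]

/-- `A*(t) = E {C(t, t) C(t, t)ᵀ} η(t, t)`. -/
noncomputable def AStar (μ : Measure E) (X : ℝ → E → Fin p → ℝ) (Z : ℝ → E → Fin q → ℝ)
    (η : ℝ × ℝ → ℝ) (t : ℝ) : Matrix (Fin p ⊕ Fin q) (Fin p ⊕ Fin q) ℝ :=
  Matrix.of fun a b => (∫ e, C X Z t e a * C X Z t e b ∂μ) * η (t, t)

/-- `E [C(t, t) C(t, t)ᵀ σ{t, X(t), Z(t)}²]`. -/
noncomputable def sigmaMoment (μ : Measure E) (X : ℝ → E → Fin p → ℝ) (Z : ℝ → E → Fin q → ℝ)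
    (σ : ℝ → (Fin p → ℝ) → (Fin q → ℝ) → ℝ) (t : ℝ) :
    Matrix (Fin p ⊕ Fin q) (Fin p ⊕ Fin q) ℝ :=
  Matrix.of fun a b => ∫ e, C X Z t e a * C X Z t e b * σ t (X t e) (Z t e) ^ 2 ∂μ

/-- `Σ*(t) = {∬ K²} E [C(t, t) C(t, t)ᵀ σ{t, X(t), Z(t)}²] η(t, t)`. -/
noncomputable def SigmaStar (μ : Measure E) (X : ℝ → E → Fin p → ℝ) (Z : ℝ → E → Fin q → ℝ)
    (σ : ℝ → (Fin p → ℝ) → (Fin q → ℝ) → ℝ) (η : ℝ × ℝ → ℝ) (K : ℝ × ℝ → ℝ) (t : ℝ) :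
    Matrix (Fin p ⊕ Fin q) (Fin p ⊕ Fin q) ℝ :=
  ((∫ z, K z ^ 2) * η (t, t)) • sigmaMoment μ X Z σ t

/-! ### The varying-coefficient model and the conditions on covariates, kernel and bandwidths -/

/-- The varying-coefficient model for a generic subject with trajectory law `μ`.
`mean` with `u = s` is `E {Y(s) | X(s), Z(s)} = X(s)ᵀ β₀(s) + Z(s)ᵀ γ₀(s)`; for other `u` it says
that the asynchronous covariate at another time carries no further information on the mean. -/
structure VaryingCoefficientModel (μ : Measure E) (Y : ℝ → E → ℝ) (X : ℝ → E → Fin p → ℝ)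
    (Z : ℝ → E → Fin q → ℝ) (β₀ : ℝ → Fin p → ℝ) (γ₀ : ℝ → Fin q → ℝ)
    (σ : ℝ → (Fin p → ℝ) → (Fin q → ℝ) → ℝ) : Prop where
  meas_Y : Measurable (Function.uncurry Y)
  meas_X : Measurable (Function.uncurry X)
  meas_Z : Measurable (Function.uncurry Z)
  mean : ∀ s ∈ unitI, ∀ u ∈ unitI,
    μ[Y s | MeasurableSpace.comap (fun e => (X s e, Z s e, Z u e)) inferInstance]
      =ᵐ[μ] fun e => X s e ⬝ᵥ β₀ s + Z s e ⬝ᵥ γ₀ s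
  variance : ∀ s ∈ unitI,
    Var[Y s; μ | MeasurableSpace.comap (fun e => (X s e, Z s e)) inferInstance]
      =ᵐ[μ] fun e => σ s (X s e) (Z s e) ^ 2

/-- Smoothness and identifiability of the coefficients and the covariate moments. -/
structure CovariateCondition (μ : Measure E) (X : ℝ → E → Fin p → ℝ) (Z : ℝ → E → Fin q → ℝ)
    (β₀ : ℝ → Fin p → ℝ) (γ₀ : ℝ → Fin q → ℝ) (σ : ℝ → (Fin p → ℝ) → (Fin q → ℝ) → ℝ)
    (η : ℝ × ℝ → ℝ) : Prop where
  rho_smooth : ContDiffOn ℝ 2 (rho β₀ γ₀) unitI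
  RR_smooth : ∀ t ∈ unitI, ∀ a b : RIdx p q,
    ContDiffOn ℝ 2 (fun z : (ℝ × ℝ) × (ℝ × ℝ) =>
      ∫ e, R X Z z.1.1 z.1.2 t e a * R X Z z.2.1 z.2.2 t e b ∂μ) (unitSq ×ˢ unitSq)
  R_smooth : ∀ t ∈ unitI, ∀ a : RIdx p q,
    ContDiffOn ℝ 2 (fun z : ℝ × ℝ => ∫ e, R X Z z.1 z.2 t e a ∂μ) unitSq
  posDef : ∀ s ∈ unitI, (AStar μ X Z η s).PosDef
  sigma_finite : ∀ s ∈ unitI, ∀ a b : Fin p ⊕ Fin q,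
    Integrable (fun e => C X Z s e a * C X Z s e b * σ s (X s e) (Z s e) ^ 2) μ

/-- Regularity behind the Taylor expansion of the variance at `t` and the Lyapunov condition:
`E [C Cᵀ σ²]` is continuous at `t`, and the response and the covariates have bounded moments of
some order `r > 4`. -/
structure RegularityCondition (μ : Measure E) (Y : ℝ → E → ℝ) (X : ℝ → E → Fin p → ℝ)
    (Z : ℝ → E → Fin q → ℝ) (σ : ℝ → (Fin p → ℝ) → (Fin q → ℝ) → ℝ) (t : ℝ) : Prop where
  sigma_cont : ContinuousAt (sigmaMoment μ X Z σ) t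
  moments : ∃ r B : ℝ≥0, 4 < r ∧ ∀ s ∈ unitI,
    eLpNorm (Y s) r μ ≤ B ∧ eLpNorm (X s) r μ ≤ B ∧ eLpNorm (Z s) r μ ≤ B

end

/-- `K` is a centred, square-integrable bivariate density with finite second moments. -/
structure KernelCondition (K : ℝ × ℝ → ℝ) : Prop where
  meas : Measurable K
  nonneg : ∀ z, 0 ≤ K z
  integrable : Integrable K
  integral_eq_one : ∫ z, K z = 1
  integral_fst : ∫ z : ℝ × ℝ, z.1 * K z = 0
  integral_snd : ∫ z : ℝ × ℝ, z.2 * K z = 0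
  integrable_sq : Integrable fun z => K z ^ 2
  integrable_fst_sq : Integrable fun z : ℝ × ℝ => z.1 ^ 2 * K z
  integrable_snd_sq : Integrable fun z : ℝ × ℝ => z.2 ^ 2 * K z
  integrable_mul_sq : Integrable fun z : ℝ × ℝ => z.1 ^ 2 * z.2 ^ 2 * K z

/-- `(n h₁ h₂)^{1/2} (h₁² + h₂²) → 0` and `n h₁ h₂ → ∞`, for positive bandwidths. -/
structure BandwidthCondition (h₁ h₂ : ℕ → ℝ) : Prop where
  pos₁ : ∀ n, 0 < h₁ n
  pos₂ : ∀ n, 0 < h₂ n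
  bias : Tendsto (fun n : ℕ => √(n * h₁ n * h₂ n) * (h₁ n ^ 2 + h₂ n ^ 2)) atTop (𝓝 0)
  rate : Tendsto (fun n : ℕ => n * h₁ n * h₂ n) atTop atTop

end AsyncVC

/-! A minimizer of the criterion solves linear normal equations. Write `N = n h₁ h₂`, `θ = (β₀(t),
γ₀(t))`, centre the levels at `θ`, and multiply the slopes by their bandwidths. The equations become
`M x = (u, d)`, in which every entry is an average over subjects of a sum over points, weighted by
`K` or by a monomial times `K`. The slopes are centred at zero, not at the true derivatives. This
costs nothing: the mean score `E {C(z) (Y(z₁) - C(z)ᵀ θ)}` is a `C²` function of `z` that vanishes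
at `(t, t)`, so a centred kernel leaves a bias of order `h₁² + h₂²`, which is `o(N^{-1/2})` by (A4).

Since `z² K²` need not be integrable, the slope equations cannot be normalized by `√N`. They are
scaled by `N^{1/4}` instead. At that rate, truncating the monomial at height `N^{1/4}` leaves a part
with vanishing variance and a tail that is small in `L¹`
(`tendstoInMeasure_sqrt_sqrt_mul_kernelAvg`). Hence the slope score `d` vanishes, the cross blocks
of `M` vanish because `K` has mean zero, and the diagonal blocks tend to `A*` and to an invertible
`slopeMatrix` (`tendstoInMeasure_design`). Slutsky's theorem then reduces the claim to the limit law
of `(A*)⁻¹ u`, where `u` is the level score multiplied by `√N` (`tendstoInDistribution_solution`).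

That limit is obtained by characteristic functions (`tendsto_charFun_kernelAverage`). For one
subject, `exp(i ∑ x) - 1` equals `∑ (exp(i x) - 1)` up to a sum of `|x| |x'|` over pairs of distinct
points. The pairs are negligible: those differing in both times because their joint intensity is
bounded, those sharing a time by a weighted Young inequality (`tendsto_offDiag_kern`). Campbell's
formula turns the single sum into an integral over the square. After rescaling, its linear term is
the bias and its quadratic term converges with `K²` as dominating function
(`tendsto_integral_quadratic`).

The limiting variance requires the second moment of the score to be continuous at `(t, t)`
(`tendsto_integral_sq_score`). Smooth covariate moments make the covariates continuous in mean
square, moments of order above four let this pass to products with the residual, and on the diagonal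
the conditional variance gives `E [C Cᵀ σ²]`, continuous at `t`. -/

namespace AsyncVC

/-! ### Sums over the points of the counting process -/

/-- The indices of the points of `N*`. -/
def pts (τ : ObsTimes) : Finset (ℕ × ℕ) := Finset.range τ.1.1 ×ˢ Finset.range τ.2.1

/-- The point of `N*` with index `i`. -/
def pt (τ : ObsTimes) (i : ℕ × ℕ) : ℝ × ℝ := (τ.1.2 i.1, τ.2.2 i.2)

/-- The sum of `g` over the points of `N*`. -/
def pointSum {M : Type*} [AddCommMonoid M] (τ : ObsTimes) (g : ℝ × ℝ → M) : M :=
  ∑ i ∈ pts τ, g (pt τ i)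

/-- The sum of `G` over the pairs of distinct points of `N*`. -/
def offSum {M : Type*} [AddCommMonoid M] (τ : ObsTimes) (G : (ℝ × ℝ) × (ℝ × ℝ) → M) : M :=
  ∑ i ∈ pts τ, ∑ i' ∈ (pts τ).erase i, G (pt τ i, pt τ i')

/-- The numbers of observation times are random, so the index set of a sum over points varies with
the sample. Conditioning on these counts, which take countably many values, reduces measurability to
sums over a fixed finite set. -/
lemma measurable_comp_countable {A B ι : Type*} [MeasurableSpace A] [MeasurableSpace B]
    [MeasurableSpace ι] [Countable ι] [MeasurableSingletonClass ι] {Φ : ι → A → B}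
    (hΦ : ∀ i, Measurable (Φ i)) {l : A → ι} (hl : Measurable l) :
    Measurable fun x => Φ (l x) x := by
  have h : Measurable fun y : ι × A => Φ y.1 y.2 := measurable_from_prod_countable_right hΦ
  exact h.comp (hl.prodMk measurable_id)

lemma measurable_pt (i : ℕ × ℕ) : Measurable fun τ : ObsTimes => pt τ i := by
  unfold pt; fun_prop

lemma measurable_pointSum_prod {A M : Type*} [MeasurableSpace A] [MeasurableSpace M]
    [AddCommMonoid M] [MeasurableAdd₂ M] {g : A → ℝ × ℝ → M}
    (hg : Measurable (Function.uncurry g)) :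
    Measurable fun x : A × ObsTimes => pointSum x.2 (g x.1) := by
  refine measurable_comp_countable (ι := ℕ × ℕ)
    (Φ := fun l (x : A × ObsTimes) => ∑ i ∈ Finset.range l.1 ×ˢ Finset.range l.2, g x.1 (pt x.2 i))
    (l := fun x : A × ObsTimes => (x.2.1.1, x.2.2.1)) (fun l => ?_) ?_
  · apply Finset.measurable_sum
    intro i _
    exact hg.comp (measurable_fst.prodMk ((measurable_pt i).comp measurable_snd))
  · have h : Measurable fun τ : ObsTimes => (τ.1.1, τ.2.1) := by fun_prop
    exact h.comp measurable_snd

lemma measurable_pointSum {M : Type*} [MeasurableSpace M] [AddCommMonoid M]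
    [MeasurableAdd₂ M] {g : ℝ × ℝ → M} (hg : Measurable g) :
    Measurable fun τ : ObsTimes => pointSum τ g := by
  refine measurable_comp_countable (ι := ℕ × ℕ)
    (Φ := fun l τ => ∑ i ∈ Finset.range l.1 ×ˢ Finset.range l.2, g (pt τ i))
    (l := fun τ => (τ.1.1, τ.2.1)) (fun l => ?_) (by fun_prop)
  apply Finset.measurable_sum
  intro i _
  exact hg.comp (measurable_pt i)

lemma lintegral_dNstar (τ : ObsTimes) (g : ℝ × ℝ → ℝ≥0∞) :
    ∫⁻ z, g z ∂dNstar τ = pointSum τ g := by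
  simp [dNstar, pointSum, pts, pt, lintegral_finsetSum_measure, Finset.sum_product]

lemma integral_dNstar (τ : ObsTimes) (g : ℝ × ℝ → ℝ) :
    ∫ z, g z ∂dNstar τ = pointSum τ g := by
  have h : ∀ a : ℝ × ℝ, Integrable g (Measure.dirac a) := fun a => integrable_dirac (by simp)
  rw [dNstar, integral_finsetSum_measure]
  · simp only [pointSum, pts, Finset.sum_product]
    refine Finset.sum_congr rfl fun j _ => ?_
    rw [integral_finsetSum_measure fun k _ => h _]
    simp [pt]
  · exact fun j _ => integrable_finsetSum_measure.2 fun k _ => h _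

lemma measurable_dNstar : Measurable dNstar := by
  refine Measure.measurable_of_measurable_coe _ fun B hB => ?_
  have h : Measurable fun τ : ObsTimes => pointSum τ (B.indicator (1 : ℝ × ℝ → ℝ≥0∞)) :=
    measurable_pointSum (measurable_one.indicator hB)
  convert h using 2 with τ
  rw [← lintegral_dNstar, lintegral_indicator_one hB]

/-- Measurability of a random sum of Dirac masses, with a number of terms determined by the
numbers of observation times. -/
lemma measurable_sum_dirac {A ι : Type*} [MeasurableSpace A] (s : ℕ × ℕ → Finset ι)
    (x : ι → ObsTimes → A) (hx : ∀ i, Measurable (x i)) :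
    Measurable fun τ : ObsTimes => ∑ i ∈ s (τ.1.1, τ.2.1), Measure.dirac (x i τ) := by
  refine Measure.measurable_of_measurable_coe _ fun B hB => ?_
  refine measurable_comp_countable (ι := ℕ × ℕ)
    (Φ := fun l τ => (∑ i ∈ s l, Measure.dirac (x i τ)) B)
    (l := fun τ => (τ.1.1, τ.2.1)) (fun l => ?_) (by fun_prop)
  simp only [Measure.coe_finsetSum, Finset.sum_apply]
  exact Finset.measurable_sum _ fun i _ =>
    (Measure.measurable_coe hB).comp (Measure.measurable_dirac.comp (hx i))

/-- The pair measures are regrouped by their first point, the shape in which `offSum` is defined. -/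
lemma dPairs_eq (τ : ObsTimes) : dPairs τ = ∑ i ∈ pts τ,
    ∑ i' ∈ (Finset.range τ.1.1).erase i.1 ×ˢ (Finset.range τ.2.1).erase i.2,
      Measure.dirac (pt τ i, pt τ i') := by
  simp only [dPairs, pts, pt, Finset.sum_product]
  refine Finset.sum_congr rfl fun j _ => ?_
  rw [Finset.sum_comm]

lemma dSharedT_eq (τ : ObsTimes) : dSharedT τ = ∑ i ∈ pts τ,
    ∑ k' ∈ (Finset.range τ.2.1).erase i.2, Measure.dirac (τ.1.2 i.1, τ.2.2 i.2, τ.2.2 k') := by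
  simp only [dSharedT, pts, Finset.sum_product]

lemma dSharedS_eq (τ : ObsTimes) : dSharedS τ = ∑ i ∈ pts τ,
    ∑ j' ∈ (Finset.range τ.1.1).erase i.1, Measure.dirac (τ.2.2 i.2, τ.1.2 i.1, τ.1.2 j') := by
  simp only [dSharedS, pts, Finset.sum_product]
  rw [Finset.sum_comm]

lemma measurable_dPairs : Measurable dPairs := by
  have := measurable_sum_dirac
    (fun l => (Finset.range l.1 ×ˢ Finset.range l.2).sigma fun i =>
      (Finset.range l.1).erase i.1 ×ˢ (Finset.range l.2).erase i.2)
    (fun i τ => (pt τ i.1, pt τ i.2))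
    (fun i => (measurable_pt _).prodMk (measurable_pt _))
  convert this using 2 with τ
  rw [dPairs_eq, Finset.sum_sigma]; rfl

lemma measurable_dSharedT : Measurable dSharedT := by
  have := measurable_sum_dirac
    (fun l => (Finset.range l.1 ×ˢ Finset.range l.2).sigma fun i => (Finset.range l.2).erase i.2)
    (fun i τ => (τ.1.2 i.1.1, τ.2.2 i.1.2, τ.2.2 i.2)) (fun i => by fun_prop)
  convert this using 2 with τ
  rw [dSharedT_eq, Finset.sum_sigma]; rfl

lemma measurable_dSharedS : Measurable dSharedS := by
  have := measurable_sum_dirac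
    (fun l => (Finset.range l.1 ×ˢ Finset.range l.2).sigma fun i => (Finset.range l.1).erase i.1)
    (fun i τ => (τ.2.2 i.1.2, τ.1.2 i.1.1, τ.1.2 i.2)) (fun i => by fun_prop)
  convert this using 2 with τ
  rw [dSharedS_eq, Finset.sum_sigma]; rfl

/-- The inner integral is taken against a random measure; its mean measure `ν.bind D` is dominated
by `m` on sets, hence on nonnegative functions. -/
lemma lintegral_lintegral_le_of_forall_le {A B : Type*} [MeasurableSpace A] [MeasurableSpace B]
    {ν : Measure A} {D : A → Measure B} (hD : Measurable D) {m : Measure B}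
    (h : ∀ s, MeasurableSet s → ∫⁻ τ, D τ s ∂ν ≤ m s) {g : B → ℝ≥0∞} (hg : Measurable g) :
    ∫⁻ τ, ∫⁻ z, g z ∂D τ ∂ν ≤ ∫⁻ z, g z ∂m := by
  rw [← Measure.lintegral_bind hD.aemeasurable hg.aemeasurable]
  refine lintegral_mono' (Measure.le_iff.2 fun s hs => ?_) le_rfl
  rw [Measure.bind_apply hs hD.aemeasurable]
  exact h s hs

/-- The pairs of distinct points split into those that differ in both times, those that share the
response time, and those that share the asynchronous time. -/
lemma offSum_eq (τ : ObsTimes) (G : (ℝ × ℝ) × (ℝ × ℝ) → ℝ≥0∞) :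
    offSum τ G = (∫⁻ z, G z ∂dPairs τ) + (∫⁻ z, G ((z.1, z.2.1), (z.1, z.2.2)) ∂dSharedT τ)
      + ∫⁻ z, G ((z.2.1, z.1), (z.2.2, z.1)) ∂dSharedS τ := by
  rw [dPairs_eq, dSharedT_eq, dSharedS_eq]
  simp only [lintegral_finsetSum_measure, lintegral_dirac, offSum, ← Finset.sum_add_distrib]
  refine Finset.sum_congr rfl fun i hi => ?_
  have hi' : i.1 ∈ Finset.range τ.1.1 ∧ i.2 ∈ Finset.range τ.2.1 := Finset.mem_product.1 hi
  -- A partner of `i` differs from it in both indices, only in the second, or only in the first. The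
  -- split is by index, not by the value of the times.
  have hsplit : (pts τ).erase i =
      ((Finset.range τ.1.1).erase i.1 ×ˢ (Finset.range τ.2.1).erase i.2 ∪
        {i.1} ×ˢ (Finset.range τ.2.1).erase i.2) ∪ (Finset.range τ.1.1).erase i.1 ×ˢ {i.2} := by
    ext ⟨j, k⟩
    obtain ⟨j₀, k₀⟩ := i
    simp only [pts, Finset.mem_erase, Finset.mem_product, Finset.mem_union, Finset.mem_singleton,
      ne_eq, Prod.mk.injEq] at hi' ⊢
    grind
  rw [hsplit, Finset.sum_union, Finset.sum_union]
  · rw [Finset.sum_product, Finset.sum_product, Finset.sum_product, Finset.sum_singleton]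
    simp only [Finset.sum_singleton, pt]
  · rw [Finset.disjoint_left]
    rintro ⟨j, k⟩
    simp only [Finset.mem_product, Finset.mem_erase, Finset.mem_singleton]
    grind
  · rw [Finset.disjoint_left]
    rintro ⟨j, k⟩
    simp only [Finset.mem_product, Finset.mem_erase, Finset.mem_singleton, Finset.mem_union]
    grind

lemma sq_pointSum {M : Type*} [CommSemiring M] (τ : ObsTimes) (a : ℝ × ℝ → M) :
    pointSum τ a ^ 2 = pointSum τ (fun z => a z ^ 2) + offSum τ (fun z => a z.1 * a z.2) := by
  simp only [pointSum, offSum, ← Finset.sum_add_distrib, sq, Finset.sum_mul_sum]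
  refine Finset.sum_congr rfl fun i hi => ?_
  rw [Finset.add_sum_erase _ (fun i' => a (pt τ i) * a (pt τ i')) hi]

/-! ### First and second moments of sums over points -/

section Moments

variable {ν : Measure ObsTimes} {η : ℝ × ℝ → ℝ} {f : (ℝ × ℝ) × (ℝ × ℝ) → ℝ}

/-- The intensity extended by zero outside the unit square. -/
noncomputable def etaExt (η : ℝ × ℝ → ℝ) : ℝ × ℝ → ℝ := unitSq.indicator η

lemma measurableSet_unitSq : MeasurableSet unitSq := measurableSet_Icc.prod measurableSet_Icc

lemma isCompact_unitSq : IsCompact unitSq := isCompact_Icc.prod isCompact_Icc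

namespace ObservationCondition

lemma etaExt_nonneg (h : ObservationCondition ν η f) (z : ℝ × ℝ) : 0 ≤ etaExt η z :=
  indicator_nonneg h.eta_nonneg z

lemma measurable_etaExt (h : ObservationCondition ν η f) : Measurable (etaExt η) := by
  have hc := h.eta_smooth.continuousOn
  have : etaExt η = unitSq.piecewise η 0 := by
    rw [etaExt, piecewise_eq_indicator]
  rw [this]
  exact hc.measurable_piecewise continuousOn_const measurableSet_unitSq

lemma exists_etaExt_le (h : ObservationCondition ν η f) :
    ∃ c : ℝ≥0, ∀ z, etaExt η z ≤ c := by
  obtain ⟨c, hc⟩ := isCompact_unitSq.exists_bound_of_continuousOn h.eta_smooth.continuousOn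
  refine ⟨c.toNNReal, fun z => ?_⟩
  by_cases hz : z ∈ unitSq
  · rw [etaExt, indicator_of_mem hz]
    exact (le_abs_self _).trans ((hc z hz).trans (Real.le_coe_toNNReal c))
  · rw [etaExt, indicator_of_notMem hz]; positivity

/-- Campbell's formula for the mean of a sum over points. -/
lemma lintegral_pointSum (h : ObservationCondition ν η f) {g : ℝ × ℝ → ℝ≥0∞} (hg : Measurable g) :
    ∫⁻ τ, pointSum τ g ∂ν = ∫⁻ z, g z * ENNReal.ofReal (etaExt η z) := by
  have hbind : ν.bind dNstar = volume.withDensity fun z => ENNReal.ofReal (etaExt η z) := by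
    refine Measure.ext fun B hB => ?_
    rw [Measure.bind_apply hB measurable_dNstar.aemeasurable, h.intensity B hB,
      withDensity_apply _ hB, inter_comm, ← Measure.restrict_restrict measurableSet_unitSq,
      ← lintegral_indicator measurableSet_unitSq]
    congr 1 with z
    by_cases hz : z ∈ unitSq
    · rw [etaExt, indicator_of_mem hz, indicator_of_mem hz]
    · rw [etaExt, indicator_of_notMem hz, indicator_of_notMem hz, ENNReal.ofReal_zero]
  simp_rw [← lintegral_dNstar]
  rw [← Measure.lintegral_bind measurable_dNstar.aemeasurable hg.aemeasurable, hbind,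
    lintegral_withDensity_eq_lintegral_mul _ h.measurable_etaExt.ennreal_ofReal hg]
  simp_rw [Pi.mul_apply, mul_comm]

lemma ae_pt_mem (h : ObservationCondition ν η f) :
    ∀ᵐ τ ∂ν, ∀ i ∈ pts τ, pt τ i ∈ unitSq := by
  have h0 := h.lintegral_pointSum (g := unitSqᶜ.indicator 1)
    (measurable_one.indicator measurableSet_unitSq.compl)
  have h1 : ∫⁻ z, unitSqᶜ.indicator (1 : ℝ × ℝ → ℝ≥0∞) z * ENNReal.ofReal (etaExt η z) = 0 := by
    rw [← lintegral_zero (μ := (volume : Measure (ℝ × ℝ)))]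
    congr 1 with z
    by_cases hz : z ∈ unitSq
    · rw [indicator_of_notMem (by simpa only [mem_compl_iff, not_not] using hz), zero_mul]
    · rw [etaExt, indicator_of_notMem hz, ENNReal.ofReal_zero, mul_zero]
  rw [h1, lintegral_eq_zero_iff] at h0
  · filter_upwards [h0] with τ hτ i hi
    by_contra hc
    have := (Finset.sum_eq_zero_iff.1 hτ) i hi
    rw [indicator_of_mem (by exact hc)] at this
    exact one_ne_zero this
  · exact measurable_pointSum (measurable_one.indicator measurableSet_unitSq.compl)

/-- Four sign regions cover `offDiag` and have compact closures. The one-sided limits bound `f` near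
every point of such a closure, and finitely many neighbourhoods suffice. Only this bound on the pair
intensity enters what follows. -/
lemma exists_pair_intensity_le (h : ObservationCondition ν η f) :
    ∃ c : ℝ≥0, ∀ z ∈ offDiag, f z * η z.2 ≤ c := by
  have hpart : ∀ a ∈ ({1, -1} : Set ℝ), ∀ b ∈ ({1, -1} : Set ℝ),
      ∃ c : ℝ, 0 ≤ c ∧ ∀ z ∈ offDiagPart a b, f z ≤ c := by
    intro a ha b hb
    have hK : IsCompact (closure (offDiagPart a b)) :=
      (isCompact_unitSq.prod isCompact_unitSq).closure_of_subset fun z hz => hz.1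
    have key := hK.induction_on (p := fun s => ∃ c : ℝ, 0 ≤ c ∧ ∀ z ∈ s ∩ offDiagPart a b, f z ≤ c)
      ⟨0, le_rfl, by simp⟩
      (fun s t hst ⟨c, hc0, hc⟩ => ⟨c, hc0, fun z hz => hc z ⟨hst hz.1, hz.2⟩⟩)
      (fun s t ⟨c, hc0, hc⟩ ⟨d, hd0, hd⟩ => ⟨max c d, le_max_of_le_left hc0, fun z hz =>
        hz.1.elim (fun h1 => (hc z ⟨h1, hz.2⟩).trans (le_max_left _ _))
          (fun h1 => (hd z ⟨h1, hz.2⟩).trans (le_max_right _ _))⟩)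
      (fun z hz => by
        obtain ⟨l, hl⟩ := h.f_limits a ha b hb z hz
        have := hl.eventually (Iio_mem_nhds (lt_add_one l))
        rw [eventually_nhdsWithin_iff] at this
        exact ⟨_, mem_nhdsWithin_of_mem_nhds this, max 0 (l + 1), le_max_left _ _,
          fun y hy => (hy.1 hy.2).le.trans (le_max_right _ _)⟩)
    obtain ⟨c, hc0, hc⟩ := key
    exact ⟨c, hc0, fun z hz => hc z ⟨subset_closure hz, hz⟩⟩
  obtain ⟨c₁, h10, h1⟩ := hpart 1 (by simp) 1 (by simp)
  obtain ⟨c₂, h20, h2⟩ := hpart 1 (by simp) (-1) (by simp)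
  obtain ⟨c₃, h30, h3⟩ := hpart (-1) (by simp) 1 (by simp)
  obtain ⟨c₄, h40, h4⟩ := hpart (-1) (by simp) (-1) (by simp)
  obtain ⟨d, hd⟩ := h.exists_etaExt_le
  have hf : ∀ z ∈ offDiag, f z ≤ c₁ + c₂ + c₃ + c₄ := by
    rintro z ⟨hz, hz1, hz2⟩
    rcases hz1.lt_or_gt with h1' | h1' <;> rcases hz2.lt_or_gt with h2' | h2'
    · have := h4 z ⟨hz, by linarith, by linarith⟩; linarith
    · have := h3 z ⟨hz, by linarith, by linarith⟩; linarith
    · have := h2 z ⟨hz, by linarith, by linarith⟩; linarith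
    · have := h1 z ⟨hz, by linarith, by linarith⟩; linarith
  refine ⟨(c₁ + c₂ + c₃ + c₄).toNNReal * d, fun z hz => ?_⟩
  have he : η z.2 ≤ d := by
    have := hd z.2
    rwa [etaExt, indicator_of_mem hz.1.2] at this
  rw [NNReal.coe_mul, Real.coe_toNNReal _ (by positivity)]
  exact mul_le_mul (hf z hz) he (h.eta_nonneg _ hz.1.2) (by positivity)

/-- The unit cube. -/
abbrev _root_.AsyncVC.unitCube : Set (ℝ × ℝ × ℝ) := unitI ×ˢ unitSq

lemma _root_.AsyncVC.measurableSet_unitCube : MeasurableSet unitCube :=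
  measurableSet_Icc.prod measurableSet_unitSq

/-- The mean of a sum over pairs of distinct points. -/
lemma exists_lintegral_offSum_le (h : ObservationCondition ν η f) :
    ∃ c : ℝ≥0, ∀ G : (ℝ × ℝ) × (ℝ × ℝ) → ℝ≥0∞, Measurable G →
      ∫⁻ τ, offSum τ G ∂ν ≤ c * ((∫⁻ z in unitSq ×ˢ unitSq, G z)
        + (∫⁻ z in unitCube, G ((z.1, z.2.1), (z.1, z.2.2)))
        + ∫⁻ z in unitCube, G ((z.2.1, z.1), (z.2.2, z.1))) := by
  obtain ⟨c₁, h1⟩ := h.exists_pair_intensity_le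
  obtain ⟨c₂, h2⟩ := h.shared_intensity
  have hsq := measurableSet_unitSq.prod measurableSet_unitSq
  refine ⟨max c₁ c₂, fun G hG => ?_⟩
  -- Almost surely all points lie in the unit square, so `G` may be cut off there. This confines the
  -- shared-time bounds, which are against Lebesgue measure on all of `ℝ³`, to the unit cube.
  set G' : (ℝ × ℝ) × (ℝ × ℝ) → ℝ≥0∞ := (unitSq ×ˢ unitSq).indicator G with hG'
  have hG'm : Measurable G' := hG.indicator hsq
  have hae : ∀ᵐ τ ∂ν, offSum τ G = offSum τ G' := by
    filter_upwards [h.ae_pt_mem] with τ hτ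
    refine Finset.sum_congr rfl fun i hi => Finset.sum_congr rfl fun i' hi' => ?_
    have hmem : (pt τ i, pt τ i') ∈ unitSq ×ˢ unitSq :=
      ⟨hτ i hi, hτ i' (Finset.mem_of_mem_erase hi')⟩
    rw [hG', indicator_of_mem hmem]
  have hT : Measurable fun z : ℝ × ℝ × ℝ => G' ((z.1, z.2.1), (z.1, z.2.2)) :=
    hG'm.comp (by fun_prop)
  have hS : Measurable fun z : ℝ × ℝ × ℝ => G' ((z.2.1, z.1), (z.2.2, z.1)) :=
    hG'm.comp (by fun_prop)
  have i1 : ∫⁻ τ, ∫⁻ z, G' z ∂dPairs τ ∂ν ≤ c₁ * ∫⁻ z in unitSq ×ˢ unitSq, G z := by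
    refine (lintegral_lintegral_le_of_forall_le measurable_dPairs
      (m := (c₁ : ℝ≥0∞) • volume) (fun B hB => ?_) hG'm).trans ?_
    · have hoff : MeasurableSet offDiag := by
        refine hsq.inter (MeasurableSet.inter ?_ ?_)
        · exact (measurableSet_eq_fun (by fun_prop) (by fun_prop)).compl
        · exact (measurableSet_eq_fun (by fun_prop) (by fun_prop)).compl
      rw [h.pair_intensity B hB]
      calc ∫⁻ z in B ∩ offDiag, ENNReal.ofReal (f z * η z.2)
          ≤ ∫⁻ z in B ∩ offDiag, (c₁ : ℝ≥0∞) := by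
            refine setLIntegral_mono measurable_const fun z hz => ?_
            exact ENNReal.ofReal_le_of_le_toReal (by simpa using h1 z hz.2)
        _ ≤ _ := by
            rw [setLIntegral_const, Measure.smul_apply, smul_eq_mul]
            exact mul_le_mul_right (measure_mono inter_subset_left) _
    · rw [lintegral_smul_measure, hG', lintegral_indicator hsq, smul_eq_mul]
  have i2 : ∫⁻ τ, ∫⁻ z, G' ((z.1, z.2.1), (z.1, z.2.2)) ∂dSharedT τ ∂ν ≤
      c₂ * ∫⁻ z in unitCube, G ((z.1, z.2.1), (z.1, z.2.2)) := by
    refine (lintegral_lintegral_le_of_forall_le measurable_dSharedT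
      (m := (c₂ : ℝ≥0∞) • volume) (fun B hB => (h2 B hB).1) hT).trans ?_
    rw [lintegral_smul_measure, smul_eq_mul, ← lintegral_indicator measurableSet_unitCube]
    refine mul_le_mul_right (lintegral_mono fun z => ?_) _
    by_cases hz : z ∈ unitCube
    · rw [indicator_of_mem hz]; exact indicator_le_self _ _ _
    · rw [indicator_of_notMem hz, hG', indicator_of_notMem]
      exact fun hc => hz ⟨hc.1.1, hc.1.2, hc.2.2⟩
  have i3 : ∫⁻ τ, ∫⁻ z, G' ((z.2.1, z.1), (z.2.2, z.1)) ∂dSharedS τ ∂ν ≤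
      c₂ * ∫⁻ z in unitCube, G ((z.2.1, z.1), (z.2.2, z.1)) := by
    refine (lintegral_lintegral_le_of_forall_le measurable_dSharedS
      (m := (c₂ : ℝ≥0∞) • volume) (fun B hB => (h2 B hB).2) hS).trans ?_
    rw [lintegral_smul_measure, smul_eq_mul, ← lintegral_indicator measurableSet_unitCube]
    refine mul_le_mul_right (lintegral_mono fun z => ?_) _
    by_cases hz : z ∈ unitCube
    · rw [indicator_of_mem hz]; exact indicator_le_self _ _ _
    · rw [indicator_of_notMem hz, hG', indicator_of_notMem]
      exact fun hc => hz ⟨hc.1.2, hc.1.1, hc.2.1⟩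
  rw [lintegral_congr_ae hae]
  simp_rw [offSum_eq]
  have mS : Measurable fun τ => ∫⁻ z, G' ((z.2.1, z.1), (z.2.2, z.1)) ∂dSharedS τ :=
    (Measure.measurable_lintegral hS).comp measurable_dSharedS
  have mT : Measurable fun τ => ∫⁻ z, G' ((z.1, z.2.1), (z.1, z.2.2)) ∂dSharedT τ :=
    (Measure.measurable_lintegral hT).comp measurable_dSharedT
  rw [lintegral_add_right _ mS, lintegral_add_right _ mT, mul_add, mul_add]
  have l1 : (c₁ : ℝ≥0∞) ≤ (max c₁ c₂ : ℝ≥0) := by exact_mod_cast le_max_left _ _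
  have l2 : (c₂ : ℝ≥0∞) ≤ (max c₁ c₂ : ℝ≥0) := by exact_mod_cast le_max_right _ _
  gcongr
  · exact i1.trans (by gcongr)
  · exact i2.trans (by gcongr)
  · exact i3.trans (by gcongr)

/-- The second moment of a sum over points. -/
lemma exists_lintegral_sq_pointSum_le (h : ObservationCondition ν η f) :
    ∃ c : ℝ≥0, ∀ a : ℝ × ℝ → ℝ≥0∞, Measurable a →
      ∫⁻ τ, pointSum τ a ^ 2 ∂ν ≤ c * ∫⁻ z in unitSq, a z ^ 2 := by
  obtain ⟨c₁, h1⟩ := h.exists_etaExt_le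
  obtain ⟨c₂, h2⟩ := h.exists_lintegral_offSum_le
  refine ⟨c₁ + 3 * c₂, fun a ha => ?_⟩
  have ha2 : Measurable fun z => a z ^ 2 := ha.pow_const 2
  set I := ∫⁻ z in unitSq, a z ^ 2 with hI
  have hvol : volume unitI = 1 := by simp
  have hvol2 : volume unitSq = 1 := by
    rw [Measure.volume_eq_prod, Measure.prod_prod, hvol, one_mul]
  -- the diagonal part
  have hdiag : ∫⁻ τ, pointSum τ (fun z => a z ^ 2) ∂ν ≤ c₁ * I := by
    rw [h.lintegral_pointSum ha2, hI, ← lintegral_const_mul _ ha2,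
      ← lintegral_indicator measurableSet_unitSq]
    refine lintegral_mono fun z => ?_
    by_cases hz : z ∈ unitSq
    · rw [indicator_of_mem hz, mul_comm]
      exact mul_le_mul_left (ENNReal.ofReal_le_of_le_toReal (by simpa using h1 z)) _
    · simp only [etaExt, indicator_of_notMem hz, ENNReal.ofReal_zero, mul_zero, le_refl]
  -- the pairs
  have hyoung : ∀ x y : ℝ≥0∞, x * y ≤ 2⁻¹ * (x ^ 2 + y ^ 2) := by
    intro x y
    have h3 : 2 * (x * y) ≤ x ^ 2 + y ^ 2 := by
      rcases eq_or_ne x ⊤ with rfl | hx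
      · simp
      rcases eq_or_ne y ⊤ with rfl | hy
      · simp
      lift x to ℝ≥0 using hx
      lift y to ℝ≥0 using hy
      have := two_mul_le_add_sq x y
      rw [mul_assoc] at this
      exact_mod_cast this
    calc x * y = 2⁻¹ * (2 * (x * y)) := by
          rw [← mul_assoc, ENNReal.inv_mul_cancel (by simp) (by simp), one_mul]
      _ ≤ _ := by gcongr
  -- Once the product is replaced by a half sum of squares, each summand leaves some coordinates
  -- free. These range over sets of volume one, so all three pair integrals equal `I`.
  set G : (ℝ × ℝ) × (ℝ × ℝ) → ℝ≥0∞ := fun z => 2⁻¹ * (a z.1 ^ 2 + a z.2 ^ 2) with hG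
  have hGm : Measurable G := by fun_prop
  have hhalf : ∀ {B : Type} [MeasurableSpace B] (m : Measure B) (u v : B → ℝ≥0∞),
      Measurable u → ∫⁻ z, u z ∂m = I → ∫⁻ z, v z ∂m = I →
      ∫⁻ z, 2⁻¹ * (u z + v z) ∂m = I := by
    intro B _ m u v hu hu' hv'
    rw [lintegral_const_mul' _ _ (by simp), lintegral_add_left hu, hu', hv', ← two_mul,
      ← mul_assoc, ENNReal.inv_mul_cancel (by simp) (by simp), one_mul]
  have hpair : ∫⁻ z in unitSq ×ˢ unitSq, G z = I := by
    rw [Measure.volume_eq_prod, ← Measure.prod_restrict]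
    refine hhalf _ _ _ (by fun_prop) ?_ ?_
    · rw [lintegral_prod _ (by fun_prop)]
      simp only [lintegral_const, Measure.restrict_apply_univ, hvol2, mul_one, hI]
    · rw [lintegral_prod _ (by fun_prop)]
      simp only [lintegral_const, Measure.restrict_apply_univ, hvol2, mul_one, hI]
  have e1 : ∫⁻ x in unitI, ∫⁻ y in unitI, a (x, y) ^ 2 = I := by
    rw [hI, Measure.volume_eq_prod, ← Measure.prod_restrict, lintegral_prod _ (by fun_prop)]
  have e2 : ∫⁻ x in unitI, ∫⁻ y in unitI, a (y, x) ^ 2 = I := by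
    rw [hI, Measure.volume_eq_prod, ← Measure.prod_restrict,
      lintegral_prod_symm _ (by fun_prop)]
  have hT : ∫⁻ z in unitCube, G ((z.1, z.2.1), (z.1, z.2.2)) = I := by
    rw [Measure.volume_eq_prod, ← Measure.prod_restrict, Measure.volume_eq_prod,
      ← Measure.prod_restrict]
    refine hhalf _ _ _ (by fun_prop) ?_ ?_
    · rw [lintegral_prod _ (by fun_prop), ← e1]
      congr 1 with x
      rw [lintegral_prod _ (by fun_prop)]
      simp only [lintegral_const, Measure.restrict_apply_univ, hvol, mul_one]
    · rw [lintegral_prod _ (by fun_prop), ← e1]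
      congr 1 with x
      rw [lintegral_prod _ (by fun_prop)]
      simp only [lintegral_const, Measure.restrict_apply_univ, hvol, mul_one]
  have hS : ∫⁻ z in unitCube, G ((z.2.1, z.1), (z.2.2, z.1)) = I := by
    rw [Measure.volume_eq_prod, ← Measure.prod_restrict, Measure.volume_eq_prod,
      ← Measure.prod_restrict]
    refine hhalf _ _ _ (by fun_prop) ?_ ?_
    · rw [lintegral_prod _ (by fun_prop), ← e2]
      congr 1 with x
      rw [lintegral_prod _ (by fun_prop)]
      simp only [lintegral_const, Measure.restrict_apply_univ, hvol, mul_one]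
    · rw [lintegral_prod _ (by fun_prop), ← e2]
      congr 1 with x
      rw [lintegral_prod _ (by fun_prop)]
      simp only [lintegral_const, Measure.restrict_apply_univ, hvol, mul_one]
  have hoff : ∫⁻ τ, offSum τ (fun z => a z.1 * a z.2) ∂ν ≤ 3 * c₂ * I := by
    calc ∫⁻ τ, offSum τ (fun z => a z.1 * a z.2) ∂ν ≤ ∫⁻ τ, offSum τ G ∂ν := by
          refine lintegral_mono fun τ => Finset.sum_le_sum fun i _ => Finset.sum_le_sum fun i' _ => ?_
          exact hyoung _ _
      _ ≤ c₂ * (I + I + I) := by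
          have := h2 G hGm
          rwa [hpair, hT, hS] at this
      _ = 3 * c₂ * I := by ring
  calc ∫⁻ τ, pointSum τ a ^ 2 ∂ν
      = ∫⁻ τ, pointSum τ (fun z => a z ^ 2) ∂ν + ∫⁻ τ, offSum τ (fun z => a z.1 * a z.2) ∂ν := by
        simp_rw [sq_pointSum]
        exact lintegral_add_left (measurable_pointSum ha2) _
    _ ≤ c₁ * I + 3 * c₂ * I := add_le_add hdiag hoff
    _ = _ := by push_cast; ring

end ObservationCondition

end Moments

/-! ### Rescaling around the point of interest -/

/-- The map `x ↦ (t + h₁ x₁, t + h₂ x₂)`. -/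
def rescale (t h₁ h₂ : ℝ) (x : ℝ × ℝ) : ℝ × ℝ := (t + h₁ * x.1, t + h₂ * x.2)

/-- The scaled kernel centred at `t`. -/
noncomputable def kern (κ : ℝ × ℝ → ℝ) (h₁ h₂ t : ℝ) (z : ℝ × ℝ) : ℝ :=
  scaledKernel κ h₁ h₂ (z.1 - t) (z.2 - t)

lemma measurable_rescale (t h₁ h₂ : ℝ) : Measurable (rescale t h₁ h₂) := by
  unfold rescale; fun_prop

lemma measurable_kern {κ : ℝ × ℝ → ℝ} (hκ : Measurable κ) (h₁ h₂ t : ℝ) :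
    Measurable (kern κ h₁ h₂ t) := by
  unfold kern scaledKernel
  exact (hκ.comp (by fun_prop)).div_const _

lemma kern_rescale {κ : ℝ × ℝ → ℝ} {h₁ h₂ : ℝ} (h1 : 0 < h₁) (h2 : 0 < h₂) (t : ℝ) (x : ℝ × ℝ) :
    kern κ h₁ h₂ t (rescale t h₁ h₂ x) = κ x / (h₁ * h₂) := by
  simp [kern, rescale, scaledKernel, mul_div_cancel_left₀ _ h1.ne', mul_div_cancel_left₀ _ h2.ne']

lemma map_add_mul_volume (t : ℝ) {h : ℝ} (hh : 0 < h) :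
    Measure.map (fun x => t + h * x) volume = ENNReal.ofReal h⁻¹ • (volume : Measure ℝ) := by
  have h1 : (fun x => t + h * x) = (fun x => t + x) ∘ (fun x => h * x) := rfl
  rw [h1, ← Measure.map_map (by fun_prop) (by fun_prop), Real.map_volume_mul_left hh.ne',
    Measure.map_smul, map_add_left_eq_self, abs_of_pos (inv_pos.2 hh)]

lemma map_rescale_volume (t : ℝ) {h₁ h₂ : ℝ} (h1 : 0 < h₁) (h2 : 0 < h₂) :
    Measure.map (rescale t h₁ h₂) volume
      = ENNReal.ofReal (h₁ * h₂)⁻¹ • (volume : Measure (ℝ × ℝ)) := by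
  have : rescale t h₁ h₂ = Prod.map (fun x => t + h₁ * x) (fun x => t + h₂ * x) := rfl
  rw [this, Measure.volume_eq_prod, ← Measure.map_prod_map _ _ (by fun_prop) (by fun_prop),
    map_add_mul_volume t h1, map_add_mul_volume t h2, Measure.prod_smul_left,
    Measure.prod_smul_right, smul_smul, ← ENNReal.ofReal_mul (by positivity), mul_inv]

lemma volume_eq_smul_map_rescale (t : ℝ) {h₁ h₂ : ℝ} (h1 : 0 < h₁) (h2 : 0 < h₂) :
    (volume : Measure (ℝ × ℝ)) =
      ENNReal.ofReal (h₁ * h₂) • Measure.map (rescale t h₁ h₂) volume := by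
  rw [map_rescale_volume t h1 h2, smul_smul, ← ENNReal.ofReal_mul (by positivity),
    mul_inv_cancel₀ (by positivity), ENNReal.ofReal_one, one_smul]

lemma measurableEmbedding_rescale (t : ℝ) {h₁ h₂ : ℝ} (h1 : 0 < h₁) (h2 : 0 < h₂) :
    MeasurableEmbedding (rescale t h₁ h₂) := by
  have hinv : Function.LeftInverse
      (fun z : ℝ × ℝ => ((z.1 - t) / h₁, (z.2 - t) / h₂)) (rescale t h₁ h₂) := by
    intro x
    simp [rescale, mul_div_cancel_left₀ _ h1.ne', mul_div_cancel_left₀ _ h2.ne']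
  have hinv' : Function.RightInverse
      (fun z : ℝ × ℝ => ((z.1 - t) / h₁, (z.2 - t) / h₂)) (rescale t h₁ h₂) := by
    intro x
    simp [rescale, mul_div_cancel₀ _ h1.ne', mul_div_cancel₀ _ h2.ne']
  exact (MeasurableEquiv.measurableEmbedding
    ⟨⟨rescale t h₁ h₂, _, hinv, hinv'⟩, measurable_rescale t h₁ h₂, by
      change Measurable (fun z : ℝ × ℝ => ((z.1 - t) / h₁, (z.2 - t) / h₂)); fun_prop⟩)

lemma lintegral_rescale (t : ℝ) {h₁ h₂ : ℝ} (h1 : 0 < h₁) (h2 : 0 < h₂) (g : ℝ × ℝ → ℝ≥0∞) :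
    ∫⁻ z, g z = ENNReal.ofReal (h₁ * h₂) * ∫⁻ x, g (rescale t h₁ h₂ x) := by
  conv_lhs => rw [volume_eq_smul_map_rescale t h1 h2]
  rw [lintegral_smul_measure, (measurableEmbedding_rescale t h1 h2).lintegral_map, smul_eq_mul]

lemma integral_rescale {F : Type*} [NormedAddCommGroup F] [NormedSpace ℝ F]
    (t : ℝ) {h₁ h₂ : ℝ} (h1 : 0 < h₁) (h2 : 0 < h₂) (g : ℝ × ℝ → F) :
    ∫ z, g z = (h₁ * h₂) • ∫ x, g (rescale t h₁ h₂ x) := by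
  conv_lhs => rw [volume_eq_smul_map_rescale t h1 h2]
  rw [integral_smul_measure, (measurableEmbedding_rescale t h1 h2).integral_map,
    ENNReal.toReal_ofReal (by positivity)]

/-- Scaling preserves the `L¹` norm of the kernel but multiplies its squared `L²` norm by `1 / (h₁ *
h₂)`, as the lemmas below record. This is what makes `n h₁ h₂` the effective sample size. -/
lemma lintegral_enorm_kern {κ : ℝ × ℝ → ℝ} {h₁ h₂ : ℝ} (h1 : 0 < h₁) (h2 : 0 < h₂) (t : ℝ) :
    ∫⁻ z, ‖kern κ h₁ h₂ t z‖ₑ = ∫⁻ x, ‖κ x‖ₑ := by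
  have hpos : 0 < h₁ * h₂ := by positivity
  rw [lintegral_rescale t h1 h2, ← lintegral_const_mul' _ _ ENNReal.ofReal_ne_top]
  congr 1 with x
  rw [kern_rescale h1 h2, ← Real.enorm_eq_ofReal hpos.le, ← enorm_mul, mul_div_cancel₀ _ hpos.ne']

lemma lintegral_enorm_sq_kern_indicator {κ : ℝ × ℝ → ℝ} {h₁ h₂ : ℝ} (h1 : 0 < h₁) (h2 : 0 < h₂)
    (t : ℝ) {A : Set (ℝ × ℝ)} (hA : MeasurableSet A) :
    ENNReal.ofReal (h₁ * h₂) * ∫⁻ z in A, ‖kern κ h₁ h₂ t z‖ₑ ^ 2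
      = ∫⁻ x in rescale t h₁ h₂ ⁻¹' A, ‖κ x‖ₑ ^ 2 := by
  have hpos : 0 < h₁ * h₂ := by positivity
  rw [← lintegral_indicator hA, lintegral_rescale t h1 h2,
    ← lintegral_const_mul' _ _ ENNReal.ofReal_ne_top,
    ← lintegral_const_mul' _ _ ENNReal.ofReal_ne_top,
    ← lintegral_indicator (measurable_rescale t h₁ h₂ hA)]
  congr 1 with x
  by_cases hx : rescale t h₁ h₂ x ∈ A
  · have hx' : x ∈ rescale t h₁ h₂ ⁻¹' A := hx
    rw [indicator_of_mem hx, indicator_of_mem hx', kern_rescale h1 h2, ← mul_assoc, ← sq,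
      ← Real.enorm_eq_ofReal hpos.le, ← mul_pow, ← enorm_mul, mul_div_cancel₀ _ hpos.ne']
  · have hx' : x ∉ rescale t h₁ h₂ ⁻¹' A := hx
    rw [indicator_of_notMem hx, indicator_of_notMem hx', mul_zero, mul_zero]

lemma lintegral_enorm_sq_kern {κ : ℝ × ℝ → ℝ} {h₁ h₂ : ℝ} (h1 : 0 < h₁) (h2 : 0 < h₂) (t : ℝ) :
    ENNReal.ofReal (h₁ * h₂) * ∫⁻ z, ‖kern κ h₁ h₂ t z‖ₑ ^ 2 = ∫⁻ x, ‖κ x‖ₑ ^ 2 := by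
  simpa using lintegral_enorm_sq_kern_indicator (κ := κ) h1 h2 t MeasurableSet.univ

/-! ### Local expansions of a twice differentiable function extended by zero -/

lemma exists_indicator_bound {F : ℝ × ℝ → ℝ} (hF : ContinuousOn F unitSq) :
    ∃ c : ℝ, 0 ≤ c ∧ ∀ z, |unitSq.indicator F z| ≤ c := by
  obtain ⟨c, hc⟩ := isCompact_unitSq.exists_bound_of_continuousOn hF
  refine ⟨max c 0, le_max_right _ _, fun z => ?_⟩
  by_cases hz : z ∈ unitSq
  · rw [indicator_of_mem hz]; exact (hc z hz).trans (le_max_left _ _)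
  · rw [indicator_of_notMem hz, abs_zero]; exact le_max_right _ _

lemma unitSq_mem_nhds {t : ℝ} (ht : t ∈ Ioo (0 : ℝ) 1) : unitSq ∈ 𝓝 (t, t) :=
  prod_mem_nhds (Icc_mem_nhds ht.1 ht.2) (Icc_mem_nhds ht.1 ht.2)

/-- Second-order expansion at an interior point, valid globally after extension by zero. -/
lemma exists_taylor_two {F : ℝ × ℝ → ℝ} (hF : ContDiffOn ℝ 2 F unitSq) {t : ℝ}
    (ht : t ∈ Ioo (0 : ℝ) 1) :
    ∃ l₁ l₂ L : ℝ, 0 ≤ L ∧ ∀ v : ℝ × ℝ,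
      |unitSq.indicator F (t + v.1, t + v.2) - F (t, t) - l₁ * v.1 - l₂ * v.2|
        ≤ L * (v.1 ^ 2 + v.2 ^ 2) := by
  set a : ℝ × ℝ := (t, t) with ha
  have hat : ContDiffAt ℝ 2 F a := hF.contDiffAt (unitSq_mem_nhds ht)
  obtain ⟨K, s, hs, hK⟩ := (hat.fderiv_right (m := 1) (by norm_num)).exists_lipschitzOnWith
  have hd : ∀ᶠ z in 𝓝 a, DifferentiableAt ℝ F z :=
    (hat.eventually (by simp)).mono fun z hz => hz.differentiableAt (by norm_num)
  obtain ⟨ε, hε, hball⟩ := Metric.mem_nhds_iff.1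
    (inter_mem (inter_mem hs hd) (unitSq_mem_nhds ht))
  obtain ⟨c, hc0, hc⟩ := exists_indicator_bound hF.continuousOn
  set φ := fderiv ℝ F a with hφ
  have hlin : ∀ v : ℝ × ℝ, φ v = φ (1, 0) * v.1 + φ (0, 1) * v.2 := by
    intro v
    have : v = v.1 • ((1 : ℝ), (0 : ℝ)) + v.2 • ((0 : ℝ), (1 : ℝ)) := by ext <;> simp
    conv_lhs => rw [this, map_add, map_smul, map_smul]
    simp [mul_comm]
  have hnorm : ∀ v : ℝ × ℝ, ‖v‖ ^ 2 ≤ v.1 ^ 2 + v.2 ^ 2 := by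
    intro v
    rw [Prod.norm_def]
    rcases max_cases ‖v.1‖ ‖v.2‖ with h | h <;> rw [h.1, Real.norm_eq_abs, sq_abs] <;> nlinarith [sq_nonneg v.1, sq_nonneg v.2]
  -- `K` is the Lipschitz constant of the derivative near `a` and settles `‖v‖ < ε`. Farther away
  -- only the bound `c` is available, and `1 ≤ ‖v‖ / ε` turns `2 * c` and `‖φ‖ * ‖v‖` into multiples
  -- of `‖v‖ ^ 2`.
  refine ⟨φ (1, 0), φ (0, 1), K + (2 * c / ε ^ 2 + ‖φ‖ / ε), by positivity, fun v => ?_⟩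
  have hav : (t + v.1, t + v.2) = a + v := by rw [ha]; rfl
  have hrw : unitSq.indicator F (t + v.1, t + v.2) - F (t, t) - φ (1, 0) * v.1 - φ (0, 1) * v.2
      = unitSq.indicator F (a + v) - F a - φ v := by rw [hav, hlin v]; ring
  rw [hrw]
  refine le_trans ?_ (mul_le_mul_of_nonneg_left (hnorm v) (by positivity))
  rcases lt_or_ge ‖v‖ ε with hv | hv
  · have hmem : a + v ∈ Metric.ball a ε := by simpa using hv
    rw [indicator_of_mem (hball hmem).2]
    have hconv : Convex ℝ (Metric.closedBall a ‖v‖) := convex_closedBall _ _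
    have hsub : Metric.closedBall a ‖v‖ ⊆ Metric.ball a ε := Metric.closedBall_subset_ball hv
    have := hconv.norm_image_sub_le_of_norm_hasFDerivWithin_le' (f := F) (f' := fderiv ℝ F)
      (φ := φ) (C := K * ‖v‖) (x := a) (y := a + v)
      (fun z hz => ((hball (hsub hz)).1.2 : DifferentiableAt ℝ F z).hasFDerivAt.hasFDerivWithinAt)
      (fun z hz => by
        have h1 := hK.dist_le_mul z (hball (hsub hz)).1.1 a (mem_of_mem_nhds hs)
        rw [dist_eq_norm] at h1
        exact h1.trans (by gcongr; exact hz))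
      (Metric.mem_closedBall_self (norm_nonneg _)) (by simp)
    rw [add_sub_cancel_left, Real.norm_eq_abs] at this
    refine this.trans ?_
    have h2 : 0 ≤ (2 * c / ε ^ 2 + ‖φ‖ / ε) * ‖v‖ ^ 2 := by positivity
    nlinarith
  · have h1 : |unitSq.indicator F (a + v)| ≤ c := hc _
    have h2 : |F a| ≤ c := by
      have := hc a
      rwa [indicator_of_mem (mem_of_mem_nhds (unitSq_mem_nhds ht))] at this
    have h3 : |φ v| ≤ ‖φ‖ * ‖v‖ := φ.le_opNorm v
    have h4 : |unitSq.indicator F (a + v) - F a - φ v| ≤ c + c + ‖φ‖ * ‖v‖ :=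
      (abs_sub _ _).trans (add_le_add ((abs_sub _ _).trans (add_le_add h1 h2)) h3)
    refine h4.trans ?_
    have h5 : 1 ≤ ‖v‖ / ε := (one_le_div hε).2 hv
    have h6 : 2 * c ≤ 2 * c / ε ^ 2 * ‖v‖ ^ 2 := by
      have : 2 * c / ε ^ 2 * ‖v‖ ^ 2 = 2 * c * (‖v‖ / ε) ^ 2 := by field_simp
      rw [this]
      exact le_mul_of_one_le_right (by positivity) (one_le_pow₀ h5)
    have h7 : ‖φ‖ * ‖v‖ ≤ ‖φ‖ / ε * ‖v‖ ^ 2 := by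
      have : ‖φ‖ / ε * ‖v‖ ^ 2 = ‖φ‖ * ‖v‖ * (‖v‖ / ε) := by field_simp
      rw [this]
      exact le_mul_of_one_le_right (by positivity) h5
    have h8 : 0 ≤ (K : ℝ) * ‖v‖ ^ 2 := by positivity
    linarith

/-- Lipschitz estimate at an interior point, valid globally after extension by zero. -/
lemma exists_lipschitz_at {F : ℝ × ℝ → ℝ} (hF : ContDiffOn ℝ 2 F unitSq) {t : ℝ}
    (ht : t ∈ Ioo (0 : ℝ) 1) :
    ∃ L : ℝ, 0 ≤ L ∧ ∀ v : ℝ × ℝ,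
      |unitSq.indicator F (t + v.1, t + v.2) - F (t, t)| ≤ L * (|v.1| + |v.2|) := by
  obtain ⟨l₁, l₂, L, hL, h⟩ := exists_taylor_two hF ht
  obtain ⟨c, hc0, hc⟩ := exists_indicator_bound hF.continuousOn
  -- The first three terms come from the second-order expansion when `|v.1| + |v.2| ≤ 1`; beyond
  -- that, `2 * c` bounds the increment.
  refine ⟨|l₁| + |l₂| + L + 2 * c, by positivity, fun v => ?_⟩
  have hv1 := abs_nonneg v.1
  have hv2 := abs_nonneg v.2
  rcases le_total (|v.1| + |v.2|) 1 with hv | hv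
  · have h1 := h v
    have h2 : |l₁ * v.1| ≤ |l₁| * (|v.1| + |v.2|) := by
      rw [abs_mul]; exact mul_le_mul_of_nonneg_left (by linarith) (abs_nonneg _)
    have h3 : |l₂ * v.2| ≤ |l₂| * (|v.1| + |v.2|) := by
      rw [abs_mul]; exact mul_le_mul_of_nonneg_left (by linarith) (abs_nonneg _)
    have h4 : v.1 ^ 2 + v.2 ^ 2 ≤ |v.1| + |v.2| := by
      rw [← sq_abs v.1, ← sq_abs v.2]; nlinarith
    have h5 : L * (v.1 ^ 2 + v.2 ^ 2) ≤ L * (|v.1| + |v.2|) := by gcongr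
    have h6 : 0 ≤ 2 * c * (|v.1| + |v.2|) := by positivity
    have h7 := abs_add_le (unitSq.indicator F (t + v.1, t + v.2) - F (t, t) - l₁ * v.1 - l₂ * v.2)
      (l₁ * v.1 + l₂ * v.2)
    have h8 := abs_add_le (l₁ * v.1) (l₂ * v.2)
    have h9 : unitSq.indicator F (t + v.1, t + v.2) - F (t, t) - l₁ * v.1 - l₂ * v.2
      + (l₁ * v.1 + l₂ * v.2) = unitSq.indicator F (t + v.1, t + v.2) - F (t, t) := by ring
    rw [h9] at h7
    linarith
  · have h1 := hc (t + v.1, t + v.2)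
    have h2 : |F (t, t)| ≤ c := by
      have := hc (t, t)
      rwa [indicator_of_mem (mem_of_mem_nhds (unitSq_mem_nhds ht))] at this
    have h3 := abs_sub (unitSq.indicator F (t + v.1, t + v.2)) (F (t, t))
    have h4 : 0 ≤ (|l₁| + |l₂| + L) * (|v.1| + |v.2|) := by positivity
    nlinarith

lemma measurable_indicator_unitSq {F : ℝ × ℝ → ℝ} (hF : ContinuousOn F unitSq) :
    Measurable (unitSq.indicator F) := by
  rw [← piecewise_eq_indicator]
  exact hF.measurable_piecewise continuousOn_const measurableSet_unitSq

/-! ### Integrals against a rescaled function -/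

lemma tendsto_rescale {h₁ h₂ : ℕ → ℝ} (h1 : Tendsto h₁ atTop (𝓝 0)) (h2 : Tendsto h₂ atTop (𝓝 0))
    (t : ℝ) (x : ℝ × ℝ) : Tendsto (fun n => rescale t (h₁ n) (h₂ n) x) atTop (𝓝 (t, t)) := by
  refine Tendsto.prodMk_nhds ?_ ?_
  · simpa using (h1.mul_const x.1).const_add t
  · simpa using (h2.mul_const x.2).const_add t

lemma tendsto_integral_mul_rescale {κ F : ℝ × ℝ → ℝ} (hκ : Integrable κ) (hF : Measurable F)
    {c t : ℝ} (hc : ∀ z, |F z| ≤ c) (hFt : ContinuousAt F (t, t)) {h₁ h₂ : ℕ → ℝ}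
    (h1 : Tendsto h₁ atTop (𝓝 0)) (h2 : Tendsto h₂ atTop (𝓝 0)) :
    Tendsto (fun n => ∫ x, κ x * F (rescale t (h₁ n) (h₂ n) x)) atTop
      (𝓝 (F (t, t) * ∫ x, κ x)) := by
  have : F (t, t) * ∫ x, κ x = ∫ x, κ x * F (t, t) := by rw [integral_mul_const, mul_comm]
  rw [this]
  refine tendsto_integral_of_dominated_convergence (fun x => ‖κ x‖ * c)
    (fun n => hκ.aestronglyMeasurable.mul (hF.comp (measurable_rescale _ _ _)).aestronglyMeasurable)
    (hκ.norm.mul_const c) (fun n => ae_of_all _ fun x => ?_) (ae_of_all _ fun x => ?_)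
  · rw [norm_mul]; exact mul_le_mul_of_nonneg_left (hc _) (norm_nonneg _)
  · exact (hFt.tendsto.comp (tendsto_rescale h1 h2 t x)).const_mul _

lemma integrable_mul_rescale {κ F : ℝ × ℝ → ℝ} (hκ : Integrable κ) (hF : Measurable F)
    {c : ℝ} (hc : ∀ z, |F z| ≤ c) (t h₁ h₂ : ℝ) :
    Integrable fun x => κ x * F (rescale t h₁ h₂ x) :=
  hκ.mul_bdd (hF.comp (measurable_rescale t h₁ h₂)).aestronglyMeasurable
    (ae_of_all _ fun x => hc (rescale t h₁ h₂ x))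

/-- First-order bias of a kernel with vanishing integral. -/
lemma exists_abs_integral_mul_rescale_le {κ F : ℝ × ℝ → ℝ} (hκ : Integrable κ) (hκ0 : ∫ x, κ x = 0)
    (hκ1 : Integrable fun x : ℝ × ℝ => x.1 * κ x) (hκ2 : Integrable fun x : ℝ × ℝ => x.2 * κ x)
    (hF : ContDiffOn ℝ 2 F unitSq) {t : ℝ} (ht : t ∈ Ioo (0 : ℝ) 1) :
    ∃ C : ℝ, ∀ h₁ h₂ : ℝ, 0 < h₁ → 0 < h₂ →
      |∫ x, κ x * unitSq.indicator F (rescale t h₁ h₂ x)| ≤ C * (h₁ + h₂) := by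
  obtain ⟨L, hL, h⟩ := exists_lipschitz_at hF ht
  obtain ⟨c, hc0, hc⟩ := exists_indicator_bound hF.continuousOn
  refine ⟨L * ((∫ x : ℝ × ℝ, |x.1 * κ x|) + ∫ x : ℝ × ℝ, |x.2 * κ x|), fun h₁ h₂ hp1 hp2 => ?_⟩
  have hm := measurable_indicator_unitSq hF.continuousOn
  have e1 : ∫ x, κ x * unitSq.indicator F (rescale t h₁ h₂ x)
      = ∫ x, κ x * (unitSq.indicator F (rescale t h₁ h₂ x) - F (t, t)) := by
    simp_rw [mul_sub]
    rw [integral_sub (integrable_mul_rescale hκ hm hc t h₁ h₂) (hκ.mul_const _),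
      integral_mul_const, hκ0, zero_mul, sub_zero]
  rw [e1]
  set I₁ := ∫ x : ℝ × ℝ, |x.1 * κ x| with hI1
  set I₂ := ∫ x : ℝ × ℝ, |x.2 * κ x| with hI2
  have p1 : 0 ≤ I₁ := integral_nonneg fun _ => abs_nonneg _
  have p2 : 0 ≤ I₂ := integral_nonneg fun _ => abs_nonneg _
  calc |∫ x, κ x * (unitSq.indicator F (rescale t h₁ h₂ x) - F (t, t))|
      ≤ ∫ x : ℝ × ℝ, L * (h₁ * |x.1 * κ x| + h₂ * |x.2 * κ x|) := by
        rw [← Real.norm_eq_abs]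
        refine norm_integral_le_of_norm_le
          (((hκ1.abs.const_mul h₁).add (hκ2.abs.const_mul h₂)).const_mul L)
          (ae_of_all _ fun x => ?_)
        have := h (h₁ * x.1, h₂ * x.2)
        rw [norm_mul, Real.norm_eq_abs, Real.norm_eq_abs]
        refine (mul_le_mul_of_nonneg_left this (abs_nonneg _)).trans (le_of_eq ?_)
        simp only [abs_mul, abs_of_pos hp1, abs_of_pos hp2]
        ring
    _ = L * (h₁ * I₁ + h₂ * I₂) := by
        rw [integral_const_mul, integral_add (hκ1.abs.const_mul h₁) (hκ2.abs.const_mul h₂),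
          integral_const_mul, integral_const_mul]
    _ ≤ L * (I₁ + I₂) * (h₁ + h₂) := by
        rw [mul_assoc]
        refine mul_le_mul_of_nonneg_left ?_ hL
        nlinarith

/-- Second-order bias of a centred kernel at a zero of the target function. -/
lemma exists_abs_integral_kernel_mul_rescale_le {K F : ℝ × ℝ → ℝ} (hK : KernelCondition K)
    (hK1 : Integrable fun x : ℝ × ℝ => x.1 * K x) (hK2 : Integrable fun x : ℝ × ℝ => x.2 * K x)
    (hF : ContDiffOn ℝ 2 F unitSq) {t : ℝ} (ht : t ∈ Ioo (0 : ℝ) 1) (hFt : F (t, t) = 0) :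
    ∃ C : ℝ, ∀ h₁ h₂ : ℝ, 0 < h₁ → 0 < h₂ →
      |∫ x, K x * unitSq.indicator F (rescale t h₁ h₂ x)| ≤ C * (h₁ ^ 2 + h₂ ^ 2) := by
  obtain ⟨l₁, l₂, L, hL, h⟩ := exists_taylor_two hF ht
  obtain ⟨c, hc0, hc⟩ := exists_indicator_bound hF.continuousOn
  refine ⟨L * ((∫ x : ℝ × ℝ, x.1 ^ 2 * K x) + ∫ x : ℝ × ℝ, x.2 ^ 2 * K x),
    fun h₁ h₂ hp1 hp2 => ?_⟩
  have hm := measurable_indicator_unitSq hF.continuousOn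
  -- The centred kernel annihilates the linear part of the expansion and `hFt` removes the constant,
  -- so only the quadratic remainder is integrated.
  have e1 : ∫ x, K x * unitSq.indicator F (rescale t h₁ h₂ x)
      = ∫ x : ℝ × ℝ, K x * (unitSq.indicator F (rescale t h₁ h₂ x) - F (t, t)
        - l₁ * (h₁ * x.1) - l₂ * (h₂ * x.2)) := by
    have : ∀ x : ℝ × ℝ, K x * (unitSq.indicator F (rescale t h₁ h₂ x) - F (t, t)
        - l₁ * (h₁ * x.1) - l₂ * (h₂ * x.2)) = K x * unitSq.indicator F (rescale t h₁ h₂ x)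
        - (l₁ * h₁ * (x.1 * K x) + l₂ * h₂ * (x.2 * K x)) := by
      intro x; rw [hFt]; ring
    simp_rw [this]
    have hi : Integrable fun x : ℝ × ℝ => l₁ * h₁ * (x.1 * K x) + l₂ * h₂ * (x.2 * K x) :=
      (hK1.const_mul _).add (hK2.const_mul _)
    rw [integral_sub (integrable_mul_rescale hK.integrable hm hc t h₁ h₂) hi, integral_add (hK1.const_mul _) (hK2.const_mul _),
      integral_const_mul, integral_const_mul, hK.integral_fst, hK.integral_snd]
    simp
  rw [e1]
  set I₁ := ∫ x : ℝ × ℝ, x.1 ^ 2 * K x with hI1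
  set I₂ := ∫ x : ℝ × ℝ, x.2 ^ 2 * K x with hI2
  have p1 : 0 ≤ I₁ := integral_nonneg fun x => mul_nonneg (sq_nonneg _) (hK.nonneg x)
  have p2 : 0 ≤ I₂ := integral_nonneg fun x => mul_nonneg (sq_nonneg _) (hK.nonneg x)
  have i1 := hK.integrable_fst_sq
  have i2 := hK.integrable_snd_sq
  calc _ ≤ ∫ x : ℝ × ℝ, L * (h₁ ^ 2 * (x.1 ^ 2 * K x) + h₂ ^ 2 * (x.2 ^ 2 * K x)) := by
        rw [← Real.norm_eq_abs]
        refine norm_integral_le_of_norm_le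
          (((i1.const_mul (h₁ ^ 2)).add (i2.const_mul (h₂ ^ 2))).const_mul L)
          (ae_of_all _ fun x => ?_)
        have := h (h₁ * x.1, h₂ * x.2)
        rw [norm_mul, Real.norm_eq_abs, Real.norm_eq_abs, abs_of_nonneg (hK.nonneg x)]
        refine (mul_le_mul_of_nonneg_left this (hK.nonneg x)).trans (le_of_eq ?_)
        ring
    _ = L * (h₁ ^ 2 * I₁ + h₂ ^ 2 * I₂) := by
        rw [integral_const_mul, integral_add (i1.const_mul _) (i2.const_mul _),
          integral_const_mul, integral_const_mul]
    _ ≤ L * (I₁ + I₂) * (h₁ ^ 2 + h₂ ^ 2) := by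
        rw [mul_assoc]
        refine mul_le_mul_of_nonneg_left ?_ hL
        nlinarith [sq_nonneg h₁, sq_nonneg h₂]

/-! ### Moments of the kernel and truncation -/

/-- From `|p q| ≤ p² + q²`. All mixed moments of `K` of order at most two are obtained in this way.
-/
lemma KernelCondition.integrable_mul_mul {K : ℝ × ℝ → ℝ} (hK : KernelCondition K)
    {p q : ℝ × ℝ → ℝ} (hp : Measurable p) (hq : Measurable q)
    (hp2 : Integrable fun x => p x ^ 2 * K x) (hq2 : Integrable fun x => q x ^ 2 * K x) :
    Integrable fun x => p x * q x * K x := by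
  refine (hp2.add hq2).mono' ((hp.mul hq).mul hK.meas).aestronglyMeasurable
    (ae_of_all _ fun x => ?_)
  have h1 : |p x * q x| ≤ p x ^ 2 + q x ^ 2 := by
    rw [abs_le]
    constructor <;> nlinarith [sq_nonneg (p x + q x), sq_nonneg (p x - q x), sq_nonneg (p x), sq_nonneg (q x)]
  rw [norm_mul, Real.norm_eq_abs, Real.norm_of_nonneg (hK.nonneg x), Pi.add_apply, ← add_mul]
  exact mul_le_mul_of_nonneg_right h1 (hK.nonneg x)

/-- Tails of an integrable function off increasing sublevel sets. -/
lemma tendsto_setLIntegral_compl_sublevel {φ : ℝ × ℝ → ℝ} (hφ : Measurable φ)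
    {g : ℝ × ℝ → ℝ≥0∞} (hg : Measurable g) (hgi : ∫⁻ x, g x ≠ ⊤)
    {r : ℕ → ℝ} (hr : Tendsto r atTop atTop) :
    Tendsto (fun n => ∫⁻ x in {x | |φ x| ≤ r n}ᶜ, g x) atTop (𝓝 0) := by
  have hA : ∀ n, MeasurableSet {x | |φ x| ≤ r n}ᶜ := fun n =>
    (measurableSet_le (by fun_prop) measurable_const).compl
  refine Tendsto.congr (fun n => lintegral_indicator (hA n) g) ?_
  rw [← lintegral_zero (μ := (volume : Measure (ℝ × ℝ)))]
  refine tendsto_lintegral_of_dominated_convergence g (fun n => hg.indicator (hA n))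
    (fun n => ae_of_all _ fun x => indicator_le_self _ _ x) hgi (ae_of_all _ fun x => ?_)
  refine tendsto_const_nhds.congr' ?_
  filter_upwards [hr.eventually_ge_atTop |φ x|] with n hn
  exact (indicator_of_notMem (by simpa using hn) _).symm

/-- On `{|κ| ≤ r}` one has `κ² ≤ r |κ|`, so the quantity is at most `r⁻¹ ∫ |κ|`. A truncated average
thus has vanishing variance although `κ` is only integrable. -/
lemma tendsto_ofReal_inv_mul_setLIntegral_sq {κ : ℝ × ℝ → ℝ} (hκ : Integrable κ)
    (hκm : Measurable κ) {r : ℕ → ℝ} (hr : Tendsto r atTop atTop) :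
    Tendsto (fun n => ENNReal.ofReal (r n ^ 2)⁻¹ * ∫⁻ x in {x | |κ x| ≤ r n}, ‖κ x‖ₑ ^ 2) atTop
      (𝓝 0) := by
  have hfin : ∫⁻ x, ‖κ x‖ₑ ≠ ⊤ := hκ.hasFiniteIntegral.ne
  have hlim : Tendsto (fun n => ENNReal.ofReal (r n)⁻¹ * ∫⁻ x, ‖κ x‖ₑ) atTop (𝓝 0) := by
    have h1 : Tendsto (fun n => ENNReal.ofReal (r n)⁻¹) atTop (𝓝 0) := by
      simpa using ENNReal.tendsto_ofReal (tendsto_inv_atTop_zero.comp hr)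
    simpa using ENNReal.Tendsto.mul_const h1 (Or.inr hfin)
  refine tendsto_of_tendsto_of_tendsto_of_le_of_le' tendsto_const_nhds hlim
    (Eventually.of_forall fun _ => zero_le) ?_
  filter_upwards [hr.eventually_gt_atTop 0] with n hn
  have hA : MeasurableSet {x | |κ x| ≤ r n} := measurableSet_le (by fun_prop) measurable_const
  calc ENNReal.ofReal (r n ^ 2)⁻¹ * ∫⁻ x in {x | |κ x| ≤ r n}, ‖κ x‖ₑ ^ 2
      ≤ ENNReal.ofReal (r n ^ 2)⁻¹ * ∫⁻ x in {x | |κ x| ≤ r n}, ENNReal.ofReal (r n) * ‖κ x‖ₑ := by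
        gcongr ENNReal.ofReal _ * ?_
        refine setLIntegral_mono (by fun_prop) fun x hx => ?_
        rw [sq]
        gcongr
        rw [Real.enorm_eq_ofReal_abs]
        exact ENNReal.ofReal_le_ofReal hx
    _ = ENNReal.ofReal (r n)⁻¹ * ∫⁻ x in {x | |κ x| ≤ r n}, ‖κ x‖ₑ := by
        rw [lintegral_const_mul' _ _ ENNReal.ofReal_ne_top, ← mul_assoc,
          ← ENNReal.ofReal_mul (by positivity)]
        congr 2
        field_simp
    _ ≤ _ := by gcongr; exact Measure.restrict_le_self

/-- Truncated second moments of a linear weight times a square-integrable kernel. -/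
lemma tendsto_ofReal_inv_sq_mul_setLIntegral_sq {K p : ℝ × ℝ → ℝ} (hK : Measurable K)
    (hK2 : Integrable fun x => K x ^ 2) (hp : Measurable p) {r : ℕ → ℝ}
    (hr : Tendsto r atTop atTop) :
    Tendsto (fun n => ENNReal.ofReal (r n ^ 2)⁻¹ * ∫⁻ x in {x | |p x| ≤ r n}, ‖p x * K x‖ₑ ^ 2)
      atTop (𝓝 0) := by
  have hA : ∀ n, MeasurableSet {x | |p x| ≤ r n} := fun n =>
    measurableSet_le (by fun_prop) measurable_const
  have hfin : ∫⁻ x, ‖K x‖ₑ ^ 2 ≠ ⊤ := by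
    have := hK2.hasFiniteIntegral.ne
    simpa [enorm_pow] using this
  refine Tendsto.congr (fun n => (lintegral_indicator (hA n) _).trans
    (lintegral_const_mul' _ _ ENNReal.ofReal_ne_top)) ?_
  rw [← lintegral_zero (μ := (volume : Measure (ℝ × ℝ)))]
  -- On the truncation set `p² / r² ≤ 1`, so `K²` dominates; `p² K²` itself need not be integrable.
  refine tendsto_lintegral_filter_of_dominated_convergence (fun x => ‖K x‖ₑ ^ 2)
    (Eventually.of_forall fun n => Measurable.indicator (by fun_prop) (hA n)) ?_ hfin
    (ae_of_all _ fun x => ?_)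
  · filter_upwards [hr.eventually_gt_atTop 0] with n hn
    refine ae_of_all _ fun x => ?_
    by_cases hx : x ∈ {x | |p x| ≤ r n}
    · rw [indicator_of_mem hx, enorm_mul, mul_pow, ← mul_assoc]
      refine mul_le_of_le_one_left (zero_le) ?_
      rw [Real.enorm_eq_ofReal_abs, ← ENNReal.ofReal_pow (abs_nonneg _),
        ← ENNReal.ofReal_mul (by positivity)]
      refine ENNReal.ofReal_le_one.2 ?_
      rw [inv_mul_le_one₀ (by positivity)]
      exact pow_le_pow_left₀ (abs_nonneg _) hx 2
    · rw [indicator_of_notMem hx]; exact zero_le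
  · have h1 : Tendsto (fun n => ENNReal.ofReal (r n ^ 2)⁻¹ * ‖p x * K x‖ₑ ^ 2) atTop (𝓝 0) := by
      have h2 : Tendsto (fun n => ENNReal.ofReal (r n ^ 2)⁻¹) atTop (𝓝 0) := by
        simpa using ENNReal.tendsto_ofReal
          (tendsto_inv_atTop_zero.comp ((tendsto_pow_atTop two_ne_zero).comp hr))
      simpa using ENNReal.Tendsto.mul_const h2 (Or.inr (by finiteness))
    exact tendsto_of_tendsto_of_tendsto_of_le_of_le tendsto_const_nhds h1
      (fun _ => zero_le) (fun n => indicator_le_self _ _ x)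

/-- Off the truncation set `r ≤ |p|`, hence `r |p K| ≤ p² |K|`, whose tail integral tends to zero.
This is the companion of the preceding estimate: one level `r` serves both as the truncation and as
the rate. -/
lemma tendsto_ofReal_mul_setLIntegral_compl {K p : ℝ × ℝ → ℝ} (hK : Measurable K)
    (hp : Measurable p) (hpK : Integrable fun x => p x ^ 2 * K x) {r : ℕ → ℝ}
    (hr : Tendsto r atTop atTop) :
    Tendsto (fun n => ENNReal.ofReal (r n) * ∫⁻ x in {x | |p x| ≤ r n}ᶜ, ‖p x * K x‖ₑ)
      atTop (𝓝 0) := by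
  have hA : ∀ n, MeasurableSet {x | |p x| ≤ r n}ᶜ := fun n =>
    (measurableSet_le (by fun_prop) measurable_const).compl
  have hlim := tendsto_setLIntegral_compl_sublevel hp (g := fun x => ‖p x ^ 2 * K x‖ₑ)
    (by fun_prop) hpK.hasFiniteIntegral.ne hr
  refine tendsto_of_tendsto_of_tendsto_of_le_of_le tendsto_const_nhds hlim
    (fun _ => zero_le) fun n => ?_
  rw [← lintegral_const_mul' _ _ ENNReal.ofReal_ne_top]
  refine setLIntegral_mono (by fun_prop) fun x hx => ?_
  rw [sq, mul_assoc, enorm_mul (p x) (p x * K x)]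
  gcongr
  rw [Real.enorm_eq_ofReal_abs]
  refine ENNReal.ofReal_le_ofReal ?_
  simp only [mem_compl_iff, mem_ofPred_eq, not_le] at hx
  exact hx.le

/-! ### Pairs of points that share a time -/

lemma two_mul_mul_le_weighted (x y : ℝ≥0∞) {c : ℝ≥0} (hc : c ≠ 0) :
    2 * (x * y) ≤ c * x ^ 2 + (c : ℝ≥0∞)⁻¹ * y ^ 2 := by
  rcases eq_or_ne x ⊤ with rfl | hx
  · rw [ENNReal.top_pow two_ne_zero, ENNReal.mul_top (by simpa using hc), top_add]; exact le_top
  rcases eq_or_ne y ⊤ with rfl | hy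
  · rw [ENNReal.top_pow two_ne_zero, ENNReal.mul_top (ENNReal.inv_ne_zero.2 ENNReal.coe_ne_top),
      add_top]
    exact le_top
  lift x to ℝ≥0 using hx
  lift y to ℝ≥0 using hy
  rw [← ENNReal.coe_inv hc]
  have h : 2 * (x * y) ≤ c * x ^ 2 + c⁻¹ * y ^ 2 := by
    rw [← NNReal.coe_le_coe]
    push_cast
    have hc' : (0 : ℝ) < c := by positivity
    have : (c : ℝ) * x ^ 2 + (c : ℝ)⁻¹ * y ^ 2 - 2 * (x * y) = (c : ℝ)⁻¹ * (c * x - y) ^ 2 := by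
      field_simp; ring
    nlinarith [show 0 ≤ (c : ℝ)⁻¹ * (c * x - y) ^ 2 by positivity]
  exact_mod_cast h

/-- A weighted form of Young's inequality for a function integrated against itself along one
coordinate. -/
lemma lintegral_shared_le {a : ℝ × ℝ → ℝ≥0∞} (ha : Measurable a) (t : ℝ) {ρ : ℝ≥0} (hρ : ρ ≠ 0) :
    ∫⁻ z in unitCube, a (z.1, z.2.1) * a (z.1, z.2.2) ≤
      3 * ρ * (∫⁻ z, a z ^ 2) + 3 * ∫⁻ z in {z | |z.2 - t| ≤ ρ}ᶜ, a z ^ 2 := by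
  classical
  have hN : MeasurableSet {s : ℝ | |s - t| ≤ ρ} := measurableSet_le (by fun_prop) measurable_const
  have hF : MeasurableSet {z : ℝ × ℝ | |z.2 - t| ≤ ρ}ᶜ :=
    (measurableSet_le (by fun_prop) measurable_const).compl
  -- The weight has integral at most `3 ρ`: one on an interval of length `2 ρ`, and `ρ` elsewhere.
  -- Its reciprocal is harmless near `t` and costs `1 / ρ` only on the far set.
  set r : ℝ → ℝ≥0 := fun s => if |s - t| ≤ ρ then 1 else ρ with hr
  have hrm : Measurable r := Measurable.ite hN measurable_const measurable_const
  have hr0 : ∀ s, r s ≠ 0 := by intro s; simp only [hr]; split_ifs <;> simp [hρ]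
  have hR : ∫⁻ s in unitI, (r s : ℝ≥0∞) ≤ 3 * ρ := by
    calc ∫⁻ s in unitI, (r s : ℝ≥0∞)
        ≤ ∫⁻ s in unitI, ({s : ℝ | |s - t| ≤ ρ}.indicator 1 s + (ρ : ℝ≥0∞)) := by
          refine lintegral_mono fun s => ?_
          by_cases hs : |s - t| ≤ ρ
          · simp [hr, hs]
          · simp [hr, hs]
      _ = volume.restrict unitI {s : ℝ | |s - t| ≤ ρ} + ρ := by
          rw [lintegral_add_right _ measurable_const, lintegral_indicator_one hN]
          simp
      _ ≤ 2 * ρ + ρ := by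
          gcongr
          refine (Measure.restrict_le_self _).trans ?_
          have : {s : ℝ | |s - t| ≤ ρ} = Metric.closedBall t ρ := by
            ext s; simp [Real.dist_eq]
          rw [this, Real.volume_closedBall, ENNReal.ofReal_mul (by norm_num)]
          simp
      _ = 3 * ρ := by ring
  set b : ℝ × ℝ → ℝ≥0∞ := fun z => (r z.2 : ℝ≥0∞)⁻¹ * a z ^ 2 with hb
  have hbm : Measurable b := by fun_prop
  have hbI : (∫⁻ z, b z) * (3 * ρ) ≤
      3 * ρ * (∫⁻ z, a z ^ 2) + 3 * ∫⁻ z in {z | |z.2 - t| ≤ ρ}ᶜ, a z ^ 2 := by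
    rw [← lintegral_mul_const _ hbm, ← lintegral_const_mul _ (by fun_prop),
      ← lintegral_const_mul _ (by fun_prop), ← lintegral_indicator hF,
      ← lintegral_add_left (by fun_prop)]
    refine lintegral_mono fun z => ?_
    by_cases hz : |z.2 - t| ≤ ρ
    · simp only [hb, hr, if_pos hz, ENNReal.coe_one, inv_one, one_mul, mul_comm]
      exact le_self_add
    · rw [indicator_of_mem (by simpa using hz)]
      simp only [hb, hr, if_neg hz]
      refine le_add_of_nonneg_of_le zero_le (le_of_eq ?_)
      have : (ρ : ℝ≥0∞)⁻¹ * ρ = 1 := ENNReal.inv_mul_cancel (by simpa using hρ) (by simp)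
      calc (ρ : ℝ≥0∞)⁻¹ * a z ^ 2 * (3 * ρ) = ((ρ : ℝ≥0∞)⁻¹ * ρ) * (3 * a z ^ 2) := by ring
        _ = _ := by rw [this, one_mul]
  have hbR : ∫⁻ x in unitI, ∫⁻ y in unitI, b (x, y) ≤ ∫⁻ z, b z := by
    calc ∫⁻ x in unitI, ∫⁻ y in unitI, b (x, y) = ∫⁻ z in unitSq, b z := by
          rw [Measure.volume_eq_prod, ← Measure.prod_restrict, lintegral_prod _ (by fun_prop)]
      _ ≤ _ := setLIntegral_le_lintegral _ _
  have hterm : ∫⁻ x in unitI, ∫⁻ y in unitI, ∫⁻ y' in unitI, (r y' : ℝ≥0∞) * b (x, y)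
      ≤ (∫⁻ z, b z) * (3 * ρ) := by
    calc ∫⁻ x in unitI, ∫⁻ y in unitI, ∫⁻ y' in unitI, (r y' : ℝ≥0∞) * b (x, y)
        ≤ ∫⁻ x in unitI, ∫⁻ y in unitI, b (x, y) * (3 * ρ) := by
          refine lintegral_mono fun x => lintegral_mono fun y => ?_
          rw [lintegral_mul_const _ (by fun_prop), mul_comm]
          gcongr
      _ = (∫⁻ x in unitI, ∫⁻ y in unitI, b (x, y)) * (3 * ρ) := by
          rw [← lintegral_mul_const _ (by fun_prop)]
          congr 1 with x
          rw [← lintegral_mul_const _ (by fun_prop)]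
      _ ≤ _ := by gcongr
  have h2 : 2 * ∫⁻ z in unitCube, a (z.1, z.2.1) * a (z.1, z.2.2) ≤
      2 * ((∫⁻ z, b z) * (3 * ρ)) := by
    rw [← lintegral_const_mul _ (by fun_prop), Measure.volume_eq_prod, ← Measure.prod_restrict,
      Measure.volume_eq_prod, ← Measure.prod_restrict]
    calc _ ≤ ∫⁻ z, (r z.2.2 : ℝ≥0∞) * b (z.1, z.2.1) + (r z.2.1 : ℝ≥0∞) * b (z.1, z.2.2)
          ∂((volume.restrict unitI).prod ((volume.restrict unitI).prod (volume.restrict unitI))) := by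
          refine lintegral_mono fun z => ?_
          -- With the ratio of the two weights in Young's inequality, each resulting term is `b` at
          -- one point times `r` at the other, and the `r` factor integrates out separately.
          have hc : r z.2.2 / r z.2.1 ≠ 0 := div_ne_zero (hr0 _) (hr0 _)
          refine (two_mul_mul_le_weighted _ _ hc).trans (le_of_eq ?_)
          simp only [hb]
          rw [ENNReal.coe_div (hr0 _), ENNReal.inv_div (by simp) (Or.inl (by simpa using hr0 _))]
          simp only [div_eq_mul_inv]
          ring
      _ = (∫⁻ x in unitI, ∫⁻ y in unitI, ∫⁻ y' in unitI, (r y' : ℝ≥0∞) * b (x, y))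
          + ∫⁻ x in unitI, ∫⁻ y in unitI, ∫⁻ y' in unitI, (r y' : ℝ≥0∞) * b (x, y) := by
          rw [lintegral_add_left (by fun_prop)]
          congr 1
          · rw [lintegral_prod _ (by fun_prop)]
            congr 1 with x
            rw [lintegral_prod _ (by fun_prop)]
          · rw [lintegral_prod _ (by fun_prop)]
            congr 1 with x
            rw [lintegral_prod_symm _ (by fun_prop)]
      _ ≤ _ := by rw [two_mul]; exact add_le_add hterm hterm
  exact ((ENNReal.mul_le_mul_iff_right (by simp) (by simp)).1 h2).trans hbI

/-- The contribution of the pairs of distinct points is negligible. -/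
lemma tendsto_offDiag_kern {K : ℝ × ℝ → ℝ} (hK : KernelCondition K) {h₁ h₂ : ℕ → ℝ}
    (p1 : ∀ n, 0 < h₁ n) (p2 : ∀ n, 0 < h₂ n)
    (h1 : Tendsto h₁ atTop (𝓝 0)) (h2 : Tendsto h₂ atTop (𝓝 0)) (t : ℝ) :
    Tendsto (fun n => ENNReal.ofReal (h₁ n * h₂ n) *
      ((∫⁻ z in unitSq ×ˢ unitSq, ‖kern K (h₁ n) (h₂ n) t z.1‖ₑ * ‖kern K (h₁ n) (h₂ n) t z.2‖ₑ)
      + (∫⁻ z in unitCube, ‖kern K (h₁ n) (h₂ n) t (z.1, z.2.1)‖ₑ *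
          ‖kern K (h₁ n) (h₂ n) t (z.1, z.2.2)‖ₑ)
      + ∫⁻ z in unitCube, ‖kern K (h₁ n) (h₂ n) t (z.2.1, z.1)‖ₑ *
          ‖kern K (h₁ n) (h₂ n) t (z.2.2, z.1)‖ₑ)) atTop (𝓝 0) := by
  have hk : ∀ n, Measurable (kern K (h₁ n) (h₂ n) t) := fun n => measurable_kern hK.meas _ _ _
  have hfin1 : ∫⁻ x, ‖K x‖ₑ ≠ ⊤ := hK.integrable.hasFiniteIntegral.ne
  have hfin2 : ∫⁻ x, ‖K x‖ₑ ^ 2 ≠ ⊤ := by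
    have := hK.integrable_sq.hasFiniteIntegral.ne
    simpa [enorm_pow] using this
  have hK2m : Measurable fun x => ‖K x‖ₑ ^ 2 := by have := hK.meas; fun_prop
  -- the pairs that differ in both times
  have l1 : Tendsto (fun n => ENNReal.ofReal (h₁ n * h₂ n) *
      ∫⁻ z in unitSq ×ˢ unitSq, ‖kern K (h₁ n) (h₂ n) t z.1‖ₑ * ‖kern K (h₁ n) (h₂ n) t z.2‖ₑ)
      atTop (𝓝 0) := by
    have hlim : Tendsto (fun n => ENNReal.ofReal (h₁ n * h₂ n) *
        ((∫⁻ x, ‖K x‖ₑ) * ∫⁻ x, ‖K x‖ₑ)) atTop (𝓝 0) := by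
      have h3 : Tendsto (fun n => ENNReal.ofReal (h₁ n * h₂ n)) atTop (𝓝 0) := by
        simpa using ENNReal.tendsto_ofReal (h1.mul h2)
      simpa using ENNReal.Tendsto.mul_const h3 (Or.inr (ENNReal.mul_ne_top hfin1 hfin1))
    refine tendsto_of_tendsto_of_tendsto_of_le_of_le tendsto_const_nhds hlim
      (fun _ => zero_le) fun n => ?_
    simp only
    gcongr
    refine (setLIntegral_le_lintegral _ _).trans (le_of_eq ?_)
    have hm : AEMeasurable fun z => ‖kern K (h₁ n) (h₂ n) t z‖ₑ := (hk n).enorm.aemeasurable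
    rw [Measure.volume_eq_prod, lintegral_prod_mul hm hm, lintegral_enorm_kern (p1 n) (p2 n)]
  -- the tails of the kernel
  have tail : ∀ (p : ℝ × ℝ → ℝ) (_ : Measurable p) (h : ℕ → ℝ), (∀ n, 0 < h n) →
      Tendsto h atTop (𝓝 0) → Tendsto (fun n => 3 * ((√(h n)).toNNReal : ℝ≥0∞) * (∫⁻ x, ‖K x‖ₑ ^ 2)
        + 3 * ∫⁻ x in {x | |p x| ≤ (√(h n))⁻¹}ᶜ, ‖K x‖ₑ ^ 2) atTop (𝓝 0) := by
    intro p hp h hpos hh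
    have hs : Tendsto (fun n => √(h n)) atTop (𝓝 0) := by
      simpa [Function.comp_def] using (Real.continuous_sqrt.tendsto 0).comp hh
    have a1 : Tendsto (fun n => 3 * ((√(h n)).toNNReal : ℝ≥0∞) * (∫⁻ x, ‖K x‖ₑ ^ 2)) atTop
        (𝓝 0) := by
      have : Tendsto (fun n => ((√(h n)).toNNReal : ℝ≥0∞)) atTop (𝓝 0) := by
        simpa [ENNReal.ofReal] using ENNReal.tendsto_ofReal hs
      have := ENNReal.Tendsto.const_mul (a := 3) this (Or.inr (by simp))
      simpa using ENNReal.Tendsto.mul_const this (Or.inr hfin2)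
    have hinv : Tendsto (fun n => (√(h n))⁻¹) atTop atTop := by
      refine Tendsto.inv_tendsto_nhdsGT_zero ?_
      refine tendsto_nhdsWithin_iff.2 ⟨hs, Eventually.of_forall fun n => Real.sqrt_pos.2 (hpos n)⟩
    have a2 := ENNReal.Tendsto.const_mul (a := 3)
      (tendsto_setLIntegral_compl_sublevel hp hK2m hfin2 hinv) (Or.inr (by simp))
    simpa using a1.add a2
  have hset : ∀ (h u : ℝ), 0 < h → (|h * u| ≤ ((√h).toNNReal : ℝ) ↔ |u| ≤ (√h)⁻¹) := by
    intro h u hpos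
    have hs : 0 < √h := Real.sqrt_pos.2 hpos
    rw [Real.coe_toNNReal _ hs.le, abs_mul, abs_of_pos hpos, ← one_div, le_div_iff₀ hs]
    nth_rewrite 1 [← Real.mul_self_sqrt hpos.le]
    rw [mul_assoc, mul_le_iff_le_one_right hs, mul_comm]
  -- The cutoff in `lintegral_shared_le` is `√h₂`. It tends to zero, while the far set `|z.2 - t| >
  -- √h₂` rescales to `|x.2| > 1 / √h₂` and escapes to infinity.
  have l2 : Tendsto (fun n => ENNReal.ofReal (h₁ n * h₂ n) *
      ∫⁻ z in unitCube, ‖kern K (h₁ n) (h₂ n) t (z.1, z.2.1)‖ₑ *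
          ‖kern K (h₁ n) (h₂ n) t (z.1, z.2.2)‖ₑ) atTop (𝓝 0) := by
    refine tendsto_of_tendsto_of_tendsto_of_le_of_le tendsto_const_nhds
      (tail Prod.snd measurable_snd h₂ p2 h2) (fun _ => zero_le) fun n => ?_
    have hm : Measurable fun z => ‖kern K (h₁ n) (h₂ n) t z‖ₑ := by have := hk n; fun_prop
    have hρ : (√(h₂ n)).toNNReal ≠ 0 := by
      simpa using Real.sqrt_pos.2 (p2 n)
    refine (mul_le_mul_right (lintegral_shared_le hm t hρ) _).trans (le_of_eq ?_)
    calc _ = 3 * ((√(h₂ n)).toNNReal : ℝ≥0∞) *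
            (ENNReal.ofReal (h₁ n * h₂ n) * ∫⁻ z, ‖kern K (h₁ n) (h₂ n) t z‖ₑ ^ 2) +
          3 * (ENNReal.ofReal (h₁ n * h₂ n) *
            ∫⁻ z in {z | |z.2 - t| ≤ (√(h₂ n)).toNNReal}ᶜ, ‖kern K (h₁ n) (h₂ n) t z‖ₑ ^ 2) := by
          ring
      _ = _ := by
          rw [lintegral_enorm_sq_kern (p1 n) (p2 n), lintegral_enorm_sq_kern_indicator (p1 n) (p2 n)
            t (measurableSet_le (by fun_prop) measurable_const).compl]
          congr 4
          ext x
          simpa [rescale] using (not_congr (hset (h₂ n) x.2 (p2 n)))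
  have l3 : Tendsto (fun n => ENNReal.ofReal (h₁ n * h₂ n) *
      ∫⁻ z in unitCube, ‖kern K (h₁ n) (h₂ n) t (z.2.1, z.1)‖ₑ *
          ‖kern K (h₁ n) (h₂ n) t (z.2.2, z.1)‖ₑ) atTop (𝓝 0) := by
    refine tendsto_of_tendsto_of_tendsto_of_le_of_le tendsto_const_nhds
      (tail Prod.fst measurable_fst h₁ p1 h1) (fun _ => zero_le) fun n => ?_
    have hm : Measurable fun z : ℝ × ℝ => ‖kern K (h₁ n) (h₂ n) t z.swap‖ₑ := by
      have := (hk n).comp measurable_swap; exact this.enorm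
    have hρ : (√(h₁ n)).toNNReal ≠ 0 := by
      simpa using Real.sqrt_pos.2 (p1 n)
    have hswap : ∀ g : ℝ × ℝ → ℝ≥0∞, ∫⁻ z : ℝ × ℝ, g z.swap = ∫⁻ z, g z := by
      intro g
      exact (Measure.measurePreserving_swap (μ := (volume : Measure ℝ))
        (ν := (volume : Measure ℝ))).lintegral_comp_emb MeasurableEquiv.prodComm.measurableEmbedding g
    have e2 : ∫⁻ z : ℝ × ℝ in {z | |z.2 - t| ≤ (√(h₁ n)).toNNReal}ᶜ,
          ‖kern K (h₁ n) (h₂ n) t z.swap‖ₑ ^ 2 =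
        ∫⁻ z : ℝ × ℝ in {z | |z.1 - t| ≤ (√(h₁ n)).toNNReal}ᶜ,
          ‖kern K (h₁ n) (h₂ n) t z‖ₑ ^ 2 := by
      rw [← lintegral_indicator (measurableSet_le (by fun_prop) measurable_const).compl,
        ← lintegral_indicator (measurableSet_le (by fun_prop) measurable_const).compl, ← hswap]
      rfl
    refine (mul_le_mul_right (lintegral_shared_le hm t hρ) _).trans (le_of_eq ?_)
    calc _ = 3 * ((√(h₁ n)).toNNReal : ℝ≥0∞) *
            (ENNReal.ofReal (h₁ n * h₂ n) * ∫⁻ z, ‖kern K (h₁ n) (h₂ n) t z‖ₑ ^ 2) +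
          3 * (ENNReal.ofReal (h₁ n * h₂ n) *
            ∫⁻ z in {z | |z.1 - t| ≤ (√(h₁ n)).toNNReal}ᶜ, ‖kern K (h₁ n) (h₂ n) t z‖ₑ ^ 2) := by
          rw [e2, hswap (fun z => ‖kern K (h₁ n) (h₂ n) t z‖ₑ ^ 2)]
          ring
      _ = _ := by
          rw [lintegral_enorm_sq_kern (p1 n) (p2 n), lintegral_enorm_sq_kern_indicator (p1 n) (p2 n)
            t (measurableSet_le (by fun_prop) measurable_const).compl]
          congr 4
          ext x
          simpa [rescale] using (not_congr (hset (h₁ n) x.1 (p1 n)))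
  simpa [mul_add] using (l1.add l2).add l3

/-! ### Campbell's formula with random marks -/

section Campbell

variable {E : Type*} [MeasurableSpace E] {μ : Measure E} [IsProbabilityMeasure μ]
  {ν : Measure ObsTimes} [IsProbabilityMeasure ν] {η : ℝ × ℝ → ℝ} {f : (ℝ × ℝ) × (ℝ × ℝ) → ℝ}

lemma pointSum_eq_toReal_sub (τ : ObsTimes) (φ : ℝ × ℝ → ℝ) :
    pointSum τ φ = (pointSum τ fun z => ENNReal.ofReal (φ z)).toReal
      - (pointSum τ fun z => ENNReal.ofReal (-φ z)).toReal := by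
  simp only [pointSum]
  rw [ENNReal.toReal_sum (by simp), ENNReal.toReal_sum (by simp), ← Finset.sum_sub_distrib]
  refine Finset.sum_congr rfl fun i _ => ?_
  rw [ENNReal.toReal_ofReal', ENNReal.toReal_ofReal']
  rcases le_total (φ (pt τ i)) 0 with h | h
  · rw [max_eq_right h, max_eq_left (by linarith)]; ring
  · rw [max_eq_left h, max_eq_right (by linarith)]; ring

lemma pointSum_ne_top (τ : ObsTimes) (φ : ℝ × ℝ → ℝ≥0∞) (hφ : ∀ z, φ z ≠ ⊤) :
    pointSum τ φ ≠ ⊤ := by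
  simpa [pointSum] using fun i j _ => hφ (pt τ (i, j))

lemma enorm_pointSum_le {F : Type*} [NormedAddCommGroup F] (τ : ObsTimes) (φ : ℝ × ℝ → F) :
    ‖pointSum τ φ‖ₑ ≤ pointSum τ fun z => ‖φ z‖ₑ :=
  enorm_sum_le _ _

namespace ObservationCondition

lemma lintegral_pointSum_prod (h : ObservationCondition ν η f) {φ : E → ℝ × ℝ → ℝ≥0∞}
    (hφ : Measurable (Function.uncurry φ)) :
    ∫⁻ x, pointSum x.2 (φ x.1) ∂(μ.prod ν)
      = ∫⁻ z, (∫⁻ e, φ e z ∂μ) * ENNReal.ofReal (etaExt η z) := by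
  rw [lintegral_prod _ (measurable_pointSum_prod hφ).aemeasurable]
  have h1 : ∀ e, ∫⁻ τ, pointSum τ (φ e) ∂ν = ∫⁻ z, φ e z * ENNReal.ofReal (etaExt η z) :=
    fun e => h.lintegral_pointSum (hφ.comp measurable_prodMk_left)
  simp only [h1]
  have hm : Measurable fun x : E × (ℝ × ℝ) => φ x.1 x.2 * ENNReal.ofReal (etaExt η x.2) :=
    hφ.mul (h.measurable_etaExt.ennreal_ofReal.comp measurable_snd)
  rw [lintegral_lintegral_swap hm.aemeasurable]
  congr 1 with z
  exact lintegral_mul_const _ (hφ.comp measurable_prodMk_right)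

variable {φ : E → ℝ × ℝ → ℝ}

lemma integrable_pointSum_prod {F : Type*} [NormedAddCommGroup F] [MeasurableSpace F]
    [BorelSpace F] [SecondCountableTopology F] {φ : E → ℝ × ℝ → F}
    (h : ObservationCondition ν η f) (hφ : Measurable (Function.uncurry φ))
    (hfin : ∫⁻ z, (∫⁻ e, ‖φ e z‖ₑ ∂μ) * ENNReal.ofReal (etaExt η z) ≠ ⊤) :
    Integrable (fun x : E × ObsTimes => pointSum x.2 (φ x.1)) (μ.prod ν) := by
  refine ⟨(measurable_pointSum_prod hφ).aestronglyMeasurable, lt_of_le_of_lt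
    (lintegral_mono fun x => enorm_pointSum_le x.2 (φ x.1)) ?_⟩
  rw [h.lintegral_pointSum_prod (φ := fun e z => ‖φ e z‖ₑ) hφ.enorm]
  exact hfin.lt_top

/-- Campbell's formula for nonnegative integrands says that sums over points integrate like `μ.prod
Λ`. The signed version follows by applying it to positive and negative parts. -/
lemma integral_pointSum_prod (h : ObservationCondition ν η f)
    (hφ : Measurable (Function.uncurry φ))
    (hfin : ∫⁻ z, (∫⁻ e, ‖φ e z‖ₑ ∂μ) * ENNReal.ofReal (etaExt η z) ≠ ⊤) :
    ∫ x, pointSum x.2 (φ x.1) ∂(μ.prod ν) = ∫ z, etaExt η z * ∫ e, φ e z ∂μ := by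
  set Λ : Measure (ℝ × ℝ) := volume.withDensity fun z => ENNReal.ofReal (etaExt η z) with hΛ
  have hηm := h.measurable_etaExt
  have key : ∀ ψ : E → ℝ × ℝ → ℝ≥0∞, Measurable (Function.uncurry ψ) →
      ∫⁻ x, pointSum x.2 (ψ x.1) ∂(μ.prod ν) = ∫⁻ y, ψ y.1 y.2 ∂(μ.prod Λ) := by
    intro ψ hψ
    have hψ' : AEMeasurable (fun y : E × (ℝ × ℝ) => ψ y.1 y.2) (μ.prod Λ) := hψ.aemeasurable
    have hψz : Measurable fun z => ∫⁻ e, ψ e z ∂μ := Measurable.lintegral_prod_left' hψ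
    rw [h.lintegral_pointSum_prod hψ, lintegral_prod_symm _ hψ', hΛ,
      lintegral_withDensity_eq_lintegral_mul _ hηm.ennreal_ofReal hψz]
    congr 1 with z
    rw [Pi.mul_apply, mul_comm]
  have hint : Integrable (fun y : E × (ℝ × ℝ) => φ y.1 y.2) (μ.prod Λ) := by
    refine ⟨hφ.aestronglyMeasurable, ?_⟩
    rw [hasFiniteIntegral_iff_enorm, ← key (fun e z => ‖φ e z‖ₑ) hφ.enorm,
      h.lintegral_pointSum_prod (φ := fun e z => ‖φ e z‖ₑ) hφ.enorm]
    exact hfin.lt_top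
  have hpos : ∫⁻ x, pointSum x.2 (fun z => ENNReal.ofReal (φ x.1 z)) ∂(μ.prod ν) ≠ ⊤ := by
    rw [key (fun e z => ENNReal.ofReal (φ e z)) hφ.ennreal_ofReal]
    exact hint.lintegral_lt_top.ne
  have hneg : ∫⁻ x, pointSum x.2 (fun z => ENNReal.ofReal (-φ x.1 z)) ∂(μ.prod ν) ≠ ⊤ := by
    rw [key (fun e z => ENNReal.ofReal (-φ e z)) hφ.neg.ennreal_ofReal]
    exact hint.neg.lintegral_lt_top.ne
  have mpos : Measurable fun x : E × ObsTimes =>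
      pointSum x.2 (fun z => ENNReal.ofReal (φ x.1 z)) :=
    measurable_pointSum_prod (g := fun e z => ENNReal.ofReal (φ e z)) hφ.ennreal_ofReal
  have mneg : Measurable fun x : E × ObsTimes =>
      pointSum x.2 (fun z => ENNReal.ofReal (-φ x.1 z)) :=
    measurable_pointSum_prod (g := fun e z => ENNReal.ofReal (-φ e z)) hφ.neg.ennreal_ofReal
  calc ∫ x, pointSum x.2 (φ x.1) ∂(μ.prod ν)
      = (∫⁻ x, pointSum x.2 (fun z => ENNReal.ofReal (φ x.1 z)) ∂(μ.prod ν)).toReal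
        - (∫⁻ x, pointSum x.2 (fun z => ENNReal.ofReal (-φ x.1 z)) ∂(μ.prod ν)).toReal := by
        simp_rw [pointSum_eq_toReal_sub]
        rw [integral_sub (integrable_toReal_of_lintegral_ne_top mpos.aemeasurable hpos)
          (integrable_toReal_of_lintegral_ne_top mneg.aemeasurable hneg),
          integral_toReal mpos.aemeasurable (ae_of_all _ fun x => ?_),
          integral_toReal mneg.aemeasurable (ae_of_all _ fun x => ?_)]
        · exact (pointSum_ne_top _ _ fun z => ENNReal.ofReal_ne_top).lt_top
        · exact (pointSum_ne_top _ _ fun z => ENNReal.ofReal_ne_top).lt_top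
    _ = ∫ y, φ y.1 y.2 ∂(μ.prod Λ) := by
        rw [integral_eq_lintegral_pos_part_sub_lintegral_neg_part hint,
          key (fun e z => ENNReal.ofReal (φ e z)) hφ.ennreal_ofReal,
          key (fun e z => ENNReal.ofReal (-φ e z)) hφ.neg.ennreal_ofReal]
    _ = ∫ z, ∫ e, φ e z ∂μ ∂Λ := integral_prod_symm _ hint
    _ = _ := by
        rw [hΛ, integral_withDensity_eq_integral_toReal_smul hηm.ennreal_ofReal
          (ae_of_all _ fun z => ENNReal.ofReal_lt_top)]
        simp_rw [ENNReal.toReal_ofReal (h.etaExt_nonneg _), smul_eq_mul]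

lemma integral_pointSum_prod_complex {φ : E → ℝ × ℝ → ℂ} (h : ObservationCondition ν η f)
    (hφ : Measurable (Function.uncurry φ))
    (hfin : ∫⁻ z, (∫⁻ e, ‖φ e z‖ₑ ∂μ) * ENNReal.ofReal (etaExt η z) ≠ ⊤) :
    ∫ x, pointSum x.2 (φ x.1) ∂(μ.prod ν) = ∫ z, (etaExt η z : ℂ) * ∫ e, φ e z ∂μ := by
  have hηm := h.measurable_etaExt
  have hL := h.integrable_pointSum_prod hφ hfin
  have hmz : Measurable fun z => ∫⁻ e, ‖φ e z‖ₑ ∂μ := Measurable.lintegral_prod_left' hφ.enorm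
  have hsm : StronglyMeasurable fun z => ∫ e, φ e z ∂μ :=
    hφ.stronglyMeasurable.integral_prod_left
  have hR : Integrable fun z => (etaExt η z : ℂ) * ∫ e, φ e z ∂μ := by
    refine ⟨(Complex.measurable_ofReal.comp hηm).aestronglyMeasurable.mul
      hsm.aestronglyMeasurable, lt_of_le_of_lt (lintegral_mono fun z => ?_) hfin.lt_top⟩
    rw [enorm_mul, mul_comm]
    gcongr
    · exact enorm_integral_le_lintegral_enorm _
    · rw [← ofReal_norm, Complex.norm_real, Real.norm_of_nonneg (h.etaExt_nonneg z)]
  -- Finiteness of the double integral gives integrability of the marks for almost every `z` of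
  -- positive intensity. Where the intensity vanishes there is nothing to prove.
  have hae : ∀ᵐ z, etaExt η z = 0 ∨ Integrable (fun e => φ e z) μ := by
    filter_upwards [ae_lt_top (hmz.mul hηm.ennreal_ofReal) hfin] with z hz
    by_cases h0 : etaExt η z = 0
    · exact Or.inl h0
    · refine Or.inr ⟨(hφ.comp measurable_prodMk_right).aestronglyMeasurable, ?_⟩
      by_contra hc
      rw [hasFiniteIntegral_iff_enorm, not_lt, top_le_iff] at hc
      rw [Pi.mul_apply, hc, ENNReal.top_mul] at hz
      · exact lt_irrefl _ hz
      · rw [Ne, ENNReal.ofReal_eq_zero, not_le]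
        exact lt_of_le_of_ne (h.etaExt_nonneg z) (Ne.symm h0)
  have hproj : ∀ (L : ℂ →L[ℝ] ℝ), (∀ w, ‖L w‖ ≤ ‖w‖) →
      L (∫ x, pointSum x.2 (φ x.1) ∂(μ.prod ν)) = L (∫ z, (etaExt η z : ℂ) * ∫ e, φ e z ∂μ) := by
    intro L hL1
    rw [← L.integral_comp_comm hL, ← L.integral_comp_comm hR]
    have e1 : ∀ x : E × ObsTimes, L (pointSum x.2 (φ x.1)) = pointSum x.2 (fun z => L (φ x.1 z)) :=
      fun x => map_sum L _ _
    simp_rw [e1]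
    rw [h.integral_pointSum_prod (φ := fun e z => L (φ e z)) (L.measurable.comp hφ)]
    · refine integral_congr_ae ?_
      filter_upwards [hae] with z hz
      have e2 : (etaExt η z : ℂ) * ∫ e, φ e z ∂μ = etaExt η z • ∫ e, φ e z ∂μ := by
        rw [Complex.real_smul]
      simp only [e2, map_smul, smul_eq_mul]
      rcases hz with hz | hz
      · rw [hz, zero_mul, zero_mul]
      · rw [← L.integral_comp_comm hz]
    · refine (lt_of_le_of_lt (lintegral_mono fun z => ?_) hfin.lt_top).ne
      gcongr with e
      exact enorm_le_iff_norm_le.2 (hL1 _)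
  apply Complex.ext
  · exact hproj Complex.reCLM fun w => Complex.abs_re_le_norm w
  · exact hproj Complex.imCLM fun w => Complex.abs_im_le_norm w

end ObservationCondition

end Campbell

/-! ### Averages of independent copies -/

section Averages

variable {Ω A : Type*} [MeasurableSpace Ω] [MeasurableSpace A] {P : Measure Ω}
  [IsProbabilityMeasure P] {Q : Measure A} [IsProbabilityMeasure Q] {ζ : ℕ → Ω → A}

lemma sq_eLpNorm_two {B : Type*} [MeasurableSpace B] {m : Measure B} (u : B → ℝ) :
    eLpNorm u 2 m ^ 2 = ∫⁻ b, ‖u b‖ₑ ^ 2 ∂m := by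
  simpa using eLpNorm_nnreal_pow_eq_lintegral (f := u) (μ := m) (p := 2) (by norm_num)

/-- Variances of independent copies add, and a variance is at most the second moment. -/
lemma sq_eLpNorm_average_sub_le (hζ : ∀ i, HasLaw (ζ i) Q P)
    (hind : iIndepFun ζ P) {W : A → ℝ} (hW : Measurable W) (hW2 : MemLp W 2 Q) {n : ℕ} (hn : n ≠ 0) :
    eLpNorm (fun ω => (n : ℝ)⁻¹ * ∑ i ∈ Finset.range n, W (ζ i ω) - ∫ a, W a ∂Q) 2 P ^ 2
      ≤ (n : ℝ≥0∞)⁻¹ * ∫⁻ a, ‖W a‖ₑ ^ 2 ∂Q := by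
  have hmem : ∀ i, MemLp (fun ω => W (ζ i ω)) 2 P := fun i => by
    have h1 : MemLp W 2 (P.map (ζ i)) := (hζ i).map_eq ▸ hW2
    exact h1.comp_of_map (hζ i).aemeasurable
  have hmean : ∀ i, ∫ ω, W (ζ i ω) ∂P = ∫ a, W a ∂Q := fun i =>
    (hζ i).integral_comp hW.aestronglyMeasurable
  have hvar : ∀ i, Var[fun ω => W (ζ i ω); P] = Var[W; Q] := fun i => by
    rw [← (hζ i).map_eq, variance_map hW.aemeasurable (hζ i).aemeasurable]; rfl
  set S : Ω → ℝ := fun ω => (n : ℝ)⁻¹ * ∑ i ∈ Finset.range n, W (ζ i ω) with hS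
  have hSmem : MemLp S 2 P :=
    (memLp_finsetSum _ fun i _ => hmem i).const_mul _
  have hSmean : ∫ ω, S ω ∂P = ∫ a, W a ∂Q := by
    rw [hS, integral_const_mul, integral_finsetSum _ fun i _ => (hmem i).integrable (by norm_num)]
    simp only [hmean, Finset.sum_const, Finset.card_range, nsmul_eq_mul]
    field_simp
  have hSvar : Var[S; P] = (n : ℝ)⁻¹ * Var[W; Q] := by
    have h2 : Var[∑ i ∈ Finset.range n, fun ω => W (ζ i ω); P] = n * Var[W; Q] := by
      rw [IndepFun.variance_sum (fun i _ => hmem i)]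
      · simp only [hvar, Finset.sum_const, Finset.card_range, nsmul_eq_mul]
      · exact fun i _ j _ hij => (hind.comp (fun _ => W) fun _ => hW).indepFun hij
    have h3 : S = fun ω => (n : ℝ)⁻¹ * (∑ i ∈ Finset.range n, fun ω => W (ζ i ω)) ω := by
      ext ω; simp [hS]
    rw [h3, variance_const_mul, h2]
    field_simp
  have h4 : eLpNorm (fun ω => S ω - ∫ a, W a ∂Q) 2 P ^ 2 = ENNReal.ofReal (Var[S; P]) := by
    rw [sq_eLpNorm_two, ofReal_variance hSmem, evariance, hSmean]
  rw [h4, hSvar, ENNReal.ofReal_mul (by positivity),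
    ENNReal.ofReal_inv_of_pos (by positivity), ENNReal.ofReal_natCast]
  gcongr
  rw [ofReal_variance hW2]
  calc evariance W Q ≤ _ := le_of_eq (evariance_def' hW.aestronglyMeasurable)
    _ ≤ _ := tsub_le_self

omit [IsProbabilityMeasure P] [IsProbabilityMeasure Q] in
lemma eLpNorm_one_average_le (hζ : ∀ i, HasLaw (ζ i) Q P) {W : A → ℝ} (hW : Measurable W) (n : ℕ) :
    eLpNorm (fun ω => (n : ℝ)⁻¹ * ∑ i ∈ Finset.range n, W (ζ i ω)) 1 P ≤ ∫⁻ a, ‖W a‖ₑ ∂Q := by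
  rcases eq_or_ne n 0 with rfl | hn
  · simp
  have h1 : ∀ i, ∫⁻ ω, ‖W (ζ i ω)‖ₑ ∂P = ∫⁻ a, ‖W a‖ₑ ∂Q := fun i =>
    (hζ i).lintegral_comp hW.enorm.aemeasurable
  rw [eLpNorm_one_eq_lintegral_enorm]
  calc ∫⁻ ω, ‖(n : ℝ)⁻¹ * ∑ i ∈ Finset.range n, W (ζ i ω)‖ₑ ∂P
      ≤ ∫⁻ ω, ‖(n : ℝ)⁻¹‖ₑ * ∑ i ∈ Finset.range n, ‖W (ζ i ω)‖ₑ ∂P := by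
        refine lintegral_mono fun ω => ?_
        rw [enorm_mul]
        gcongr
        exact enorm_sum_le _ _
    _ = ‖(n : ℝ)⁻¹‖ₑ * ∑ i ∈ Finset.range n, ∫⁻ a, ‖W a‖ₑ ∂Q := by
        rw [lintegral_const_mul' _ _ (by simp), lintegral_finsetSum']
        · simp only [h1]
        · exact fun i _ => (hW.comp_aemeasurable (hζ i).aemeasurable).enorm
    _ = ∫⁻ a, ‖W a‖ₑ ∂Q := by
        rw [Finset.sum_const, Finset.card_range, nsmul_eq_mul, ← mul_assoc,
          Real.enorm_eq_ofReal (by positivity), ENNReal.ofReal_inv_of_pos (by positivity),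
          ENNReal.ofReal_natCast, ENNReal.inv_mul_cancel (by simpa using hn) (by simp), one_mul]

/-- A weak law of large numbers for triangular arrays: a part with small second moments plus a
part with small first moments. -/
lemma tendstoInMeasure_average (hζ : ∀ i, HasLaw (ζ i) Q P) (hind : iIndepFun ζ P)
    {V W : ℕ → A → ℝ} (hV : ∀ n, Measurable (V n)) (hW : ∀ n, Measurable (W n))
    (hV2 : Tendsto (fun n : ℕ => (n : ℝ≥0∞)⁻¹ * ∫⁻ a, ‖V n a‖ₑ ^ 2 ∂Q) atTop (𝓝 0))
    (hW1 : Tendsto (fun n => ∫⁻ a, ‖W n a‖ₑ ∂Q) atTop (𝓝 0)) {c : ℝ}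
    (hc : Tendsto (fun n => ∫ a, (V n a + W n a) ∂Q) atTop (𝓝 c)) :
    TendstoInMeasure P (fun (n : ℕ) ω => (n : ℝ)⁻¹ * ∑ i ∈ Finset.range n,
      (V n (ζ i ω) + W n (ζ i ω))) atTop (fun _ => c) := by
  have hζm : ∀ i, AEMeasurable (ζ i) P := fun i => (hζ i).aemeasurable
  have hVavg : ∀ (F : ℕ → A → ℝ), (∀ n, Measurable (F n)) → ∀ n : ℕ,
      AEStronglyMeasurable (fun ω => (n : ℝ)⁻¹ * ∑ i ∈ Finset.range n, F n (ζ i ω)) P := by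
    intro F hF n
    refine AEMeasurable.aestronglyMeasurable (AEMeasurable.const_mul ?_ _)
    exact Finset.aemeasurable_fun_sum _ fun i _ => (hF n).comp_aemeasurable (hζm i)
  -- eventually the two parts are square integrable and integrable
  have evV : ∀ᶠ n : ℕ in atTop, MemLp (V n) 2 Q := by
    filter_upwards [hV2.eventually_lt_const (zero_lt_one), eventually_ne_atTop 0] with n hn hn0
    refine ⟨(hV n).aestronglyMeasurable, ?_⟩
    have : ∫⁻ a, ‖V n a‖ₑ ^ 2 ∂Q ≠ ⊤ := by
      intro h
      rw [h, ENNReal.mul_top (by simp)] at hn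
      exact absurd hn (by simp)
    rw [← sq_eLpNorm_two] at this
    refine lt_top_iff_ne_top.2 fun h => this ?_
    rw [h]; simp
  have evW : ∀ᶠ n : ℕ in atTop, Integrable (W n) Q := by
    filter_upwards [hW1.eventually_lt_const (zero_lt_one)] with n hn
    exact ⟨(hW n).aestronglyMeasurable, hn.trans ENNReal.one_lt_top⟩
  have hWmean : Tendsto (fun n => ∫ a, W n a ∂Q) atTop (𝓝 0) := by
    rw [tendsto_zero_iff_enorm_tendsto_zero]
    exact tendsto_of_tendsto_of_tendsto_of_le_of_le tendsto_const_nhds hW1 (fun _ => zero_le)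
      (fun n => enorm_integral_le_lintegral_enorm _)
  have hVmean : Tendsto (fun n => ∫ a, V n a ∂Q) atTop (𝓝 c) := by
    have := hc.sub hWmean
    rw [sub_zero] at this
    refine this.congr' ?_
    filter_upwards [evV, evW] with n h1 h2
    rw [integral_add (h1.integrable (by norm_num)) h2]; ring
  have e1 : Tendsto (fun n : ℕ => eLpNorm (fun ω => (n : ℝ)⁻¹ * ∑ i ∈ Finset.range n, V n (ζ i ω)
      - ∫ a, V n a ∂Q) 2 P) atTop (𝓝 0) := by
    have hsq : Tendsto (fun n : ℕ => eLpNorm (fun ω => (n : ℝ)⁻¹ * ∑ i ∈ Finset.range n,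
        V n (ζ i ω) - ∫ a, V n a ∂Q) 2 P ^ 2) atTop (𝓝 0) := by
      refine tendsto_of_tendsto_of_tendsto_of_le_of_le' tendsto_const_nhds hV2
        (Eventually.of_forall fun _ => zero_le) ?_
      filter_upwards [evV, eventually_ne_atTop 0] with n h1 h2
      exact sq_eLpNorm_average_sub_le hζ hind (hV n) h1 h2
    have := (ENNReal.continuous_rpow_const (y := (1 / 2 : ℝ))).tendsto 0 |>.comp hsq
    rw [ENNReal.zero_rpow_of_pos (by norm_num)] at this
    refine this.congr fun n => ?_
    simp only [Function.comp_apply]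
    rw [← ENNReal.rpow_natCast, ← ENNReal.rpow_mul]
    norm_num
  have e2 : Tendsto (fun n : ℕ => eLpNorm (fun ω => (n : ℝ)⁻¹ * ∑ i ∈ Finset.range n,
      W n (ζ i ω)) 1 P) atTop (𝓝 0) :=
    tendsto_of_tendsto_of_tendsto_of_le_of_le tendsto_const_nhds hW1 (fun _ => zero_le)
      (fun n => eLpNorm_one_average_le hζ (hW n) n)
  have e3 : Tendsto (fun n => ‖(∫ a, V n a ∂Q) - c‖ₑ) atTop (𝓝 0) := by
    have := hVmean.sub_const c
    rw [sub_self, tendsto_zero_iff_enorm_tendsto_zero] at this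
    exact this
  refine tendstoInMeasure_of_tendsto_eLpNorm one_ne_zero
    (hVavg (fun n a => V n a + W n a) fun n => (hV n).add (hW n)) aestronglyMeasurable_const ?_
  have hsum := (e1.add e2).add e3
  rw [add_zero, add_zero] at hsum
  refine tendsto_of_tendsto_of_tendsto_of_le_of_le tendsto_const_nhds hsum (fun _ => zero_le)
    fun n => ?_
  -- The centred average of `V`, the uncentred average of `W`, and the error of the mean of `V`,
  -- which shares the limit `c` because the mean of `W` vanishes. All three tend to zero in `L¹`.
  have hdec : ((fun ω => (n : ℝ)⁻¹ * ∑ i ∈ Finset.range n, (V n (ζ i ω) + W n (ζ i ω)))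
      - fun _ => c) = ((fun ω => (n : ℝ)⁻¹ * ∑ i ∈ Finset.range n, V n (ζ i ω) - ∫ a, V n a ∂Q)
      + (fun ω => (n : ℝ)⁻¹ * ∑ i ∈ Finset.range n, W n (ζ i ω)))
      + fun _ => (∫ a, V n a ∂Q) - c := by
    ext ω
    simp only [Pi.sub_apply, Pi.add_apply, Finset.sum_add_distrib]
    ring
  have m1 := (hVavg V hV n).sub (aestronglyMeasurable_const (b := ∫ a, V n a ∂Q))
  have m2 := hVavg W hW n
  simp only
  rw [hdec]
  refine (eLpNorm_add_le (m1.add m2) aestronglyMeasurable_const le_rfl).trans ?_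
  refine add_le_add ((eLpNorm_add_le m1 m2 le_rfl).trans (add_le_add ?_ le_rfl)) ?_
  · exact eLpNorm_le_eLpNorm_of_exponent_le (by norm_num) m1
  · rw [eLpNorm_const _ one_ne_zero (IsProbabilityMeasure.ne_zero P)]; simp

end Averages

/-! ### Kernel-weighted sums of one subject -/

section KernelSum

variable {E : Type*}

/-- The kernel-weighted sum `∫ κ_h(z - t) g(z) dN*(z)` of one subject. -/
noncomputable def kernelSum (κ : ℝ × ℝ → ℝ) (h₁ h₂ t : ℝ) (g : ℝ × ℝ → E → ℝ)
    (x : E × ObsTimes) : ℝ :=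
  pointSum x.2 fun z => kern κ h₁ h₂ t z * g z x.1

lemma kernelSum_add (κ κ' : ℝ × ℝ → ℝ) (h₁ h₂ t : ℝ) (g : ℝ × ℝ → E → ℝ) (x : E × ObsTimes) :
    kernelSum (fun z => κ z + κ' z) h₁ h₂ t g x
      = kernelSum κ h₁ h₂ t g x + kernelSum κ' h₁ h₂ t g x := by
  simp only [kernelSum, pointSum, ← Finset.sum_add_distrib, kern, scaledKernel]
  refine Finset.sum_congr rfl fun i _ => ?_
  ring

variable [MeasurableSpace E]

lemma measurable_kern_mul {κ : ℝ × ℝ → ℝ} (hκ : Measurable κ) (h₁ h₂ t : ℝ) {g : ℝ × ℝ → E → ℝ}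
    (hg : Measurable (Function.uncurry g)) :
    Measurable (Function.uncurry fun (e : E) z => kern κ h₁ h₂ t z * g z e) :=
  ((measurable_kern hκ h₁ h₂ t).comp measurable_snd).mul (hg.comp measurable_swap)

lemma measurable_kernelSum {κ : ℝ × ℝ → ℝ} (hκ : Measurable κ) (h₁ h₂ t : ℝ) {g : ℝ × ℝ → E → ℝ}
    (hg : Measurable (Function.uncurry g)) : Measurable (kernelSum κ h₁ h₂ t g) :=
  measurable_pointSum_prod (measurable_kern_mul hκ h₁ h₂ t hg)

variable {μ : Measure E} [IsProbabilityMeasure μ]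
  {ν : Measure ObsTimes} {η : ℝ × ℝ → ℝ} {f : (ℝ × ℝ) × (ℝ × ℝ) → ℝ}
  {g : ℝ × ℝ → E → ℝ} {B : ℝ≥0}

lemma lintegral_enorm_le_of_sq {u : E → ℝ}
    (hu : ∫⁻ e, ‖u e‖ₑ ^ 2 ∂μ ≤ B) : ∫⁻ e, ‖u e‖ₑ ∂μ ≤ (1 + B : ℝ≥0) := by
  calc ∫⁻ e, ‖u e‖ₑ ∂μ ≤ ∫⁻ e, (1 + ‖u e‖ₑ ^ 2) ∂μ := by
        refine lintegral_mono fun e => ?_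
        rcases le_total ‖u e‖ₑ 1 with h | h
        · exact h.trans le_self_add
        · calc ‖u e‖ₑ = ‖u e‖ₑ * 1 := (mul_one _).symm
            _ ≤ ‖u e‖ₑ * ‖u e‖ₑ := by gcongr
            _ ≤ _ := by rw [sq]; exact le_add_self
    _ = 1 + ∫⁻ e, ‖u e‖ₑ ^ 2 ∂μ := by rw [lintegral_add_left measurable_const]; simp
    _ ≤ _ := by push_cast; gcongr

namespace ObservationCondition

/-- First moments of kernel-weighted sums. -/
lemma exists_lintegral_kern_mul_le (h : ObservationCondition ν η f)
    (hB : ∀ z ∈ unitSq, ∫⁻ e, ‖g z e‖ₑ ^ 2 ∂μ ≤ B) :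
    ∃ c : ℝ≥0, ∀ κ : ℝ × ℝ → ℝ, Measurable κ → ∀ h₁ h₂ t : ℝ, 0 < h₁ → 0 < h₂ →
      ∫⁻ z, (∫⁻ e, ‖kern κ h₁ h₂ t z * g z e‖ₑ ∂μ) * ENNReal.ofReal (etaExt η z)
        ≤ c * ∫⁻ x, ‖κ x‖ₑ := by
  obtain ⟨c₁, hc₁⟩ := h.exists_etaExt_le
  refine ⟨(1 + B) * c₁, fun κ hκ h₁ h₂ t p1 p2 => ?_⟩
  rw [← lintegral_enorm_kern p1 p2 t, ← lintegral_const_mul _ (measurable_kern hκ _ _ _).enorm]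
  refine lintegral_mono fun z => ?_
  by_cases hz : z ∈ unitSq
  · simp_rw [enorm_mul]
    rw [lintegral_const_mul' _ _ (by simp)]
    calc ‖kern κ h₁ h₂ t z‖ₑ * (∫⁻ e, ‖g z e‖ₑ ∂μ) * ENNReal.ofReal (etaExt η z)
        ≤ ‖kern κ h₁ h₂ t z‖ₑ * (1 + B : ℝ≥0) * (c₁ : ℝ≥0∞) := by
          gcongr
          · exact lintegral_enorm_le_of_sq (hB z hz)
          · exact ENNReal.ofReal_le_of_le_toReal (by simpa using hc₁ z)
      _ = _ := by push_cast; ring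
  · rw [etaExt, indicator_of_notMem hz]; simp

variable [IsProbabilityMeasure ν]

lemma exists_lintegral_enorm_kernelSum_le (h : ObservationCondition ν η f)
    (hg : Measurable (Function.uncurry g)) (hB : ∀ z ∈ unitSq, ∫⁻ e, ‖g z e‖ₑ ^ 2 ∂μ ≤ B) :
    ∃ c : ℝ≥0, ∀ κ : ℝ × ℝ → ℝ, Measurable κ → ∀ h₁ h₂ t : ℝ, 0 < h₁ → 0 < h₂ →
      ∫⁻ x, ‖kernelSum κ h₁ h₂ t g x‖ₑ ∂(μ.prod ν) ≤ c * ∫⁻ x, ‖κ x‖ₑ := by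
  obtain ⟨c, hc⟩ := h.exists_lintegral_kern_mul_le hB
  refine ⟨c, fun κ hκ h₁ h₂ t p1 p2 => le_trans ?_ (hc κ hκ h₁ h₂ t p1 p2)⟩
  rw [← h.lintegral_pointSum_prod (φ := fun e z => ‖kern κ h₁ h₂ t z * g z e‖ₑ)
    (measurable_kern_mul hκ h₁ h₂ t hg).enorm]
  exact lintegral_mono fun x => enorm_pointSum_le _ _

/-- Second moments of kernel-weighted sums. -/
lemma exists_lintegral_sq_kernelSum_le (h : ObservationCondition ν η f)
    (hg : Measurable (Function.uncurry g)) (hB : ∀ z ∈ unitSq, ∫⁻ e, ‖g z e‖ₑ ^ 2 ∂μ ≤ B) :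
    ∃ c : ℝ≥0, ∀ κ : ℝ × ℝ → ℝ, Measurable κ → ∀ h₁ h₂ t : ℝ, 0 < h₁ → 0 < h₂ →
      ENNReal.ofReal (h₁ * h₂) * ∫⁻ x, ‖kernelSum κ h₁ h₂ t g x‖ₑ ^ 2 ∂(μ.prod ν)
        ≤ c * ∫⁻ x, ‖κ x‖ₑ ^ 2 := by
  obtain ⟨c, hc⟩ := h.exists_lintegral_sq_pointSum_le
  refine ⟨c * B, fun κ hκ h₁ h₂ t p1 p2 => ?_⟩
  have hm := measurable_kern_mul hκ h₁ h₂ t hg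
  have hk : Measurable fun z => ‖kern κ h₁ h₂ t z‖ₑ ^ 2 :=
    (measurable_kern hκ h₁ h₂ t).enorm.pow_const 2
  have he : ∀ e, Measurable fun z => ‖kern κ h₁ h₂ t z * g z e‖ₑ := fun e =>
    ((measurable_kern hκ h₁ h₂ t).mul (hg.comp (measurable_id.prodMk measurable_const))).enorm
  have main : ∫⁻ x, ‖kernelSum κ h₁ h₂ t g x‖ₑ ^ 2 ∂(μ.prod ν)
      ≤ c * B * ∫⁻ z, ‖kern κ h₁ h₂ t z‖ₑ ^ 2 := by
    calc ∫⁻ x, ‖kernelSum κ h₁ h₂ t g x‖ₑ ^ 2 ∂(μ.prod ν)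
        ≤ ∫⁻ x, pointSum x.2 (fun z => ‖kern κ h₁ h₂ t z * g z x.1‖ₑ) ^ 2 ∂(μ.prod ν) :=
          lintegral_mono fun x => pow_le_pow_left' (enorm_pointSum_le _ _) 2
      _ = ∫⁻ e, ∫⁻ τ, pointSum τ (fun z => ‖kern κ h₁ h₂ t z * g z e‖ₑ) ^ 2 ∂ν ∂μ :=
          lintegral_prod _ ((measurable_pointSum_prod
            (g := fun e z => ‖kern κ h₁ h₂ t z * g z e‖ₑ) hm.enorm).pow_const 2).aemeasurable
      _ ≤ ∫⁻ e, (c * ∫⁻ z in unitSq, ‖kern κ h₁ h₂ t z * g z e‖ₑ ^ 2) ∂μ :=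
          lintegral_mono fun e => hc (fun z => ‖kern κ h₁ h₂ t z * g z e‖ₑ) (he e)
      _ = c * ∫⁻ z in unitSq, ∫⁻ e, ‖kern κ h₁ h₂ t z * g z e‖ₑ ^ 2 ∂μ := by
          have hm2 : Measurable fun x : E × (ℝ × ℝ) => ‖kern κ h₁ h₂ t x.2 * g x.2 x.1‖ₑ ^ 2 :=
            hm.enorm.pow_const 2
          rw [lintegral_const_mul' _ _ (by simp)]
          congr 1
          exact lintegral_lintegral_swap (f := fun e z => ‖kern κ h₁ h₂ t z * g z e‖ₑ ^ 2)
            hm2.aemeasurable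
      _ ≤ c * ∫⁻ z in unitSq, B * ‖kern κ h₁ h₂ t z‖ₑ ^ 2 := by
          refine mul_le_mul_right ?_ _
          refine setLIntegral_mono (hk.const_mul _) fun z hz => ?_
          simp_rw [enorm_mul, mul_pow]
          rw [lintegral_const_mul' _ _ (by finiteness), mul_comm]
          gcongr
          exact hB z hz
      _ ≤ c * ∫⁻ z, B * ‖kern κ h₁ h₂ t z‖ₑ ^ 2 := by
          gcongr; exact Measure.restrict_le_self
      _ = _ := by rw [lintegral_const_mul _ hk, mul_assoc]
  calc _ ≤ ENNReal.ofReal (h₁ * h₂) * (c * B * ∫⁻ z, ‖kern κ h₁ h₂ t z‖ₑ ^ 2) := by gcongr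
    _ = c * B * (ENNReal.ofReal (h₁ * h₂) * ∫⁻ z, ‖kern κ h₁ h₂ t z‖ₑ ^ 2) := by ring
    _ = _ := by rw [lintegral_enorm_sq_kern p1 p2]; push_cast; rfl

/-- Means of kernel-weighted sums. -/
lemma integral_kernelSum (h : ObservationCondition ν η f)
    (hg : Measurable (Function.uncurry g)) (hB : ∀ z ∈ unitSq, ∫⁻ e, ‖g z e‖ₑ ^ 2 ∂μ ≤ B)
    {κ : ℝ × ℝ → ℝ} (hκ : Measurable κ) (hκi : Integrable κ) {h₁ h₂ : ℝ} (p1 : 0 < h₁)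
    (p2 : 0 < h₂) (t : ℝ) :
    ∫ x, kernelSum κ h₁ h₂ t g x ∂(μ.prod ν) = ∫ x, κ x *
      (etaExt η (rescale t h₁ h₂ x) * ∫ e, g (rescale t h₁ h₂ x) e ∂μ) := by
  obtain ⟨c, hc⟩ := h.exists_lintegral_kern_mul_le hB
  have hfin : ∫⁻ z, (∫⁻ e, ‖kern κ h₁ h₂ t z * g z e‖ₑ ∂μ) * ENNReal.ofReal (etaExt η z) ≠ ⊤ :=
    ((hc κ hκ h₁ h₂ t p1 p2).trans_lt (ENNReal.mul_lt_top (by simp) hκi.hasFiniteIntegral)).ne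
  have e1 := h.integral_pointSum_prod (φ := fun e z => kern κ h₁ h₂ t z * g z e)
    (measurable_kern_mul hκ h₁ h₂ t hg) hfin
  have hpos : h₁ * h₂ ≠ 0 := by positivity
  change ∫ x, pointSum x.2 (fun z => kern κ h₁ h₂ t z * g z x.1) ∂(μ.prod ν) = _
  rw [e1, integral_rescale t p1 p2, ← integral_smul]
  congr 1 with x
  rw [integral_const_mul, kern_rescale p1 p2, smul_eq_mul]
  field_simp

end ObservationCondition

/-! ### Convergence in probability of kernel-weighted averages -/

variable [IsProbabilityMeasure ν] {Ω : Type*} [MeasurableSpace Ω] {P : Measure Ω} [IsProbabilityMeasure P]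
  {ζ : ℕ → Ω → E × ObsTimes} {h₁ h₂ : ℕ → ℝ}

/-- Convergence in probability of a scaled kernel-weighted average, under a truncation of the
kernel to sets on which it is square integrable. -/
lemma tendstoInMeasure_kernelAverage (hζ : ∀ i, HasLaw (ζ i) (μ.prod ν) P) (hind : iIndepFun ζ P)
    (h : ObservationCondition ν η f) (hg : Measurable (Function.uncurry g))
    (hB : ∀ z ∈ unitSq, ∫⁻ e, ‖g z e‖ₑ ^ 2 ∂μ ≤ B) {κ : ℝ × ℝ → ℝ} (hκ : Measurable κ)
    (hκi : Integrable κ) (p1 : ∀ n, 0 < h₁ n) (p2 : ∀ n, 0 < h₂ n) (t : ℝ)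
    {A : ℕ → Set (ℝ × ℝ)} (hA : ∀ n, MeasurableSet (A n)) {s : ℕ → ℝ} (hs : ∀ n, 0 ≤ s n)
    (H1 : Tendsto (fun n : ℕ => ENNReal.ofReal (s n ^ 2 / (n * h₁ n * h₂ n)) *
      ∫⁻ x in A n, ‖κ x‖ₑ ^ 2) atTop (𝓝 0))
    (H2 : Tendsto (fun n => ENNReal.ofReal (s n) * ∫⁻ x in (A n)ᶜ, ‖κ x‖ₑ) atTop (𝓝 0)) {c : ℝ}
    (H3 : Tendsto (fun n => s n * ∫ x, κ x * (etaExt η (rescale t (h₁ n) (h₂ n) x) *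
      ∫ e, g (rescale t (h₁ n) (h₂ n) x) e ∂μ)) atTop (𝓝 c)) :
    TendstoInMeasure P (fun (n : ℕ) ω => s n * ((n : ℝ)⁻¹ * ∑ i ∈ Finset.range n,
      kernelSum κ (h₁ n) (h₂ n) t g (ζ i ω))) atTop (fun _ => c) := by
  obtain ⟨c₁, hc₁⟩ := h.exists_lintegral_enorm_kernelSum_le hg hB
  obtain ⟨c₂, hc₂⟩ := h.exists_lintegral_sq_kernelSum_le hg hB
  have m1 : ∀ n, Measurable ((A n).indicator κ) := fun n => hκ.indicator (hA n)
  have m2 : ∀ n, Measurable ((A n)ᶜ.indicator κ) := fun n => hκ.indicator (hA n).compl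
  have hsum : ∀ n x, s n * kernelSum ((A n).indicator κ) (h₁ n) (h₂ n) t g x
      + s n * kernelSum ((A n)ᶜ.indicator κ) (h₁ n) (h₂ n) t g x
      = s n * kernelSum κ (h₁ n) (h₂ n) t g x := by
    intro n x
    rw [← mul_add, ← kernelSum_add]
    congr 2
    ext z
    exact congrFun (indicator_self_add_compl (A n) κ) z
  -- The kernel is split over `A n` and its complement. The first part has `n⁻¹ E V²` at most a
  -- multiple of `s² / (n h₁ h₂) ∫_A κ²`, the second has `E |W|` at most a multiple of `s ∫_{Aᶜ}
  -- |κ|`; `H1` and `H2` make these vanish.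
  have key := tendstoInMeasure_average hζ hind
    (V := fun n x => s n * kernelSum ((A n).indicator κ) (h₁ n) (h₂ n) t g x)
    (W := fun n x => s n * kernelSum ((A n)ᶜ.indicator κ) (h₁ n) (h₂ n) t g x)
    (fun n => (measurable_kernelSum (m1 n) _ _ _ hg).const_mul _)
    (fun n => (measurable_kernelSum (m2 n) _ _ _ hg).const_mul _) ?_ ?_ (c := c) ?_
  · refine key.congr_left fun n => ae_of_all _ fun ω => ?_
    simp only [hsum, ← Finset.mul_sum]
    ring
  · have hlim : Tendsto (fun n : ℕ => c₂ * (ENNReal.ofReal (s n ^ 2 / (n * h₁ n * h₂ n)) *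
        ∫⁻ x in A n, ‖κ x‖ₑ ^ 2)) atTop (𝓝 0) := by
      simpa using ENNReal.Tendsto.const_mul H1 (Or.inr (by simp))
    refine tendsto_of_tendsto_of_tendsto_of_le_of_le' tendsto_const_nhds hlim
      (Eventually.of_forall fun _ => zero_le) ?_
    filter_upwards [eventually_gt_atTop 0] with n hn
    have hhp : 0 < h₁ n * h₂ n := mul_pos (p1 n) (p2 n)
    have e1 : (n : ℝ≥0∞)⁻¹ * ENNReal.ofReal (s n) ^ 2
        = ENNReal.ofReal (s n ^ 2 / (n * h₁ n * h₂ n)) * ENNReal.ofReal (h₁ n * h₂ n) := by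
      rw [← ENNReal.ofReal_natCast, ← ENNReal.ofReal_inv_of_pos (by positivity),
        ← ENNReal.ofReal_pow (hs n), ← ENNReal.ofReal_mul (by positivity),
        ← ENNReal.ofReal_mul (by have := p1 n; have := p2 n; positivity)]
      congr 1
      have := (p1 n).ne'
      have := (p2 n).ne'
      field_simp
    calc (n : ℝ≥0∞)⁻¹ * ∫⁻ x, ‖s n * kernelSum ((A n).indicator κ) (h₁ n) (h₂ n) t g x‖ₑ ^ 2
          ∂(μ.prod ν)
        = ((n : ℝ≥0∞)⁻¹ * ENNReal.ofReal (s n) ^ 2) *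
          ∫⁻ x, ‖kernelSum ((A n).indicator κ) (h₁ n) (h₂ n) t g x‖ₑ ^ 2 ∂(μ.prod ν) := by
          simp_rw [enorm_mul, mul_pow, Real.enorm_eq_ofReal (hs n)]
          rw [lintegral_const_mul' _ _ (by finiteness), mul_assoc]
      _ = ENNReal.ofReal (s n ^ 2 / (n * h₁ n * h₂ n)) * (ENNReal.ofReal (h₁ n * h₂ n) *
          ∫⁻ x, ‖kernelSum ((A n).indicator κ) (h₁ n) (h₂ n) t g x‖ₑ ^ 2 ∂(μ.prod ν)) := by
          rw [e1, mul_assoc]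
      _ ≤ ENNReal.ofReal (s n ^ 2 / (n * h₁ n * h₂ n)) *
          (c₂ * ∫⁻ x, ‖(A n).indicator κ x‖ₑ ^ 2) := by
          exact mul_le_mul_right (hc₂ _ (m1 n) _ _ _ (p1 n) (p2 n)) _
      _ = _ := by
          have : ∀ x, ‖(A n).indicator κ x‖ₑ ^ 2 = (A n).indicator (fun x => ‖κ x‖ₑ ^ 2) x := by
            intro x; by_cases hx : x ∈ A n <;> simp [hx]
          simp_rw [this]
          rw [lintegral_indicator (hA n)]
          ring
  · have hlim : Tendsto (fun n : ℕ => c₁ * (ENNReal.ofReal (s n) *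
        ∫⁻ x in (A n)ᶜ, ‖κ x‖ₑ)) atTop (𝓝 0) := by
      simpa using ENNReal.Tendsto.const_mul H2 (Or.inr (by simp))
    refine tendsto_of_tendsto_of_tendsto_of_le_of_le tendsto_const_nhds hlim
      (fun _ => zero_le) fun n => ?_
    calc ∫⁻ x, ‖s n * kernelSum ((A n)ᶜ.indicator κ) (h₁ n) (h₂ n) t g x‖ₑ ∂(μ.prod ν)
        = ENNReal.ofReal (s n) *
          ∫⁻ x, ‖kernelSum ((A n)ᶜ.indicator κ) (h₁ n) (h₂ n) t g x‖ₑ ∂(μ.prod ν) := by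
          simp_rw [enorm_mul, Real.enorm_eq_ofReal (hs n)]
          rw [lintegral_const_mul' _ _ (by finiteness)]
      _ ≤ ENNReal.ofReal (s n) * (c₁ * ∫⁻ x, ‖(A n)ᶜ.indicator κ x‖ₑ) := by
          gcongr; exact hc₁ _ (m2 n) _ _ _ (p1 n) (p2 n)
      _ = _ := by
          simp_rw [enorm_indicator_eq_indicator_enorm]
          rw [lintegral_indicator (hA n).compl]
          ring
  · refine H3.congr fun n => ?_
    simp only [hsum]
    rw [integral_const_mul, h.integral_kernelSum hg hB hκ hκi (p1 n) (p2 n)]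

end KernelSum

/-! ### Expansions of the complex exponential -/

/-- For `|y| ≤ 1` the series remainder is at most `y² e` and `e ≤ 3`; for `|y| ≥ 1` the trivial
bound `2 + |y|` is at most `3 y²`. -/
lemma norm_exp_mul_I_sub_one_sub_le (y : ℝ) :
    ‖Complex.exp (y * Complex.I) - 1 - y * Complex.I‖ ≤ 3 * y ^ 2 := by
  have hn : ‖(y : ℂ) * Complex.I‖ = |y| := by simp
  rcases le_total |y| 1 with hy | hy
  · have h := Complex.norm_exp_sub_sum_le_norm_mul_exp (y * Complex.I) 2
    have e1 : Complex.exp (y * Complex.I) - ∑ m ∈ Finset.range 2, (y * Complex.I) ^ m / m.factorial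
        = Complex.exp (y * Complex.I) - 1 - y * Complex.I := by
      simp [Finset.sum_range_succ]; ring
    rw [e1, hn, sq_abs] at h
    have h3 : Real.exp |y| ≤ 3 := (Real.exp_le_exp.2 hy).trans (Real.exp_one_lt_d9.le.trans (by norm_num))
    nlinarith [sq_nonneg y]
  · have h1 : ‖Complex.exp (y * Complex.I) - 1 - y * Complex.I‖ ≤ 1 + 1 + |y| := by
      refine (norm_sub_le _ _).trans (add_le_add ((norm_sub_le _ _).trans ?_) hn.le)
      rw [Complex.norm_exp_ofReal_mul_I, norm_one]
    rw [← sq_abs y]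
    nlinarith

/-- For `|y| ≤ 1` the cubic remainder is used with `s ≤ 3`; for `|y| ≥ 1`, `3 y² + y² / 2` lies
below `4 |y|^s` because `2 ≤ s`. A real exponent is needed: the score, a product of two processes,
has moments only slightly above the second. -/
lemma norm_exp_mul_I_sub_quadratic_le (y : ℝ) {s : ℝ} (hs2 : 2 ≤ s) (hs3 : s ≤ 3) :
    ‖Complex.exp (y * Complex.I) - 1 - y * Complex.I + y ^ 2 / 2‖ ≤ 4 * |y| ^ s := by
  have hn : ‖(y : ℂ) * Complex.I‖ = |y| := by simp
  rcases le_total |y| 1 with hy | hy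
  · have h := Complex.norm_exp_sub_sum_le_norm_mul_exp (y * Complex.I) 3
    have e1 : Complex.exp (y * Complex.I) - ∑ m ∈ Finset.range 3, (y * Complex.I) ^ m / m.factorial
        = Complex.exp (y * Complex.I) - 1 - y * Complex.I + y ^ 2 / 2 := by
      simp [Finset.sum_range_succ, mul_pow]; ring
    rw [e1, hn] at h
    have h3 : Real.exp |y| ≤ 3 := (Real.exp_le_exp.2 hy).trans (Real.exp_one_lt_d9.le.trans (by norm_num))
    have h4 : |y| ^ 3 ≤ |y| ^ s := by
      rcases eq_or_lt_of_le (abs_nonneg y) with h0 | h0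
      · rw [← h0, Real.zero_rpow (by linarith)]; norm_num
      · rw [← Real.rpow_natCast]
        exact Real.rpow_le_rpow_of_exponent_ge h0 hy (by simpa using hs3)
    have h5 : 0 ≤ |y| ^ 3 := by positivity
    nlinarith
  · have h1 := norm_exp_mul_I_sub_one_sub_le y
    have h2 : ‖(y : ℂ) ^ 2 / 2‖ = y ^ 2 / 2 := by simp
    have h3 := norm_add_le (Complex.exp (y * Complex.I) - 1 - y * Complex.I) ((y : ℂ) ^ 2 / 2)
    have h4 : y ^ 2 ≤ |y| ^ s := by
      rw [← sq_abs, ← Real.rpow_natCast]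
      exact Real.rpow_le_rpow_of_exponent_le hy (by simpa using hs2)
    nlinarith [sq_nonneg y]

lemma norm_exp_mul_I_sub_one_le (y : ℝ) : ‖Complex.exp (y * Complex.I) - 1‖ ≤ |y| := by
  have := Real.norm_exp_I_mul_ofReal_sub_one_le (x := y)
  rwa [mul_comm] at this

/-- Induction on `S` from the identity `e^{i(x+X)} - 1 = (e^{ix} - 1) + (e^{iX} - 1) + (e^{ix} -
1)(e^{iX} - 1)`, whose last product is at most `|x| |X|`. It decouples the dependent points of one
subject up to pair interactions. -/
lemma norm_exp_sum_sub_le {ι : Type*} [DecidableEq ι] (S : Finset ι) (x : ι → ℝ) :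
    ‖Complex.exp ((∑ k ∈ S, x k : ℝ) * Complex.I) - 1
        - ∑ k ∈ S, (Complex.exp (x k * Complex.I) - 1)‖
      ≤ ∑ k ∈ S, ∑ l ∈ S.erase k, |x k| * |x l| := by
  induction S using Finset.induction_on with
  | empty => simp
  | insert a S ha ih =>
    set X := ∑ k ∈ S, x k with hX
    have e1 : Complex.exp ((∑ k ∈ insert a S, x k : ℝ) * Complex.I) - 1
        - ∑ k ∈ insert a S, (Complex.exp (x k * Complex.I) - 1)
        = (Complex.exp (x a * Complex.I) - 1) * (Complex.exp (X * Complex.I) - 1)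
          + (Complex.exp (X * Complex.I) - 1 - ∑ k ∈ S, (Complex.exp (x k * Complex.I) - 1)) := by
      rw [Finset.sum_insert ha, Finset.sum_insert ha, ← hX]
      push_cast
      rw [add_mul, Complex.exp_add]
      ring
    rw [e1, Finset.sum_insert ha, Finset.erase_insert ha]
    refine (norm_add_le _ _).trans (add_le_add ?_ (ih.trans ?_))
    · rw [norm_mul, ← Finset.mul_sum]
      refine mul_le_mul (norm_exp_mul_I_sub_one_le _) ((norm_exp_mul_I_sub_one_le _).trans ?_)
        (norm_nonneg _) (abs_nonneg _)
      exact Finset.abs_sum_le_sum_abs _ _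
    · refine Finset.sum_le_sum fun k _ => Finset.sum_le_sum_of_subset_of_nonneg ?_ ?_
      · exact Finset.erase_subset_erase _ (Finset.subset_insert _ _)
      · exact fun _ _ _ => by positivity

lemma norm_exp_pointSum_sub_le (τ : ObsTimes) (φ : ℝ × ℝ → ℝ) :
    ‖Complex.exp ((pointSum τ φ : ℝ) * Complex.I) - 1
        - pointSum τ (fun z => Complex.exp (φ z * Complex.I) - 1)‖ₑ
      ≤ offSum τ fun p => ‖φ p.1‖ₑ * ‖φ p.2‖ₑ := by
  have h := norm_exp_sum_sub_le (pts τ) (fun i => φ (pt τ i))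
  have e : offSum τ (fun p => ‖φ p.1‖ₑ * ‖φ p.2‖ₑ) = ENNReal.ofReal
      (∑ k ∈ pts τ, ∑ l ∈ (pts τ).erase k, |φ (pt τ k)| * |φ (pt τ l)|) := by
    rw [ENNReal.ofReal_sum_of_nonneg fun _ _ => Finset.sum_nonneg fun _ _ => by positivity]
    refine Finset.sum_congr rfl fun i _ => ?_
    rw [ENNReal.ofReal_sum_of_nonneg fun _ _ => by positivity]
    refine Finset.sum_congr rfl fun j _ => ?_
    change ‖φ (pt τ i)‖ₑ * ‖φ (pt τ j)‖ₑ = _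
    rw [ENNReal.ofReal_mul (abs_nonneg _), Real.enorm_eq_ofReal_abs, Real.enorm_eq_ofReal_abs]
  rw [e, ← ofReal_norm]
  exact ENNReal.ofReal_le_ofReal h

/-! ### The central limit theorem for kernel-weighted averages -/

section CLT

variable {E : Type*} [MeasurableSpace E] {μ : Measure E} [IsProbabilityMeasure μ]
  {ν : Measure ObsTimes} [IsProbabilityMeasure ν] {η : ℝ × ℝ → ℝ} {f : (ℝ × ℝ) × (ℝ × ℝ) → ℝ}
  {g : ℝ × ℝ → E → ℝ} {B : ℝ≥0} {h₁ h₂ : ℕ → ℝ}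

/-- The pairs of distinct points do not contribute to the characteristic function of a
kernel-weighted sum. -/
lemma tendsto_expansion_error (h : ObservationCondition ν η f)
    (hg : Measurable (Function.uncurry g))
    (hB : ∀ z ∈ unitSq, ∫⁻ e, ‖g z e‖ₑ ^ 2 ∂μ ≤ B) {K : ℝ × ℝ → ℝ} (hK : KernelCondition K)
    (p1 : ∀ n, 0 < h₁ n) (p2 : ∀ n, 0 < h₂ n) (l1 : Tendsto h₁ atTop (𝓝 0))
    (l2 : Tendsto h₂ atTop (𝓝 0)) (t : ℝ) {s : ℕ → ℝ}
    (hs : ∀ n : ℕ, n * s n ^ 2 = h₁ n * h₂ n ∨ n = 0) :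
    Tendsto (fun n : ℕ => (n : ℂ) * ∫ x, (Complex.exp
        ((s n * kernelSum K (h₁ n) (h₂ n) t g x : ℝ) * Complex.I) - 1
        - pointSum x.2 (fun z => Complex.exp
          ((s n * (kern K (h₁ n) (h₂ n) t z * g z x.1) : ℝ) * Complex.I) - 1)) ∂(μ.prod ν))
      atTop (𝓝 0) := by
  obtain ⟨c, hc⟩ := h.exists_lintegral_offSum_le
  rw [tendsto_zero_iff_enorm_tendsto_zero]
  have hlim : Tendsto (fun n => (B * c : ℝ≥0∞) * _) atTop (𝓝 ((B * c : ℝ≥0∞) * 0)) :=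
    ENNReal.Tendsto.const_mul (tendsto_offDiag_kern hK p1 p2 l1 l2 t) (Or.inr (by finiteness))
  rw [mul_zero] at hlim
  refine tendsto_of_tendsto_of_tendsto_of_le_of_le' tendsto_const_nhds hlim
    (Eventually.of_forall fun _ => zero_le) ?_
  filter_upwards [eventually_ne_atTop 0] with n hn
  -- Summing over `n` subjects produces `n s²`, exactly the prefactor with which the pair integrals
  -- vanish in `tendsto_offDiag_kern`.
  have hsn : (n : ℝ) * s n ^ 2 = h₁ n * h₂ n := (hs n).resolve_right hn
  have hkm := measurable_kern hK.meas (h₁ n) (h₂ n) t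
  have hm := measurable_kern_mul hK.meas (h₁ n) (h₂ n) t hg
  set k := kern K (h₁ n) (h₂ n) t with hk
  have hgz : ∀ z, Measurable (g z) := fun z => hg.comp measurable_prodMk_left
  have hprod : ∀ z ∈ unitSq, ∀ z' ∈ unitSq, ∫⁻ e, ‖g z e‖ₑ * ‖g z' e‖ₑ ∂μ ≤ B := by
    intro z hz z' hz'
    have h2 : 2 * ∫⁻ e, ‖g z e‖ₑ * ‖g z' e‖ₑ ∂μ ≤ 2 * B := by
      calc 2 * ∫⁻ e, ‖g z e‖ₑ * ‖g z' e‖ₑ ∂μ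
          = ∫⁻ e, 2 * (‖g z e‖ₑ * ‖g z' e‖ₑ) ∂μ := (lintegral_const_mul' _ _ (by simp)).symm
        _ ≤ ∫⁻ e, (‖g z e‖ₑ ^ 2 + ‖g z' e‖ₑ ^ 2) ∂μ := by
            refine lintegral_mono fun e => ?_
            simpa using two_mul_mul_le_weighted ‖g z e‖ₑ ‖g z' e‖ₑ (c := 1) one_ne_zero
        _ ≤ B + B := by
            rw [lintegral_add_left ((hgz z).enorm.pow_const 2)]
            exact add_le_add (hB z hz) (hB z' hz')
        _ = 2 * B := by ring
    exact (ENNReal.mul_le_mul_iff_right (by simp) (by simp)).1 h2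
  have hRm : Measurable fun x : E × ObsTimes => Complex.exp
        ((s n * kernelSum K (h₁ n) (h₂ n) t g x : ℝ) * Complex.I) - 1
        - pointSum x.2 (fun z => Complex.exp ((s n * (k z * g z x.1) : ℝ) * Complex.I) - 1) := by
    have a1 : Measurable (kernelSum K (h₁ n) (h₂ n) t g) :=
      measurable_kernelSum hK.meas _ _ _ hg
    have a2 : Measurable fun x : E × ObsTimes =>
        pointSum x.2 (fun z => Complex.exp ((s n * (k z * g z x.1) : ℝ) * Complex.I) - 1) := by
      refine measurable_pointSum_prod
        (g := fun e z => Complex.exp ((s n * (k z * g z e) : ℝ) * Complex.I) - 1) ?_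
      have a3 : Measurable fun x : E × (ℝ × ℝ) => s n * (k x.2 * g x.2 x.1) := hm.const_mul _
      exact ((Complex.measurable_exp.comp
        ((Complex.measurable_ofReal.comp a3).mul_const _)).sub_const 1)
    exact ((Complex.measurable_exp.comp
        ((Complex.measurable_ofReal.comp (a1.const_mul _)).mul_const _)).sub_const 1).sub a2
  -- For fixed observation times in the square the marks contribute at most `B` per pair, by
  -- `hprod`; what remains is a pair sum of the kernel alone.
  have hint : ∫⁻ x, ‖Complex.exp ((s n * kernelSum K (h₁ n) (h₂ n) t g x : ℝ) * Complex.I) - 1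
        - pointSum x.2 (fun z => Complex.exp ((s n * (k z * g z x.1) : ℝ) * Complex.I) - 1)‖ₑ
        ∂(μ.prod ν)
      ≤ ‖s n‖ₑ ^ 2 * (B * ∫⁻ τ, offSum τ (fun p => ‖k p.1‖ₑ * ‖k p.2‖ₑ) ∂ν) := by
    rw [lintegral_prod_symm _ hRm.enorm.aemeasurable, ← mul_assoc,
      ← lintegral_const_mul' _ _ (by finiteness)]
    refine lintegral_mono_ae ?_
    filter_upwards [h.ae_pt_mem] with τ hτ
    calc ∫⁻ e, ‖Complex.exp ((s n * kernelSum K (h₁ n) (h₂ n) t g (e, τ) : ℝ) * Complex.I) - 1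
          - pointSum τ (fun z => Complex.exp ((s n * (k z * g z e) : ℝ) * Complex.I) - 1)‖ₑ ∂μ
        ≤ ∫⁻ e, offSum τ (fun p => ‖s n * (k p.1 * g p.1 e)‖ₑ * ‖s n * (k p.2 * g p.2 e)‖ₑ) ∂μ := by
          refine lintegral_mono fun e => ?_
          have e1 : s n * kernelSum K (h₁ n) (h₂ n) t g (e, τ)
              = pointSum τ (fun z => s n * (k z * g z e)) := by
            simp only [kernelSum, pointSum, Finset.mul_sum, hk]
          rw [e1]
          exact norm_exp_pointSum_sub_le τ fun z => s n * (k z * g z e)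
      _ = ∑ i ∈ pts τ, ∑ i' ∈ (pts τ).erase i, ‖s n‖ₑ ^ 2 * (‖k (pt τ i)‖ₑ * ‖k (pt τ i')‖ₑ) *
            ∫⁻ e, ‖g (pt τ i) e‖ₑ * ‖g (pt τ i') e‖ₑ ∂μ := by
          simp only [offSum]
          rw [lintegral_finsetSum _ fun i _ => Finset.measurable_sum _ fun i' _ => by
            have := hgz (pt τ i); have := hgz (pt τ i'); fun_prop]
          refine Finset.sum_congr rfl fun i _ => ?_
          rw [lintegral_finsetSum _ fun i' _ => by
            have := hgz (pt τ i); have := hgz (pt τ i'); fun_prop]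
          refine Finset.sum_congr rfl fun i' _ => ?_
          rw [← lintegral_const_mul' _ _ (by finiteness)]
          congr 1 with e
          simp only [enorm_mul]
          ring
      _ ≤ ∑ i ∈ pts τ, ∑ i' ∈ (pts τ).erase i, ‖s n‖ₑ ^ 2 * (‖k (pt τ i)‖ₑ * ‖k (pt τ i')‖ₑ) *
            B := by
          refine Finset.sum_le_sum fun i hi => Finset.sum_le_sum fun i' hi' => ?_
          gcongr
          exact hprod _ (hτ i hi) _ (hτ i' (Finset.mem_of_mem_erase hi'))
      _ = _ := by
          simp only [offSum, Finset.mul_sum]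
          refine Finset.sum_congr rfl fun i _ => Finset.sum_congr rfl fun i' _ => ?_
          ring
  have hoff := hc (fun p => ‖k p.1‖ₑ * ‖k p.2‖ₑ)
    ((hkm.comp measurable_fst).enorm.mul (hkm.comp measurable_snd).enorm)
  set D := (∫⁻ z in unitSq ×ˢ unitSq, ‖k z.1‖ₑ * ‖k z.2‖ₑ)
      + (∫⁻ z in unitCube, ‖k (z.1, z.2.1)‖ₑ * ‖k (z.1, z.2.2)‖ₑ)
      + ∫⁻ z in unitCube, ‖k (z.2.1, z.1)‖ₑ * ‖k (z.2.2, z.1)‖ₑ with hD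
  calc ‖(n : ℂ) * ∫ x, (Complex.exp ((s n * kernelSum K (h₁ n) (h₂ n) t g x : ℝ) * Complex.I) - 1
        - pointSum x.2 (fun z => Complex.exp ((s n * (k z * g z x.1) : ℝ) * Complex.I) - 1))
        ∂(μ.prod ν)‖ₑ
      ≤ ENNReal.ofReal n * (‖s n‖ₑ ^ 2 * (B * (c * D))) := by
        rw [enorm_mul]
        refine mul_le_mul' ?_ ((enorm_integral_le_lintegral_enorm _).trans (hint.trans ?_))
        · rw [← ofReal_norm]; simp
        · exact mul_le_mul_right (mul_le_mul_right hoff _) _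
    _ = B * c * (ENNReal.ofReal (n * s n ^ 2) * D) := by
        rw [ENNReal.ofReal_mul (by positivity), ← sq_abs (s n),
          ENNReal.ofReal_pow (abs_nonneg _), ← Real.enorm_eq_ofReal_abs]
        ring
    _ = B * c * (ENNReal.ofReal (h₁ n * h₂ n) * D) := by rw [hsn]

end CLT

/-! ### Expansion of the characteristic function of one subject -/

section CLT

variable {E : Type*} [MeasurableSpace E] {μ : Measure E} [IsProbabilityMeasure μ]

omit [IsProbabilityMeasure μ] in
lemma integrable_and_integral_norm_le {V : E → ℝ} (hV : Measurable V) {B : ℝ≥0}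
    (hB : ∫⁻ e, ‖V e‖ₑ ∂μ ≤ B) : Integrable V μ ∧ ∫ e, ‖V e‖ ∂μ ≤ B := by
  refine ⟨⟨hV.aestronglyMeasurable, hB.trans_lt ENNReal.coe_lt_top⟩, ?_⟩
  rw [integral_norm_eq_lintegral_enorm hV.aestronglyMeasurable]
  simpa using ENNReal.toReal_mono ENNReal.coe_ne_top hB

omit [IsProbabilityMeasure μ] in
lemma integrable_sq_and_integral_le {U : E → ℝ} (hU : Measurable U) {B : ℝ≥0}
    (hB : ∫⁻ e, ‖U e‖ₑ ^ 2 ∂μ ≤ B) : Integrable (fun e => U e ^ 2) μ ∧ ∫ e, U e ^ 2 ∂μ ≤ B := by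
  have := integrable_and_integral_norm_le (hU.pow_const 2) (B := B) (by simpa [enorm_pow] using hB)
  simpa using this

omit [IsProbabilityMeasure μ] in
lemma integrable_rpow_and_integral_le {U : E → ℝ} (hU : Measurable U) {B : ℝ≥0} {s : ℝ}
    (hs : 0 ≤ s) (hB : ∫⁻ e, ‖U e‖ₑ ^ s ∂μ ≤ B) :
    Integrable (fun e => |U e| ^ s) μ ∧ ∫ e, |U e| ^ s ∂μ ≤ B := by
  have h1 : ∀ e, ‖|U e| ^ s‖ₑ = ‖U e‖ₑ ^ s := fun e => by
    rw [Real.enorm_eq_ofReal (by positivity), Real.enorm_eq_ofReal_abs,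
      ENNReal.ofReal_rpow_of_nonneg (abs_nonneg _) hs]
  have := integrable_and_integral_norm_le (V := fun e => |U e| ^ s) (by fun_prop) (B := B)
    (by simpa [h1] using hB)
  refine ⟨this.1, ?_⟩
  convert this.2 using 3 with e
  rw [Real.norm_of_nonneg (by positivity)]

lemma integrable_of_lintegral_sq_le {U : E → ℝ} (hU : Measurable U) {B : ℝ≥0}
    (hB : ∫⁻ e, ‖U e‖ₑ ^ 2 ∂μ ≤ B) : Integrable U μ :=
  ⟨hU.aestronglyMeasurable, (lintegral_enorm_le_of_sq hB).trans_lt ENNReal.coe_lt_top⟩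

lemma integrable_exp_mul_I {U : E → ℝ} (hU : Measurable U) (a : ℝ) :
    Integrable (fun e => Complex.exp ((a * U e : ℝ) * Complex.I)) μ := by
  refine (integrable_const (1 : ℝ)).mono' ?_ (ae_of_all _ fun e => ?_)
  · exact (Complex.measurable_exp.comp ((Complex.measurable_ofReal.comp
      (hU.const_mul a)).mul_const _)).aestronglyMeasurable
  · rw [Complex.norm_exp_ofReal_mul_I]

/-- The linear term is kept apart: after integration against the kernel it is the bias, controlled
by smoothness and not by moments. -/
lemma integral_exp_mul_I_sub_one {U : E → ℝ} (hU : Measurable U) {B : ℝ≥0}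
    (hB : ∫⁻ e, ‖U e‖ₑ ^ 2 ∂μ ≤ B) (a : ℝ) :
    ∫ e, (Complex.exp ((a * U e : ℝ) * Complex.I) - 1) ∂μ
      = (∫ e, (Complex.exp ((a * U e : ℝ) * Complex.I) - 1 - (a * U e : ℝ) * Complex.I) ∂μ)
        + ((a * ∫ e, U e ∂μ : ℝ) : ℂ) * Complex.I := by
  have i1 := (integrable_exp_mul_I (μ := μ) hU a).sub (integrable_const (1 : ℂ))
  have i2 := (((integrable_of_lintegral_sq_le hU hB).const_mul a).ofReal (𝕜 := ℂ)).mul_const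
    Complex.I
  have e2 : ((a * ∫ e, U e ∂μ : ℝ) : ℂ) * Complex.I = ∫ e, ((a * U e : ℝ) : ℂ) * Complex.I ∂μ := by
    rw [integral_mul_const, integral_complex_ofReal, integral_const_mul]
  rw [e2]
  refine Eq.trans ?_ (integral_add (i1.sub i2) i2)
  simp

omit [IsProbabilityMeasure μ] in
lemma norm_integral_exp_mul_I_sub_le {U : E → ℝ} (hU : Measurable U) {B : ℝ≥0}
    (hB : ∫⁻ e, ‖U e‖ₑ ^ 2 ∂μ ≤ B) (a : ℝ) :
    ‖∫ e, (Complex.exp ((a * U e : ℝ) * Complex.I) - 1 - (a * U e : ℝ) * Complex.I) ∂μ‖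
      ≤ 3 * a ^ 2 * B := by
  obtain ⟨i1, i2⟩ := integrable_sq_and_integral_le hU hB
  refine (norm_integral_le_of_norm_le (i1.const_mul (3 * a ^ 2)) (ae_of_all _ fun e => ?_)).trans ?_
  · exact (norm_exp_mul_I_sub_one_sub_le _).trans_eq (by ring)
  · rw [integral_const_mul]; gcongr

lemma norm_integral_exp_mul_I_add_le {U : E → ℝ} (hU : Measurable U) {B B' : ℝ≥0}
    (hB : ∫⁻ e, ‖U e‖ₑ ^ 2 ∂μ ≤ B) {s : ℝ} (hs2 : 2 ≤ s) (hs3 : s ≤ 3)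
    (hB' : ∫⁻ e, ‖U e‖ₑ ^ s ∂μ ≤ B') (a : ℝ) :
    ‖(∫ e, (Complex.exp ((a * U e : ℝ) * Complex.I) - 1 - (a * U e : ℝ) * Complex.I) ∂μ)
      + ((a ^ 2 / 2 * ∫ e, U e ^ 2 ∂μ : ℝ) : ℂ)‖ ≤ 4 * |a| ^ s * B' := by
  obtain ⟨i1, -⟩ := integrable_sq_and_integral_le hU hB
  obtain ⟨j1, j2⟩ := integrable_rpow_and_integral_le hU (by linarith) hB'
  have k1 := ((integrable_exp_mul_I (μ := μ) hU a).sub (integrable_const (1 : ℂ))).sub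
    ((((integrable_of_lintegral_sq_le hU hB).const_mul a).ofReal (𝕜 := ℂ)).mul_const Complex.I)
  have k2 := (i1.const_mul (a ^ 2 / 2)).ofReal (𝕜 := ℂ)
  have e2 : ((a ^ 2 / 2 * ∫ e, U e ^ 2 ∂μ : ℝ) : ℂ) = ∫ e, ((a ^ 2 / 2 * U e ^ 2 : ℝ) : ℂ) ∂μ := by
    rw [integral_complex_ofReal, integral_const_mul]
  have e3 : (∫ e, (Complex.exp ((a * U e : ℝ) * Complex.I) - 1 - (a * U e : ℝ) * Complex.I) ∂μ)
      + ((a ^ 2 / 2 * ∫ e, U e ^ 2 ∂μ : ℝ) : ℂ)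
      = ∫ e, ((Complex.exp ((a * U e : ℝ) * Complex.I) - 1 - (a * U e : ℝ) * Complex.I)
        + ((a ^ 2 / 2 * U e ^ 2 : ℝ) : ℂ)) ∂μ := by
    rw [e2]; exact (integral_add k1 k2).symm
  rw [e3]
  refine (norm_integral_le_of_norm_le (j1.const_mul (4 * |a| ^ s)) (ae_of_all _ fun e => ?_)).trans
    ?_
  · have := norm_exp_mul_I_sub_quadratic_le (a * U e) hs2 hs3
    rw [abs_mul, Real.mul_rpow (abs_nonneg _) (abs_nonneg _), ← mul_assoc] at this
    refine le_trans (le_of_eq ?_) this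
    congr 2
    push_cast; ring
  · rw [integral_const_mul]; gcongr

variable {ν : Measure ObsTimes} [IsProbabilityMeasure ν] {η : ℝ × ℝ → ℝ}
  {f : (ℝ × ℝ) × (ℝ × ℝ) → ℝ}
  {g : ℝ × ℝ → E → ℝ} {B B' : ℝ≥0} {h₁ h₂ : ℕ → ℝ}

omit [IsProbabilityMeasure ν] in
lemma ObservationCondition.continuousAt_etaExt (h : ObservationCondition ν η f) {t : ℝ}
    (ht : t ∈ Ioo (0 : ℝ) 1) : ContinuousAt (etaExt η) (t, t) := by
  have hn := unitSq_mem_nhds ht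
  refine (h.eta_smooth.continuousOn.continuousAt hn).congr ?_
  filter_upwards [hn] with z hz
  exact (indicator_of_mem hz η).symm

lemma etaExt_diag {t : ℝ} (ht : t ∈ Ioo (0 : ℝ) 1) : etaExt η (t, t) = η (t, t) :=
  indicator_of_mem (mem_of_mem_nhds (unitSq_mem_nhds ht)) η

-- The factor `m ^ 2` cancels the `1 / m ^ 2` of the second-order bound, so the estimate is free of
-- `m`. With `y = K x` it provides a multiple of `K²` as dominating function.
omit [IsProbabilityMeasure μ] [IsProbabilityMeasure ν] in
lemma ObservationCondition.norm_etaExt_mul_le (h : ObservationCondition ν η f)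
    (hg : Measurable (Function.uncurry g))
    (hB : ∀ z ∈ unitSq, ∫⁻ e, ‖g z e‖ₑ ^ 2 ∂μ ≤ B) {c : ℝ≥0} (hc : ∀ z, etaExt η z ≤ c)
    (z : ℝ × ℝ) (y : ℝ) {m : ℝ} (hm : 0 < m) :
    ‖(etaExt η z : ℂ) * ((m ^ 2 : ℝ) * ∫ e, (Complex.exp ((y / m * g z e : ℝ) *
        Complex.I) - 1 - (y / m * g z e : ℝ) * Complex.I) ∂μ)‖ ≤ 3 * c * B * y ^ 2 := by
  by_cases hz : z ∈ unitSq
  · rw [norm_mul, norm_mul]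
    have h1 := norm_integral_exp_mul_I_sub_le (hg.comp measurable_prodMk_left) (hB _ hz) (y / m)
    have h2 : ‖((m ^ 2 : ℝ) : ℂ)‖ = m ^ 2 := by
      rw [Complex.norm_real, Real.norm_of_nonneg (by positivity)]
    have h3 : ‖(etaExt η z : ℂ)‖ ≤ c := by
      rw [Complex.norm_real, Real.norm_of_nonneg (h.etaExt_nonneg z)]; exact hc z
    rw [h2]
    calc _ ≤ (c : ℝ) * (m ^ 2 * (3 * (y / m) ^ 2 * B)) :=
          mul_le_mul h3 (mul_le_mul_of_nonneg_left h1 (by positivity)) (by positivity) c.2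
      _ = _ := by field_simp
  · simp only [etaExt, indicator_of_notMem hz, Complex.ofReal_zero, zero_mul, norm_zero]
    positivity

omit [IsProbabilityMeasure ν] in
lemma ObservationCondition.aestronglyMeasurable_etaExt_mul (h : ObservationCondition ν η f)
    (hg : Measurable (Function.uncurry g)) {K : ℝ × ℝ → ℝ} (hK : Measurable K) (t h₁ h₂ m : ℝ) :
    AEStronglyMeasurable fun x => (etaExt η (rescale t h₁ h₂ x) : ℂ) *
      ((m ^ 2 : ℝ) * ∫ e, (Complex.exp ((K x / m * g (rescale t h₁ h₂ x) e : ℝ) *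
        Complex.I) - 1 - (K x / m * g (rescale t h₁ h₂ x) e : ℝ) * Complex.I) ∂μ) := by
  refine ((Complex.measurable_ofReal.comp
    (h.measurable_etaExt.comp (measurable_rescale _ _ _))).aestronglyMeasurable).mul ?_
  refine AEStronglyMeasurable.const_mul ?_ _
  have hr : Measurable fun y : (ℝ × ℝ) × E => K y.1 / m * g (rescale t h₁ h₂ y.1) y.2 :=
    ((hK.comp measurable_fst).div_const _).mul
      (hg.comp (((measurable_rescale _ _ _).comp measurable_fst).prodMk measurable_snd))
  have hr' := (Complex.measurable_ofReal.comp hr).mul_const Complex.I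
  have hr2 := ((Complex.measurable_exp.comp hr').sub_const 1).sub hr'
  exact (hr2.stronglyMeasurable.integral_prod_right' (ν := μ)).aestronglyMeasurable

omit [IsProbabilityMeasure ν] in
/-- The quadratic term of the log-characteristic function. -/
lemma tendsto_integral_quadratic (h : ObservationCondition ν η f)
    (hg : Measurable (Function.uncurry g))
    (hB : ∀ z ∈ unitSq, ∫⁻ e, ‖g z e‖ₑ ^ 2 ∂μ ≤ B) {s : ℝ} (hs2 : 2 < s) (hs3 : s ≤ 3)
    (hB' : ∀ z ∈ unitSq, ∫⁻ e, ‖g z e‖ₑ ^ s ∂μ ≤ B') {K : ℝ × ℝ → ℝ} (hK : KernelCondition K)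
    (l1 : Tendsto h₁ atTop (𝓝 0)) (l2 : Tendsto h₂ atTop (𝓝 0)) {t : ℝ} (ht : t ∈ Ioo (0 : ℝ) 1)
    {v : ℝ} (hv : Tendsto (fun z => ∫ e, g z e ^ 2 ∂μ) (𝓝 (t, t)) (𝓝 v))
    {m : ℕ → ℝ} (hm : Tendsto m atTop atTop) :
    Tendsto (fun n => ∫ x, (etaExt η (rescale t (h₁ n) (h₂ n) x) : ℂ) *
      ((m n ^ 2 : ℝ) * ∫ e, (Complex.exp ((K x / m n * g (rescale t (h₁ n) (h₂ n) x) e : ℝ) *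
        Complex.I) - 1 - (K x / m n * g (rescale t (h₁ n) (h₂ n) x) e : ℝ) * Complex.I) ∂μ))
      atTop (𝓝 (((-(η (t, t) * (∫ x, K x ^ 2) * v) / 2 : ℝ) : ℂ))) := by
  obtain ⟨c, hc⟩ := h.exists_etaExt_le
  have hgz : ∀ z, Measurable (g z) := fun z => hg.comp measurable_prodMk_left
  have hηm := h.measurable_etaExt
  have hlim : (((-(η (t, t) * (∫ x, K x ^ 2) * v) / 2 : ℝ) : ℂ))
      = ∫ x, (((-(η (t, t) * v) / 2) * K x ^ 2 : ℝ) : ℂ) := by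
    rw [integral_complex_ofReal, integral_const_mul]; congr 1; ring
  rw [hlim]
  have hm0 : ∀ᶠ n in atTop, 0 < m n := hm.eventually_gt_atTop 0
  -- Domination needs only `K²`. The moment of order `s > 2` is used at fixed `x`, where the error
  -- is of order `m² |K x / m|^s = |K x|^s m^{-(s - 2)}`.
  refine tendsto_integral_filter_of_dominated_convergence (fun x => 3 * c * B * K x ^ 2) ?_ ?_
    (hK.integrable_sq.const_mul _) ?_
  · exact Eventually.of_forall fun n => h.aestronglyMeasurable_etaExt_mul hg hK.meas _ _ _ _
  · filter_upwards [hm0] with n hn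
    exact ae_of_all _ fun x => h.norm_etaExt_mul_le hg hB hc _ _ hn
  · refine ae_of_all _ fun x => ?_
    have hr := tendsto_rescale l1 l2 t x
    have t1 : Tendsto (fun n => (etaExt η (rescale t (h₁ n) (h₂ n) x) : ℂ)) atTop
        (𝓝 ((η (t, t) : ℝ) : ℂ)) := by
      rw [← etaExt_diag (η := η) ht]
      exact (Complex.continuous_ofReal.tendsto _).comp ((h.continuousAt_etaExt ht).tendsto.comp hr)
    have t2 : Tendsto (fun n => ((K x ^ 2 / 2 * ∫ e, g (rescale t (h₁ n) (h₂ n) x) e ^ 2 ∂μ : ℝ)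
        : ℂ)) atTop (𝓝 ((K x ^ 2 / 2 * v : ℝ) : ℂ)) :=
      (Complex.continuous_ofReal.tendsto _).comp ((hv.comp hr).const_mul _)
    have t3 : Tendsto (fun n => ((m n ^ 2 : ℝ) : ℂ) * (∫ e, (Complex.exp
        ((K x / m n * g (rescale t (h₁ n) (h₂ n) x) e : ℝ) *
        Complex.I) - 1 - (K x / m n * g (rescale t (h₁ n) (h₂ n) x) e : ℝ) * Complex.I) ∂μ)
        + ((K x ^ 2 / 2 * ∫ e, g (rescale t (h₁ n) (h₂ n) x) e ^ 2 ∂μ : ℝ) : ℂ)) atTop (𝓝 0) := by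
      have t4 : Tendsto (fun n => 4 * |K x| ^ s * B' * m n ^ (-(s - 2))) atTop (𝓝 0) := by
        simpa using ((tendsto_rpow_neg_atTop (by linarith : 0 < s - 2)).comp hm).const_mul
          (4 * |K x| ^ s * B')
      refine squeeze_zero_norm' ?_ t4
      filter_upwards [hm0, hr.eventually (unitSq_mem_nhds ht)] with n hn hz
      have h1 := norm_integral_exp_mul_I_add_le (hgz (rescale t (h₁ n) (h₂ n) x)) (hB _ hz) hs2.le
        hs3 (hB' _ hz) (K x / m n)
      have e1 : ((m n ^ 2 : ℝ) : ℂ) * (∫ e, (Complex.exp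
        ((K x / m n * g (rescale t (h₁ n) (h₂ n) x) e : ℝ) *
        Complex.I) - 1 - (K x / m n * g (rescale t (h₁ n) (h₂ n) x) e : ℝ) * Complex.I) ∂μ)
        + ((K x ^ 2 / 2 * ∫ e, g (rescale t (h₁ n) (h₂ n) x) e ^ 2 ∂μ : ℝ) : ℂ)
        = ((m n ^ 2 : ℝ) : ℂ) * ((∫ e, (Complex.exp
        ((K x / m n * g (rescale t (h₁ n) (h₂ n) x) e : ℝ) *
        Complex.I) - 1 - (K x / m n * g (rescale t (h₁ n) (h₂ n) x) e : ℝ) * Complex.I) ∂μ)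
        + (((K x / m n) ^ 2 / 2 * ∫ e, g (rescale t (h₁ n) (h₂ n) x) e ^ 2 ∂μ : ℝ) : ℂ)) := by
        rw [mul_add, ← Complex.ofReal_mul]
        congr 2
        field_simp
      rw [e1, norm_mul, Complex.norm_real, Real.norm_of_nonneg (by positivity)]
      calc _ ≤ m n ^ 2 * (4 * |K x / m n| ^ s * B') := by gcongr
        _ = _ := by
          rw [abs_div, abs_of_pos hn, Real.div_rpow (abs_nonneg _) hn.le, neg_sub,
            Real.rpow_sub hn, Real.rpow_two]
          ring
    have t5 := t1.mul (t3.sub t2)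
    convert t5 using 2 with n
    · ring
    · push_cast; ring

/-- `n · E (e^{i s W} - 1)` for a single subject. -/
lemma tendsto_mul_integral_exp_sub_one (h : ObservationCondition ν η f)
    (hg : Measurable (Function.uncurry g))
    (hB : ∀ z ∈ unitSq, ∫⁻ e, ‖g z e‖ₑ ^ 2 ∂μ ≤ B) {s : ℝ} (hs2 : 2 < s) (hs3 : s ≤ 3)
    (hB' : ∀ z ∈ unitSq, ∫⁻ e, ‖g z e‖ₑ ^ s ∂μ ≤ B') {K : ℝ × ℝ → ℝ} (hK : KernelCondition K)
    (p1 : ∀ n, 0 < h₁ n) (p2 : ∀ n, 0 < h₂ n)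
    (l1 : Tendsto h₁ atTop (𝓝 0)) (l2 : Tendsto h₂ atTop (𝓝 0))
    (hN : Tendsto (fun n : ℕ => n * h₁ n * h₂ n) atTop atTop) {t : ℝ} (ht : t ∈ Ioo (0 : ℝ) 1)
    {v : ℝ} (hv : Tendsto (fun z => ∫ e, g z e ^ 2 ∂μ) (𝓝 (t, t)) (𝓝 v))
    (hbias : Tendsto (fun n : ℕ => √(n * h₁ n * h₂ n) * ∫ x, K x *
      (etaExt η (rescale t (h₁ n) (h₂ n) x) * ∫ e, g (rescale t (h₁ n) (h₂ n) x) e ∂μ))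
      atTop (𝓝 0)) :
    Tendsto (fun n : ℕ => (n : ℂ) * ((∫ x, Complex.exp
        ((√(n * h₁ n * h₂ n) / n * kernelSum K (h₁ n) (h₂ n) t g x : ℝ) * Complex.I) ∂(μ.prod ν))
          - 1))
      atTop (𝓝 (((-(η (t, t) * (∫ x, K x ^ 2) * v) / 2 : ℝ) : ℂ))) := by
  have hgz : ∀ z, Measurable (g z) := fun z => hg.comp measurable_prodMk_left
  have hηm := h.measurable_etaExt
  obtain ⟨c, hc⟩ := h.exists_etaExt_le
  have hN0 : ∀ n : ℕ, 0 ≤ n * h₁ n * h₂ n := fun n => by have := p1 n; have := p2 n; positivity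
  have hm : Tendsto (fun n : ℕ => √(n * h₁ n * h₂ n)) atTop atTop :=
    Real.tendsto_sqrt_atTop.comp hN
  -- Three contributions: pairs of points of one subject, the quadratic term that carries the
  -- variance, and the linear term, which is the bias times `i`.
  have lim1 := tendsto_expansion_error h hg hB hK p1 p2 l1 l2 t
    (s := fun n => √(n * h₁ n * h₂ n) / n) (fun n => by
      rcases eq_or_ne n 0 with hn | hn
      · exact Or.inr hn
      · left
        rw [div_pow, Real.sq_sqrt (hN0 n)]
        field_simp)
  have lim2 := tendsto_integral_quadratic h hg hB hs2 hs3 hB' hK l1 l2 ht hv hm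
  have lim3 : Tendsto (fun n : ℕ => ((√(n * h₁ n * h₂ n) * ∫ x, K x *
      (etaExt η (rescale t (h₁ n) (h₂ n) x) * ∫ e, g (rescale t (h₁ n) (h₂ n) x) e ∂μ) : ℝ) : ℂ)
      * Complex.I) atTop (𝓝 0) := by
    simpa using ((Complex.continuous_ofReal.tendsto _).comp hbias).mul_const Complex.I
  have lim := (lim1.add lim2).add lim3
  rw [zero_add, add_zero] at lim
  refine lim.congr' ?_
  filter_upwards [eventually_ne_atTop 0] with n hn
  have hn' : (0 : ℝ) < n := by positivity
  set m := √(n * h₁ n * h₂ n) with hmdef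
  have q1 := p1 n
  have q2 := p2 n
  have hm0 : 0 < m := Real.sqrt_pos.2 (by positivity)
  have hmsq : m ^ 2 = n * h₁ n * h₂ n := Real.sq_sqrt (by positivity)
  set rs := rescale t (h₁ n) (h₂ n) with hrs
  set k := kern K (h₁ n) (h₂ n) t with hk
  have hmk := measurable_kern_mul hK.meas (h₁ n) (h₂ n) t hg
  have hφ : Measurable (Function.uncurry fun (e : E) z =>
      Complex.exp ((m / n * (k z * g z e) : ℝ) * Complex.I) - 1) := by
    have a3 : Measurable fun x : E × (ℝ × ℝ) => m / n * (k x.2 * g x.2 x.1) := hmk.const_mul _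
    exact ((Complex.measurable_exp.comp
      ((Complex.measurable_ofReal.comp a3).mul_const _)).sub_const 1)
  have hfin : ∫⁻ z, (∫⁻ e, ‖Complex.exp ((m / n * (k z * g z e) : ℝ) * Complex.I) - 1‖ₑ ∂μ) *
      ENNReal.ofReal (etaExt η z) ≠ ⊤ := by
    obtain ⟨c', hc'⟩ := h.exists_lintegral_kern_mul_le hB
    have hb := hc' K hK.meas (h₁ n) (h₂ n) t q1 q2
    have hlt : ‖m / (n : ℝ)‖ₑ * (c' * ∫⁻ x, ‖K x‖ₑ) < ⊤ :=
      ENNReal.mul_lt_top (by simp) (ENNReal.mul_lt_top (by simp) hK.integrable.hasFiniteIntegral)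
    refine (lt_of_le_of_lt ?_ hlt).ne
    refine le_trans ?_ (mul_le_mul_right hb _)
    rw [← lintegral_const_mul' _ _ (by simp)]
    refine lintegral_mono fun z => ?_
    rw [← mul_assoc, ← lintegral_const_mul' _ _ (by simp)]
    refine mul_le_mul_left (lintegral_mono fun e => ?_) _
    rw [← enorm_mul, ← ofReal_norm, Real.enorm_eq_ofReal_abs]
    exact ENNReal.ofReal_le_ofReal (norm_exp_mul_I_sub_one_le _)
  have i1 := h.integrable_pointSum_prod hφ hfin
  have i2 := h.integral_pointSum_prod_complex hφ hfin
  have i3 : Integrable (fun x => Complex.exp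
      ((m / n * kernelSum K (h₁ n) (h₂ n) t g x : ℝ) * Complex.I)) (μ.prod ν) :=
    integrable_exp_mul_I (measurable_kernelSum hK.meas _ _ _ hg) _
  -- Rescaling brings out `h₁ h₂`, and `n h₁ h₂ = m²`. The same identity gives `m / n * kern = K x /
  -- m` at the rescaled point.
  have hscale : (n : ℂ) * ∫ z, (etaExt η z : ℂ) *
      ∫ e, (Complex.exp ((m / n * (k z * g z e) : ℝ) * Complex.I) - 1) ∂μ
      = ∫ x, ((etaExt η (rs x) : ℂ) * ((m ^ 2 : ℝ) * ∫ e, (Complex.exp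
        ((K x / m * g (rs x) e : ℝ) * Complex.I) - 1 - (K x / m * g (rs x) e : ℝ) * Complex.I) ∂μ)
        + ((m * (K x * (etaExt η (rs x) * ∫ e, g (rs x) e ∂μ)) : ℝ) : ℂ) * Complex.I) := by
    rw [integral_rescale t q1 q2, ← hrs, Complex.real_smul, ← mul_assoc, ← integral_const_mul]
    congr 1 with x
    by_cases hz : rs x ∈ unitSq
    · have e1 : ∀ e, m / n * (k (rs x) * g (rs x) e) = K x / m * g (rs x) e := fun e => by
        rw [hk, hrs, kern_rescale q1 q2]
        have : m * m = n * h₁ n * h₂ n := by rw [← sq]; exact hmsq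
        field_simp
        linear_combination (K x * g (rescale t (h₁ n) (h₂ n) x) e) * hmsq
      simp_rw [e1]
      rw [integral_exp_mul_I_sub_one (hgz (rs x)) (hB _ hz) (K x / m), mul_add, mul_add]
      have e2 : ((n : ℂ) * ((h₁ n * h₂ n : ℝ) : ℂ)) = ((m ^ 2 : ℝ) : ℂ) := by
        rw [hmsq]; push_cast; ring
      rw [e2]
      congr 1
      · ring
      · rw [← mul_assoc, ← mul_assoc, ← Complex.ofReal_mul, ← Complex.ofReal_mul]
        congr 2
        field_simp
    · have e0 : etaExt η (rs x) = 0 := indicator_of_notMem hz η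
      simp only [e0, Complex.ofReal_zero, zero_mul, mul_zero, add_zero]
  have j1 : Integrable fun x => (etaExt η (rs x) : ℂ) * ((m ^ 2 : ℝ) * ∫ e, (Complex.exp
        ((K x / m * g (rs x) e : ℝ) * Complex.I) - 1
          - (K x / m * g (rs x) e : ℝ) * Complex.I) ∂μ) :=
    (hK.integrable_sq.const_mul (3 * c * B : ℝ)).mono'
      (h.aestronglyMeasurable_etaExt_mul hg hK.meas _ _ _ _)
      (ae_of_all _ fun x => h.norm_etaExt_mul_le hg hB hc _ _ hm0)
  have j2 : Integrable fun x => ((m * (K x * (etaExt η (rs x) * ∫ e, g (rs x) e ∂μ)) : ℝ) : ℂ)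
      * Complex.I := by
    have hF : Measurable fun z => etaExt η z * ∫ e, g z e ∂μ :=
      hηm.mul hg.stronglyMeasurable.integral_prod_right.measurable
    have hFb : ∀ z, |etaExt η z * ∫ e, g z e ∂μ| ≤ c * (1 + B) := fun z => by
      by_cases hz : z ∈ unitSq
      · have b1 := (integrable_and_integral_norm_le (hgz z) (lintegral_enorm_le_of_sq (hB z hz))).2
        rw [abs_mul, abs_of_nonneg (h.etaExt_nonneg z)]
        rw [NNReal.coe_add, NNReal.coe_one] at b1
        exact mul_le_mul (hc z) ((norm_integral_le_integral_norm (g z)).trans b1)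
          (abs_nonneg _) c.2
      · simp only [etaExt, indicator_of_notMem hz, zero_mul, abs_zero]
        positivity
    exact (((integrable_mul_rescale hK.integrable hF hFb t (h₁ n) (h₂ n)).const_mul m).ofReal
      (𝕜 := ℂ)).mul_const _
  rw [integral_add j1 j2, integral_mul_const, integral_complex_ofReal, integral_const_mul, ← i2] at hscale
  have hsplit : ∫ x, (Complex.exp ((m / n * kernelSum K (h₁ n) (h₂ n) t g x : ℝ) * Complex.I) - 1
      - pointSum x.2 (fun z => Complex.exp ((m / n * (k z * g z x.1) : ℝ) * Complex.I) - 1))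
        ∂(μ.prod ν)
      = (∫ x, Complex.exp ((m / n * kernelSum K (h₁ n) (h₂ n) t g x : ℝ) * Complex.I) ∂(μ.prod ν))
        - 1 - ∫ x, pointSum x.2 (fun z => Complex.exp ((m / n * (k z * g z x.1) : ℝ) * Complex.I)
          - 1) ∂(μ.prod ν) := by
    refine (integral_sub (i3.sub (integrable_const 1)) i1).trans ?_
    congr 1
    refine (integral_sub i3 (integrable_const 1)).trans ?_
    simp only [integral_const, probReal_univ, one_smul]
  rw [hsplit]
  linear_combination (-1 : ℂ) * hscale

variable {Ω : Type*} [MeasurableSpace Ω] {P : Measure Ω} [IsProbabilityMeasure P]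
  {ζ : ℕ → Ω → E × ObsTimes}

/-- Central limit theorem for kernel-weighted averages, in terms of characteristic functions. -/
theorem tendsto_charFun_kernelAverage (hζ : ∀ i, HasLaw (ζ i) (μ.prod ν) P) (hind : iIndepFun ζ P)
    (h : ObservationCondition ν η f) (hg : Measurable (Function.uncurry g))
    (hB : ∀ z ∈ unitSq, ∫⁻ e, ‖g z e‖ₑ ^ 2 ∂μ ≤ B) {s : ℝ} (hs2 : 2 < s) (hs3 : s ≤ 3)
    (hB' : ∀ z ∈ unitSq, ∫⁻ e, ‖g z e‖ₑ ^ s ∂μ ≤ B') {K : ℝ × ℝ → ℝ} (hK : KernelCondition K)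
    (p1 : ∀ n, 0 < h₁ n) (p2 : ∀ n, 0 < h₂ n)
    (l1 : Tendsto h₁ atTop (𝓝 0)) (l2 : Tendsto h₂ atTop (𝓝 0))
    (hN : Tendsto (fun n : ℕ => n * h₁ n * h₂ n) atTop atTop) {t : ℝ} (ht : t ∈ Ioo (0 : ℝ) 1)
    {v : ℝ} (hv : Tendsto (fun z => ∫ e, g z e ^ 2 ∂μ) (𝓝 (t, t)) (𝓝 v))
    (hbias : Tendsto (fun n : ℕ => √(n * h₁ n * h₂ n) * ∫ x, K x *
      (etaExt η (rescale t (h₁ n) (h₂ n) x) * ∫ e, g (rescale t (h₁ n) (h₂ n) x) e ∂μ))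
      atTop (𝓝 0)) :
    Tendsto (fun n : ℕ => ∫ ω, Complex.exp ((√(n * h₁ n * h₂ n) * ((n : ℝ)⁻¹ *
        ∑ i ∈ Finset.range n, kernelSum K (h₁ n) (h₂ n) t g (ζ i ω)) : ℝ) * Complex.I) ∂P)
      atTop (𝓝 (Complex.exp ((-(η (t, t) * (∫ x, K x ^ 2) * v) / 2 : ℝ) : ℂ))) := by
  -- By independence the characteristic function of the sum is the `n`-th power of that of one
  -- subject, of the form `(1 + a_n)^n` with `n a_n` convergent.
  have hlim := Complex.tendsto_one_add_pow_exp_of_tendsto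
    (tendsto_mul_integral_exp_sub_one h hg hB hs2 hs3 hB' hK p1 p2 l1 l2 hN ht hv hbias)
  refine hlim.congr fun n => ?_
  rw [add_sub_cancel]
  set a := √(n * h₁ n * h₂ n) / n with ha
  have hW : Measurable (kernelSum K (h₁ n) (h₂ n) t g) := measurable_kernelSum hK.meas _ _ _ hg
  have hWi : ∀ i, AEMeasurable (fun ω => kernelSum K (h₁ n) (h₂ n) t g (ζ i ω)) P := fun i =>
    hW.comp_aemeasurable (hζ i).aemeasurable
  have hmul := ((hind.comp (fun _ => kernelSum K (h₁ n) (h₂ n) t g) fun _ => hW).restrict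
    (Finset.range n)).charFun_map_fun_finsetSum_eq_prod fun i _ => hWi i
  have hone : ∀ i, charFun (P.map fun ω => kernelSum K (h₁ n) (h₂ n) t g (ζ i ω)) a
      = ∫ x, Complex.exp ((a * kernelSum K (h₁ n) (h₂ n) t g x : ℝ) * Complex.I) ∂(μ.prod ν) := by
    intro i
    have := Measure.isProbabilityMeasure_map (hζ i).aemeasurable
    rw [charFun_apply_real, integral_map (hWi i) (by fun_prop), ← (hζ i).map_eq,
      integral_map (hζ i).aemeasurable (integrable_exp_mul_I (μ := P.map (ζ i)) hW a).1]
    simp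
  have hsum := congrFun hmul a
  rw [Finset.prod_apply] at hsum
  rw [Finset.prod_congr rfl fun i _ => hone i, Finset.prod_const, Finset.card_range,
    charFun_apply_real, integral_map (Finset.aemeasurable_fun_sum _ fun i _ => hWi i)
    (by fun_prop)] at hsum
  rw [← hsum]
  congr 1 with ω
  congr 2
  rw [ha]
  push_cast
  ring

end CLT

/-! ### Processes with uniformly bounded moments -/

section Moments

variable {E : Type*} [MeasurableSpace E]

/-- A jointly measurable process on the unit square with bounded moments of order `r`. -/
structure BddMoment (μ : Measure E) (r : ℝ) (g : ℝ × ℝ → E → ℝ) : Prop where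
  meas : Measurable (Function.uncurry g)
  bound : ∃ B : ℝ≥0, ∀ z ∈ unitSq, ∫⁻ e, ‖g z e‖ₑ ^ r ∂μ ≤ B

namespace BddMoment

variable {μ : Measure E} {r s : ℝ} {g g' : ℝ × ℝ → E → ℝ}

lemma measurable_apply (h : BddMoment μ r g) (z : ℝ × ℝ) : Measurable (g z) :=
  h.meas.comp measurable_prodMk_left

lemma mono_exponent [IsProbabilityMeasure μ] (h : BddMoment μ r g) (hs : 0 ≤ s) (hsr : s ≤ r) :
    BddMoment μ s g := by
  obtain ⟨B, hB⟩ := h.bound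
  refine ⟨h.meas, 1 + B, fun z hz => ?_⟩
  calc ∫⁻ e, ‖g z e‖ₑ ^ s ∂μ ≤ ∫⁻ e, (1 + ‖g z e‖ₑ ^ r) ∂μ := by
        refine lintegral_mono fun e => ?_
        rcases le_total ‖g z e‖ₑ 1 with h1 | h1
        · exact (ENNReal.rpow_le_one h1 hs).trans le_self_add
        · exact (ENNReal.rpow_le_rpow_of_exponent_le h1 hsr).trans le_add_self
    _ = 1 + ∫⁻ e, ‖g z e‖ₑ ^ r ∂μ := by rw [lintegral_add_left measurable_const]; simp
    _ ≤ _ := by push_cast; gcongr; exact hB z hz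

lemma add (h : BddMoment μ r g) (h' : BddMoment μ r g') (hr : 1 ≤ r) :
    BddMoment μ r (fun z e => g z e + g' z e) := by
  obtain ⟨B, hB⟩ := h.bound
  obtain ⟨B', hB'⟩ := h'.bound
  refine ⟨h.meas.add h'.meas, 2 ^ (r - 1) * (B + B'), fun z hz => ?_⟩
  have h2 : (2 : ℝ≥0∞) ^ (r - 1) ≠ ⊤ := ENNReal.rpow_ne_top_of_nonneg (by linarith) (by simp)
  calc ∫⁻ e, ‖g z e + g' z e‖ₑ ^ r ∂μ
      ≤ ∫⁻ e, 2 ^ (r - 1) * (‖g z e‖ₑ ^ r + ‖g' z e‖ₑ ^ r) ∂μ := by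
        refine lintegral_mono fun e => ?_
        exact (ENNReal.rpow_le_rpow (enorm_add_le _ _) (by linarith)).trans
          (ENNReal.rpow_add_le_mul_rpow_add_rpow _ _ hr)
    _ = 2 ^ (r - 1) * (∫⁻ e, ‖g z e‖ₑ ^ r ∂μ + ∫⁻ e, ‖g' z e‖ₑ ^ r ∂μ) := by
        rw [lintegral_const_mul' _ _ h2,
          lintegral_add_left ((h.measurable_apply z).enorm.pow_const r)]
    _ ≤ _ := by
        have : ((2 ^ (r - 1) : ℝ≥0) : ℝ≥0∞) = 2 ^ (r - 1) := by
          rw [ENNReal.coe_rpow_of_nonneg _ (by linarith)]; simp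
        push_cast
        rw [this]
        gcongr
        · exact hB z hz
        · exact hB' z hz

lemma mul_const (h : BddMoment μ r g) (hr : 0 ≤ r) (c : ℝ) :
    BddMoment μ r (fun z e => g z e * c) := by
  obtain ⟨B, hB⟩ := h.bound
  refine ⟨h.meas.mul_const c, B * ‖c‖₊ ^ r, fun z hz => ?_⟩
  have h2 : ‖c‖ₑ ^ r ≠ ⊤ := ENNReal.rpow_ne_top_of_nonneg hr (by simp)
  simp_rw [enorm_mul, ENNReal.mul_rpow_of_nonneg _ _ hr]
  rw [lintegral_mul_const' _ _ h2]
  push_cast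
  rw [ENNReal.coe_rpow_of_nonneg _ hr]
  gcongr
  · exact hB z hz
  · exact le_rfl

lemma zero (hr : 0 < r) : BddMoment μ r (fun _ _ => 0) :=
  ⟨measurable_const, 0, fun z _ => by simp [hr]⟩

lemma sum {ι : Type*} (S : Finset ι) {G : ι → ℝ × ℝ → E → ℝ} (h : ∀ i, BddMoment μ r (G i))
    (hr : 1 ≤ r) : BddMoment μ r (fun z e => ∑ i ∈ S, G i z e) := by
  classical
  induction S using Finset.induction_on with
  | empty => simpa using zero (by linarith)
  | insert a S ha ih => simpa only [Finset.sum_insert ha] using (h a).add ih hr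

lemma sub (h : BddMoment μ r g) (h' : BddMoment μ r g') (hr : 1 ≤ r) :
    BddMoment μ r (fun z e => g z e - g' z e) := by
  simpa [sub_eq_add_neg] using h.add (h'.mul_const (by linarith) (-1)) hr

/-- The modulus of a product is at most the square of the larger factor, which halves the exponent.
Factors with moments of order above four thus have a product with moments of order above two. -/
lemma mul (h : BddMoment μ r g) (h' : BddMoment μ r g') (hr : 0 ≤ r) :
    BddMoment μ (r / 2) (fun z e => g z e * g' z e) := by
  obtain ⟨B, hB⟩ := h.bound
  obtain ⟨B', hB'⟩ := h'.bound
  refine ⟨h.meas.mul h'.meas, B + B', fun z hz => ?_⟩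
  calc ∫⁻ e, ‖g z e * g' z e‖ₑ ^ (r / 2) ∂μ ≤ ∫⁻ e, (‖g z e‖ₑ ^ r + ‖g' z e‖ₑ ^ r) ∂μ := by
        refine lintegral_mono fun e => ?_
        have key : ∀ a b : ℝ≥0∞, a ≤ b → (a * b) ^ (r / 2) ≤ b ^ r := fun a b hab => by
          calc (a * b) ^ (r / 2) ≤ (b * b) ^ (r / 2) := by gcongr
            _ = b ^ r := by rw [← sq, ← ENNReal.rpow_natCast, ← ENNReal.rpow_mul]; congr 1; push_cast; ring
        rw [enorm_mul]
        rcases le_total ‖g z e‖ₑ ‖g' z e‖ₑ with hl | hl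
        · exact (key _ _ hl).trans le_add_self
        · rw [mul_comm]; exact (key _ _ hl).trans le_self_add
    _ = ∫⁻ e, ‖g z e‖ₑ ^ r ∂μ + ∫⁻ e, ‖g' z e‖ₑ ^ r ∂μ :=
        lintegral_add_left ((h.measurable_apply z).enorm.pow_const r) _
    _ ≤ _ := by push_cast; exact add_le_add (hB z hz) (hB' z hz)

/-- Reparametrization of the index by a measurable map of the unit square into itself. -/
lemma comp (h : BddMoment μ r g) {φ : ℝ × ℝ → ℝ × ℝ} (hφ : Measurable φ)
    (hm : ∀ z ∈ unitSq, φ z ∈ unitSq) : BddMoment μ r (fun z => g (φ z)) := by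
  obtain ⟨B, hB⟩ := h.bound
  exact ⟨h.meas.comp ((hφ.comp measurable_fst).prodMk measurable_snd), B,
    fun z hz => hB _ (hm z hz)⟩

lemma exists_sq_bound (h : BddMoment μ 2 g) :
    ∃ B : ℝ≥0, ∀ z ∈ unitSq, ∫⁻ e, ‖g z e‖ₑ ^ 2 ∂μ ≤ B := by
  obtain ⟨B, hB⟩ := h.bound
  exact ⟨B, fun z hz => by simpa using hB z hz⟩

lemma memLp_two (h : BddMoment μ 2 g) {z : ℝ × ℝ} (hz : z ∈ unitSq) : MemLp (g z) 2 μ := by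
  obtain ⟨B, hB⟩ := h.exists_sq_bound
  refine ⟨(h.measurable_apply z).aestronglyMeasurable, ?_⟩
  have h1 := (hB z hz).trans_lt ENNReal.coe_lt_top
  rw [← sq_eLpNorm_two] at h1
  exact lt_top_iff_ne_top.2 fun h2 => by simp [h2] at h1

end BddMoment

/-- If `b > M`, then `b² = b^{r-2} b^{4-r}` with `b^{4-r} ≤ M^{4-r}`, and `a² b^{r-2} ≤ a^r + b^r`.
For large `M` the second term is small uniformly under bounded `r`-th moments; for fixed `M` the
first is small when `a` is small in mean square. -/
lemma sq_mul_sq_le (a b : ℝ≥0) {M : ℝ≥0} (hM : 0 < M) {r : ℝ} (hr : 4 < r) :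
    a ^ 2 * b ^ 2 ≤ M ^ 2 * a ^ 2 + M ^ (4 - r) * (a ^ r + b ^ r) := by
  rcases le_total b M with hb | hb
  · refine le_trans ?_ le_self_add
    rw [mul_comm]; gcongr
  · refine le_trans ?_ le_add_self
    have hb0 : 0 < b := hM.trans_le hb
    have h1 : M ^ (r - 4) ≤ b ^ (r - 4) := NNReal.rpow_le_rpow hb (by linarith)
    have h2 : 1 ≤ M ^ (4 - r) * b ^ (r - 4) := by
      have : M ^ (4 - r) * M ^ (r - 4) = 1 := by
        rw [← NNReal.rpow_add hM.ne']; simp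
      rw [← this]; gcongr
    have h3 : a ^ 2 * b ^ (r - 2) ≤ a ^ r + b ^ r := by
      rcases le_total a b with hab | hab
      · refine le_trans ?_ le_add_self
        calc a ^ 2 * b ^ (r - 2) ≤ b ^ 2 * b ^ (r - 2) := by gcongr
          _ = b ^ r := by
            rw [← NNReal.rpow_natCast, ← NNReal.rpow_add hb0.ne']; congr 1; push_cast; ring
      · refine le_trans ?_ le_self_add
        have ha0 : 0 < a := hb0.trans_le hab
        calc a ^ 2 * b ^ (r - 2) ≤ a ^ 2 * a ^ (r - 2) := by gcongr; linarith
          _ = a ^ r := by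
            rw [← NNReal.rpow_natCast, ← NNReal.rpow_add ha0.ne']; congr 1; push_cast; ring
    calc a ^ 2 * b ^ 2 ≤ a ^ 2 * b ^ 2 * (M ^ (4 - r) * b ^ (r - 4)) := le_mul_of_one_le_right' h2
      _ = M ^ (4 - r) * (a ^ 2 * b ^ (r - 2)) := by
          have : b ^ (r - 2) = b ^ 2 * b ^ (r - 4) := by
            rw [← NNReal.rpow_natCast, ← NNReal.rpow_add hb0.ne']; congr 1; push_cast; ring
          rw [this]; ring
      _ ≤ _ := by gcongr

/-- If `d` tends to zero in mean square, then so does `d * ε`, given bounded moments of an order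
exceeding four. -/
lemma tendsto_lintegral_sq_mul {μ : Measure E} {r : ℝ} (hr : 4 < r) {d ε : ℝ × ℝ → E → ℝ}
    (hd : BddMoment μ r d) (hε : BddMoment μ r ε) {l : Filter (ℝ × ℝ)}
    (hl : ∀ᶠ z in l, z ∈ unitSq)
    (h0 : Tendsto (fun z => ∫⁻ e, ‖d z e‖ₑ ^ 2 ∂μ) l (𝓝 0)) :
    Tendsto (fun z => ∫⁻ e, ‖d z e * ε z e‖ₑ ^ 2 ∂μ) l (𝓝 0) := by
  obtain ⟨B, hB⟩ := hd.bound
  obtain ⟨B', hB'⟩ := hε.bound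
  have hpt : ∀ M : ℝ≥0, 0 < M → ∀ z ∈ unitSq, ∫⁻ e, ‖d z e * ε z e‖ₑ ^ 2 ∂μ
      ≤ (M ^ 2 : ℝ≥0) * ∫⁻ e, ‖d z e‖ₑ ^ 2 ∂μ + (M ^ (4 - r) * (B + B') : ℝ≥0) := by
    intro M hM z hz
    have m1 := (hd.measurable_apply z).enorm
    have m2 := (hε.measurable_apply z).enorm
    calc ∫⁻ e, ‖d z e * ε z e‖ₑ ^ 2 ∂μ
        ≤ ∫⁻ e, ((M ^ 2 : ℝ≥0) * ‖d z e‖ₑ ^ 2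
          + (M ^ (4 - r) : ℝ≥0) * (‖d z e‖ₑ ^ r + ‖ε z e‖ₑ ^ r)) ∂μ := by
          refine lintegral_mono fun e => ?_
          have := sq_mul_sq_le ‖d z e‖₊ ‖ε z e‖₊ hM hr
          rw [← ENNReal.coe_le_coe] at this
          rw [enorm_mul, mul_pow]
          rw [ENNReal.coe_add, ENNReal.coe_mul, ENNReal.coe_mul, ENNReal.coe_mul, ENNReal.coe_add,
            ENNReal.coe_rpow_of_nonneg _ (by linarith : 0 ≤ r),
            ENNReal.coe_rpow_of_nonneg _ (by linarith : 0 ≤ r)] at this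
          exact this
      _ = (M ^ 2 : ℝ≥0) * ∫⁻ e, ‖d z e‖ₑ ^ 2 ∂μ
          + (M ^ (4 - r) : ℝ≥0) * (∫⁻ e, ‖d z e‖ₑ ^ r ∂μ + ∫⁻ e, ‖ε z e‖ₑ ^ r ∂μ) := by
          rw [lintegral_add_left ((m1.pow_const 2).const_mul _),
            lintegral_const_mul' _ _ ENNReal.coe_ne_top,
            lintegral_const_mul' _ _ ENNReal.coe_ne_top, lintegral_add_left (m1.pow_const r)]
      _ ≤ _ := by
          rw [ENNReal.coe_mul, ENNReal.coe_add]
          gcongr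
          · exact hB z hz
          · exact hB' z hz
  have hM : Tendsto (fun M : ℝ≥0 => M ^ (4 - r) * (B + B')) atTop (𝓝 0) := by
    have : Tendsto (fun M : ℝ≥0 => M ^ (4 - r)) atTop (𝓝 0) := by
      rw [← NNReal.tendsto_coe]
      simpa [Function.comp_def] using (tendsto_rpow_neg_atTop (by linarith : 0 < r - 4)).comp
        (NNReal.tendsto_coe_atTop.2 tendsto_id)
    simpa using this.mul_const (B + B')
  rw [ENNReal.tendsto_nhds_zero]
  intro δ hδ
  obtain ⟨δ', hδ'0, hδ'⟩ := ENNReal.lt_iff_exists_nnreal_btwn.1 (ENNReal.half_pos hδ.ne')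
  have hδ'0 : 0 < δ' := by exact_mod_cast hδ'0
  obtain ⟨M, hM1, hM0⟩ := ((hM.eventually (ge_mem_nhds hδ'0)).and (eventually_gt_atTop 0)).exists
  have h1 : Tendsto (fun z => ((M ^ 2 : ℝ≥0) : ℝ≥0∞) * ∫⁻ e, ‖d z e‖ₑ ^ 2 ∂μ) l (𝓝 0) := by
    have := ENNReal.Tendsto.const_mul h0 (Or.inr (ENNReal.coe_ne_top (r := M ^ 2)))
    rwa [mul_zero] at this
  filter_upwards [hl, ENNReal.tendsto_nhds_zero.1 h1 (δ / 2) (ENNReal.half_pos hδ.ne')] with z hz h2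
  calc _ ≤ _ := hpt M hM0 z hz
    _ ≤ δ / 2 + δ / 2 := add_le_add h2 ((ENNReal.coe_le_coe.2 hM1).trans hδ'.le)
    _ = δ := ENNReal.add_halves δ

/-- Second moments converge along processes that are close in mean square. -/
lemma tendsto_integral_sq_of_tendsto_sub {ι : Type*} {μ : Measure E} {l : Filter ι}
    {G G₀ : ι → E → ℝ} (hG : ∀ᶠ z in l, MemLp (G z) 2 μ) (hG₀ : ∀ᶠ z in l, MemLp (G₀ z) 2 μ)
    (hsub : Tendsto (fun z => ∫⁻ e, ‖G z e - G₀ z e‖ₑ ^ 2 ∂μ) l (𝓝 0)) {v : ℝ}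
    (hv : Tendsto (fun z => ∫ e, G₀ z e ^ 2 ∂μ) l (𝓝 v)) :
    Tendsto (fun z => ∫ e, G z e ^ 2 ∂μ) l (𝓝 v) := by
  have hsq : ∀ u : E → ℝ, MemLp u 2 μ → ∫ e, u e ^ 2 ∂μ = (eLpNorm u 2 μ).toReal ^ 2 := by
    intro u hu
    rw [← ENNReal.toReal_pow, sq_eLpNorm_two, integral_eq_lintegral_of_nonneg_ae
      (ae_of_all _ fun _ => sq_nonneg _) (hu.1.pow 2)]
    congr 2 with e
    rw [← enorm_pow, Real.enorm_eq_ofReal (sq_nonneg _)]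
  have hd : Tendsto (fun z => (eLpNorm (G z - G₀ z) 2 μ).toReal) l (𝓝 0) := by
    have h1 : Tendsto (fun z => eLpNorm (G z - G₀ z) 2 μ ^ 2) l (𝓝 0) := by
      simpa only [sq_eLpNorm_two, Pi.sub_apply] using hsub
    have h2 := (ENNReal.continuous_rpow_const (y := 1 / 2)).tendsto 0 |>.comp h1
    simp only [Function.comp_def, ← ENNReal.rpow_natCast, ← ENNReal.rpow_mul] at h2
    norm_num at h2
    exact (ENNReal.tendsto_toReal ENNReal.zero_ne_top).comp h2
  have h0 : Tendsto (fun z => (eLpNorm (G₀ z) 2 μ).toReal) l (𝓝 √v) := by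
    have h3 := (Real.continuous_sqrt.tendsto v).comp hv
    refine h3.congr' ?_
    filter_upwards [hG₀] with z hz
    simp only [Function.comp_apply]
    rw [hsq _ hz, Real.sqrt_sq ENNReal.toReal_nonneg]
  by_cases hl : l = ⊥
  · simp [hl]
  have : l.NeBot := ⟨hl⟩
  have hv0 : 0 ≤ v := ge_of_tendsto' hv fun z => integral_nonneg fun _ => sq_nonneg _
  -- Reverse triangle inequality in `L²`: the two norms differ by at most the norm of the
  -- difference.
  have h4 : Tendsto (fun z => (eLpNorm (G z) 2 μ).toReal) l (𝓝 √v) := by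
    refine tendsto_of_tendsto_of_dist h0 ?_
    refine squeeze_zero' (Eventually.of_forall fun _ => dist_nonneg) ?_ hd
    filter_upwards [hG, hG₀] with z hz hz0
    rw [Real.dist_eq, abs_le]
    have e1 : eLpNorm (G z) 2 μ ≤ eLpNorm (G z - G₀ z) 2 μ + eLpNorm (G₀ z) 2 μ := by
      simpa using eLpNorm_add_le (hz.sub hz0).1 hz0.1 (by norm_num : (1 : ℝ≥0∞) ≤ 2)
    have e2 : eLpNorm (G₀ z) 2 μ ≤ eLpNorm (G z - G₀ z) 2 μ + eLpNorm (G z) 2 μ := by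
      rw [eLpNorm_sub_comm]
      simpa using eLpNorm_add_le (hz0.sub hz).1 hz.1 (by norm_num : (1 : ℝ≥0∞) ≤ 2)
    have t1 := ENNReal.toReal_mono (by finiteness [(hz.sub hz0).2.ne, hz0.2.ne]) e1
    have t2 := ENNReal.toReal_mono (by finiteness [(hz.sub hz0).2.ne, hz.2.ne]) e2
    rw [ENNReal.toReal_add (hz.sub hz0).2.ne hz0.2.ne] at t1
    rw [ENNReal.toReal_add (hz.sub hz0).2.ne hz.2.ne] at t2
    constructor <;> linarith
  have h5 := h4.pow 2
  rw [Real.sq_sqrt hv0] at h5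
  refine h5.congr' ?_
  filter_upwards [hG] with z hz
  exact (hsq _ hz).symm

end Moments

/-! ### Covariates and residuals on the unit square -/

section Model

variable {E : Type*} {p q : ℕ}

/-- The covariates `X(z₁)` and `Z(z₂)` at the pair of times `z`. -/
def cov (X : ℝ → E → Fin p → ℝ) (Z : ℝ → E → Fin q → ℝ) (a : Fin p ⊕ Fin q) (z : ℝ × ℝ) (e : E) :
    ℝ :=
  Sum.elim (X z.1 e) (Z z.2 e) a

/-- The vector `(β₀(s), γ₀(s))`. -/
def coef (β₀ : ℝ → Fin p → ℝ) (γ₀ : ℝ → Fin q → ℝ) (s : ℝ) : Fin p ⊕ Fin q → ℝ :=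
  Sum.elim (β₀ s) (γ₀ s)

/-- The residual `Y(z₁) - X(z₁)ᵀ b - Z(z₂)ᵀ c` for `θ = (b, c)`. -/
def resid (Y : ℝ → E → ℝ) (X : ℝ → E → Fin p → ℝ) (Z : ℝ → E → Fin q → ℝ)
    (θ : Fin p ⊕ Fin q → ℝ) (z : ℝ × ℝ) (e : E) : ℝ :=
  Y z.1 e - ∑ c, cov X Z c z e * θ c

/-- Position of the coefficient of a covariate in a local linear fit. -/
def lvl : Fin p ⊕ Fin q → RIdx p q := Sum.map Sum.inl Sum.inl

/-- Position of the slope of a covariate in a local linear fit. -/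
def der : Fin p ⊕ Fin q → RIdx p q := Sum.map Sum.inr Sum.inr

/-- The time at which a covariate is observed. -/
def time (a : Fin p ⊕ Fin q) (z : ℝ × ℝ) : ℝ := Sum.elim (fun _ => z.1) (fun _ => z.2) a

lemma R_lvl (X : ℝ → E → Fin p → ℝ) (Z : ℝ → E → Fin q → ℝ) (a : Fin p ⊕ Fin q) (z : ℝ × ℝ)
    (t : ℝ) (e : E) : R X Z z.1 z.2 t e (lvl a) = cov X Z a z e := by
  cases a <;> rfl

lemma R_der (X : ℝ → E → Fin p → ℝ) (Z : ℝ → E → Fin q → ℝ) (a : Fin p ⊕ Fin q) (z : ℝ × ℝ)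
    (t : ℝ) (e : E) : R X Z z.1 z.2 t e (der a) = cov X Z a z e * (time a z - t) := by
  cases a <;> rfl

lemma cov_diag (X : ℝ → E → Fin p → ℝ) (Z : ℝ → E → Fin q → ℝ) (a : Fin p ⊕ Fin q) (s : ℝ) (e : E) :
    cov X Z a (s, s) e = C X Z s e a := rfl

lemma rho_lvl (β₀ : ℝ → Fin p → ℝ) (γ₀ : ℝ → Fin q → ℝ) (s : ℝ) (a : Fin p ⊕ Fin q) :
    rho β₀ γ₀ s (lvl a) = coef β₀ γ₀ s a := by
  cases a <;> rfl

lemma sum_cov_diag_mul (X : ℝ → E → Fin p → ℝ) (Z : ℝ → E → Fin q → ℝ) (β₀ : ℝ → Fin p → ℝ)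
    (γ₀ : ℝ → Fin q → ℝ) (s : ℝ) (e : E) :
    ∑ c, cov X Z c (s, s) e * coef β₀ γ₀ s c = X s e ⬝ᵥ β₀ s + Z s e ⬝ᵥ γ₀ s := by
  simp [cov, coef, dotProduct]

variable [MeasurableSpace E] {μ : Measure E} [IsProbabilityMeasure μ]
  {Y : ℝ → E → ℝ} {X : ℝ → E → Fin p → ℝ} {Z : ℝ → E → Fin q → ℝ}
  {β₀ : ℝ → Fin p → ℝ} {γ₀ : ℝ → Fin q → ℝ} {σ : ℝ → (Fin p → ℝ) → (Fin q → ℝ) → ℝ}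
  {η : ℝ × ℝ → ℝ}

omit [IsProbabilityMeasure μ] in
lemma VaryingCoefficientModel.measurable_cov (hM : VaryingCoefficientModel μ Y X Z β₀ γ₀ σ)
    (a : Fin p ⊕ Fin q) : Measurable (Function.uncurry (cov X Z a)) := by
  rcases a with a | b
  · exact (measurable_pi_apply a).comp
      (hM.meas_X.comp ((measurable_fst.comp measurable_fst).prodMk measurable_snd))
  · exact (measurable_pi_apply b).comp
      (hM.meas_Z.comp ((measurable_snd.comp measurable_fst).prodMk measurable_snd))

omit [IsProbabilityMeasure μ] in
lemma lintegral_rpow_le_of_eLpNorm_le {F : Type*} [NormedAddCommGroup F] {u : E → F} {r B : ℝ≥0}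
    (hr : r ≠ 0) (h : eLpNorm u r μ ≤ B) :
    ∫⁻ e, ‖u e‖ₑ ^ (r : ℝ) ∂μ ≤ (B ^ (r : ℝ) : ℝ≥0) := by
  rw [← eLpNorm_nnreal_pow_eq_lintegral hr, ENNReal.coe_rpow_of_nonneg B r.coe_nonneg]
  exact ENNReal.rpow_le_rpow h r.2

/-- The response and the covariates have bounded moments of an order between four and six. -/
lemma exists_bddMoment (hM : VaryingCoefficientModel μ Y X Z β₀ γ₀ σ) {t : ℝ}
    (hreg : RegularityCondition μ Y X Z σ t) :
    ∃ r : ℝ, 4 < r ∧ r ≤ 6 ∧ BddMoment μ r (fun z => Y z.1) ∧ ∀ a, BddMoment μ r (cov X Z a) := by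
  obtain ⟨r, B, hr4, hB⟩ := hreg.moments
  have hr4' : (4 : ℝ) < r := by exact_mod_cast hr4
  have hr0 : r ≠ 0 := by rintro rfl; norm_num at hr4'
  have h1 : BddMoment μ r (fun z => Y z.1) :=
    ⟨hM.meas_Y.comp ((measurable_fst.comp measurable_fst).prodMk measurable_snd), _,
      fun z hz => lintegral_rpow_le_of_eLpNorm_le hr0 (hB z.1 hz.1).1⟩
  have h2 : ∀ a, BddMoment μ r (cov X Z a) := by
    intro a
    refine ⟨hM.measurable_cov a, B ^ (r : ℝ), fun z hz => ?_⟩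
    rcases a with a | b
    · refine le_trans (lintegral_mono fun e => ?_)
        (lintegral_rpow_le_of_eLpNorm_le hr0 (hB z.1 hz.1).2.1)
      refine ENNReal.rpow_le_rpow ?_ r.2
      rw [← ofReal_norm, ← ofReal_norm]
      exact ENNReal.ofReal_le_ofReal (norm_le_pi_norm (X z.1 e) a)
    · refine le_trans (lintegral_mono fun e => ?_)
        (lintegral_rpow_le_of_eLpNorm_le hr0 (hB z.2 hz.2).2.2)
      refine ENNReal.rpow_le_rpow ?_ r.2
      rw [← ofReal_norm, ← ofReal_norm]
      exact ENNReal.ofReal_le_ofReal (norm_le_pi_norm (Z z.2 e) b)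
  -- Capping the order at six keeps `r / 2` in `(2, 3]`, the range needed for the expansion of the
  -- exponential.
  have hmin : (0 : ℝ) ≤ min (r : ℝ) 6 := le_min r.2 (by norm_num)
  exact ⟨min r 6, lt_min hr4' (by norm_num), min_le_right _ _,
    h1.mono_exponent hmin (min_le_left _ _), fun a => (h2 a).mono_exponent hmin (min_le_left _ _)⟩

omit [IsProbabilityMeasure μ] in
lemma bddMoment_resid {r : ℝ} (hr : 1 ≤ r) (hY : BddMoment μ r (fun z => Y z.1))
    (hC : ∀ a, BddMoment μ r (cov X Z a)) (θ : Fin p ⊕ Fin q → ℝ) :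
    BddMoment μ r (resid Y X Z θ) :=
  hY.sub (BddMoment.sum _ (fun c => (hC c).mul_const (by linarith) (θ c)) hr) hr

/-- The moment function `E {C_a(z) C_b(z')}`. -/
noncomputable def covMoment (μ : Measure E) (X : ℝ → E → Fin p → ℝ) (Z : ℝ → E → Fin q → ℝ)
    (a b : Fin p ⊕ Fin q) (z : (ℝ × ℝ) × (ℝ × ℝ)) : ℝ :=
  ∫ e, cov X Z a z.1 e * cov X Z b z.2 e ∂μ

omit [IsProbabilityMeasure μ] in
lemma CovariateCondition.contDiffOn_covMoment (h : CovariateCondition μ X Z β₀ γ₀ σ η)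
    (a b : Fin p ⊕ Fin q) : ContDiffOn ℝ 2 (covMoment μ X Z a b) (unitSq ×ˢ unitSq) := by
  -- The level entries of `R` do not involve the centre `t`, so zero serves as well as any other
  -- value.
  refine (h.RR_smooth 0 (by simp) (lvl a) (lvl b)).congr fun z _ => ?_
  simp only [covMoment, R_lvl]

omit [IsProbabilityMeasure μ] in
lemma CovariateCondition.contDiffOn_coef (h : CovariateCondition μ X Z β₀ γ₀ σ η)
    (a : Fin p ⊕ Fin q) : ContDiffOn ℝ 2 (fun s => coef β₀ γ₀ s a) unitI := by
  refine (contDiffOn_pi.1 h.rho_smooth (lvl a)).congr fun s _ => ?_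
  rw [rho_lvl]

omit [MeasurableSpace E] in
lemma diag_mem {z : ℝ × ℝ} (hz : z ∈ unitSq) : (z.1, z.1) ∈ unitSq := ⟨hz.1, hz.1⟩

/-- The covariates are continuous in mean square. -/
lemma tendsto_lintegral_sq_cov_sub (h : CovariateCondition μ X Z β₀ γ₀ σ η) {t : ℝ}
    (ht : t ∈ Ioo (0 : ℝ) 1) {r : ℝ} (hr : 4 < r) {a : Fin p ⊕ Fin q}
    (hC : BddMoment μ r (cov X Z a)) :
    Tendsto (fun z : ℝ × ℝ => ∫⁻ e, ‖cov X Z a z e - cov X Z a (z.1, z.1) e‖ₑ ^ 2 ∂μ)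
      (𝓝 (t, t)) (𝓝 0) := by
  have hn := unitSq_mem_nhds ht
  have hc : ContinuousAt (covMoment μ X Z a a) ((t, t), (t, t)) :=
    (h.contDiffOn_covMoment a a).continuousOn.continuousAt (prod_mem_nhds hn hn)
  have hφ : ∀ φ : ℝ × ℝ → ((ℝ × ℝ) × (ℝ × ℝ)), Continuous φ → φ (t, t) = ((t, t), (t, t)) →
      Tendsto (fun z => covMoment μ X Z a a (φ z)) (𝓝 (t, t))
        (𝓝 (covMoment μ X Z a a ((t, t), (t, t)))) := fun φ h1 h2 => by
    have h3 := h1.tendsto (t, t)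
    rw [h2] at h3
    exact hc.tendsto.comp h3
  -- Expanding the square gives three values of the moment function with coefficients `1, -2, 1`;
  -- all tend to its value at `((t, t), (t, t))`, so the combination tends to zero.
  have hlim := ((hφ (fun z => (z, z)) (by fun_prop) rfl).sub
    ((hφ (fun z => (z, (z.1, z.1))) (by fun_prop) rfl).const_mul 2)).add
    (hφ (fun z => ((z.1, z.1), (z.1, z.1))) (by fun_prop) rfl)
  have hlim' := ENNReal.tendsto_ofReal hlim
  have h0 : covMoment μ X Z a a ((t, t), (t, t)) - 2 * covMoment μ X Z a a ((t, t), (t, t))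
      + covMoment μ X Z a a ((t, t), (t, t)) = 0 := by ring
  rw [h0, ENNReal.ofReal_zero] at hlim'
  refine hlim'.congr' ?_
  have hC2 := hC.mono_exponent (s := 2) (by norm_num) (by linarith)
  filter_upwards [hn] with z hz
  have m1 := hC2.memLp_two hz
  have m2 := hC2.memLp_two (diag_mem hz)
  have i1 := m1.integrable_mul m1
  have i2 := m1.integrable_mul m2
  have i3 := m2.integrable_mul m2
  have e1 : ∫ e, (cov X Z a z e - cov X Z a (z.1, z.1) e) ^ 2 ∂μ
      = covMoment μ X Z a a (z, z) - 2 * covMoment μ X Z a a (z, (z.1, z.1))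
        + covMoment μ X Z a a ((z.1, z.1), (z.1, z.1)) := by
    have : ∀ e, (cov X Z a z e - cov X Z a (z.1, z.1) e) ^ 2
        = (cov X Z a z e * cov X Z a z e - 2 * (cov X Z a z e * cov X Z a (z.1, z.1) e))
          + cov X Z a (z.1, z.1) e * cov X Z a (z.1, z.1) e := fun e => by ring
    simp_rw [this]
    refine (integral_add (i1.sub (i2.const_mul 2)) i3).trans ?_
    congr 1
    refine (integral_sub i1 (i2.const_mul 2)).trans ?_
    rw [integral_const_mul]
    rfl
  have i4 : Integrable (fun e => (cov X Z a z e - cov X Z a (z.1, z.1) e) ^ 2) μ :=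
    (m1.sub m2).integrable_sq
  rw [← e1, ofReal_integral_eq_lintegral_ofReal i4 (ae_of_all _ fun _ => sq_nonneg _)]
  congr 1 with e
  rw [← enorm_pow, Real.enorm_eq_ofReal (sq_nonneg _)]

/-! ### The mean of the score -/

/-- `E {C_a(z) Y(z₁)}` under the model. -/
lemma integral_cov_mul_response (hM : VaryingCoefficientModel μ Y X Z β₀ γ₀ σ) {r : ℝ}
    (hr : 4 < r) (hY : BddMoment μ r (fun z => Y z.1)) (hC : ∀ a, BddMoment μ r (cov X Z a))
    (a : Fin p ⊕ Fin q) {z : ℝ × ℝ} (hz : z ∈ unitSq) :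
    ∫ e, cov X Z a z e * Y z.1 e ∂μ
      = ∑ c, covMoment μ X Z a c (z, (z.1, z.1)) * coef β₀ γ₀ z.1 c := by
  have hY2 := (hY.mono_exponent (s := 2) (by norm_num) (by linarith)).memLp_two hz
  have hC2 : ∀ a, BddMoment μ 2 (cov X Z a) := fun a =>
    (hC a).mono_exponent (by norm_num) (by linarith)
  set Φ : E → (Fin p → ℝ) × (Fin q → ℝ) × (Fin q → ℝ) :=
    fun e => (X z.1 e, Z z.1 e, Z z.2 e) with hΦ
  have hX : ∀ s, Measurable (X s) := fun s => hM.meas_X.comp measurable_prodMk_left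
  have hZ : ∀ s, Measurable (Z s) := fun s => hM.meas_Z.comp measurable_prodMk_left
  have hΦm : Measurable Φ := (hX _).prodMk ((hZ _).prodMk (hZ _))
  have hle : MeasurableSpace.comap Φ inferInstance ≤ ‹MeasurableSpace E› := hΦm.comap_le
  have hcov : StronglyMeasurable[MeasurableSpace.comap Φ inferInstance] (cov X Z a z) := by
    refine Measurable.stronglyMeasurable ?_
    rcases a with a | b
    · exact ((measurable_pi_apply a).comp measurable_fst).comp (comap_measurable Φ)
    · exact ((measurable_pi_apply b).comp (measurable_snd.comp measurable_snd)).comp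
        (comap_measurable Φ)
  have i1 : Integrable (cov X Z a z * Y z.1) μ := ((hC2 a).memLp_two hz).integrable_mul hY2
  have h1 := condExp_mul_of_stronglyMeasurable_left hcov i1 (hY2.integrable (by norm_num))
  -- The model enters here with `u = z.2`: the weight may contain `Z(z₂)`, so the conditioning must
  -- include it without changing the mean of `Y(z₁)`.
  have h2 := hM.mean z.1 hz.1 z.2 hz.2
  calc ∫ e, cov X Z a z e * Y z.1 e ∂μ
      = ∫ e, (μ[cov X Z a z * Y z.1 | MeasurableSpace.comap Φ inferInstance]) e ∂μ :=
        (integral_condExp hle).symm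
    _ = ∫ e, ∑ c, (cov X Z a z e * cov X Z c (z.1, z.1) e) * coef β₀ γ₀ z.1 c ∂μ := by
        refine integral_congr_ae ?_
        filter_upwards [h1, h2] with e he1 he2
        rw [he1, Pi.mul_apply, he2, ← sum_cov_diag_mul, Finset.mul_sum]
        simp only [mul_assoc]
    _ = _ := by
        have i2 : ∀ c, Integrable (fun e => cov X Z a z e * cov X Z c (z.1, z.1) e *
            coef β₀ γ₀ z.1 c) μ := fun c => (((hC2 a).memLp_two hz).integrable_mul
          ((hC2 c).memLp_two (diag_mem hz))).mul_const _
        rw [integral_finsetSum _ fun c _ => i2 c]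
        refine Finset.sum_congr rfl fun c _ => ?_
        rw [integral_mul_const]; rfl

/-- The mean of the score, `E {C_a(z) (Y(z₁) - C(z)ᵀ θ)}`. -/
lemma integral_cov_mul_resid (hM : VaryingCoefficientModel μ Y X Z β₀ γ₀ σ) {r : ℝ}
    (hr : 4 < r) (hY : BddMoment μ r (fun z => Y z.1)) (hC : ∀ a, BddMoment μ r (cov X Z a))
    (a : Fin p ⊕ Fin q) (θ : Fin p ⊕ Fin q → ℝ) {z : ℝ × ℝ} (hz : z ∈ unitSq) :
    ∫ e, cov X Z a z e * resid Y X Z θ z e ∂μ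
      = (∑ c, covMoment μ X Z a c (z, (z.1, z.1)) * coef β₀ γ₀ z.1 c)
        - ∑ c, covMoment μ X Z a c (z, z) * θ c := by
  have hY2 := (hY.mono_exponent (s := 2) (by norm_num) (by linarith)).memLp_two hz
  have hC2 : ∀ a, MemLp (cov X Z a z) 2 μ := fun a =>
    ((hC a).mono_exponent (by norm_num) (by linarith)).memLp_two hz
  have i1 : Integrable (cov X Z a z * Y z.1) μ := (hC2 a).integrable_mul hY2
  have i2 : ∀ c, Integrable (fun e => cov X Z a z e * cov X Z c z e * θ c) μ := fun c =>
    ((hC2 a).integrable_mul (hC2 c)).mul_const _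
  rw [← integral_cov_mul_response hM hr hY hC a hz]
  have e1 : ∀ e, cov X Z a z e * resid Y X Z θ z e
      = (cov X Z a z * Y z.1) e - ∑ c, cov X Z a z e * cov X Z c z e * θ c := fun e => by
    simp only [resid, mul_sub, Finset.mul_sum, Pi.mul_apply, mul_assoc]
  simp_rw [e1]
  rw [integral_sub i1 (integrable_finsetSum _ fun c _ => i2 c), integral_finsetSum _ fun c _ => i2 c]
  congr 1
  refine Finset.sum_congr rfl fun c _ => ?_
  rw [integral_mul_const]; rfl

omit [IsProbabilityMeasure μ] in
/-- The mean of the score is twice continuously differentiable. -/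
lemma CovariateCondition.contDiffOn_score_mean (h : CovariateCondition μ X Z β₀ γ₀ σ η)
    (a : Fin p ⊕ Fin q) (θ : Fin p ⊕ Fin q → ℝ) :
    ContDiffOn ℝ 2 (fun z : ℝ × ℝ =>
      (∑ c, covMoment μ X Z a c (z, (z.1, z.1)) * coef β₀ γ₀ z.1 c)
        - ∑ c, covMoment μ X Z a c (z, z) * θ c) unitSq := by
  refine ContDiffOn.sub (ContDiffOn.sum fun c _ => ContDiffOn.mul ?_ ?_)
    (ContDiffOn.sum fun c _ => ContDiffOn.mul ?_ contDiffOn_const)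
  · refine (h.contDiffOn_covMoment a c).comp (f := fun z : ℝ × ℝ => (z, (z.1, z.1))) ?_ ?_
    · exact ContDiff.contDiffOn (by fun_prop)
    · exact fun z hz => ⟨hz, diag_mem hz⟩
  · refine (h.contDiffOn_coef c).comp (f := fun z : ℝ × ℝ => z.1) contDiff_fst.contDiffOn ?_
    exact fun z hz => hz.1
  · refine (h.contDiffOn_covMoment a c).comp (f := fun z : ℝ × ℝ => (z, z)) ?_ ?_
    · exact ContDiff.contDiffOn (by fun_prop)
    · exact fun z hz => ⟨hz, hz⟩

end Model

/-! ### The variance of the score -/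

section Variance

variable {E : Type*} [MeasurableSpace E] {μ : Measure E}

lemma tendsto_lintegral_sq_add {ι : Type*} {l : Filter ι} {d d' : ι → E → ℝ}
    (hm : ∀ z, Measurable (d z))
    (h : Tendsto (fun z => ∫⁻ e, ‖d z e‖ₑ ^ 2 ∂μ) l (𝓝 0))
    (h' : Tendsto (fun z => ∫⁻ e, ‖d' z e‖ₑ ^ 2 ∂μ) l (𝓝 0)) :
    Tendsto (fun z => ∫⁻ e, ‖d z e + d' z e‖ₑ ^ 2 ∂μ) l (𝓝 0) := by
  have hlim : Tendsto (fun z => 2 * (∫⁻ e, ‖d z e‖ₑ ^ 2 ∂μ + ∫⁻ e, ‖d' z e‖ₑ ^ 2 ∂μ)) l (𝓝 0) := by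
    simpa using ENNReal.Tendsto.const_mul (h.add h') (Or.inr (ENNReal.ofNat_ne_top (n := 2)))
  refine tendsto_of_tendsto_of_tendsto_of_le_of_le tendsto_const_nhds hlim
    (fun _ => zero_le) fun z => ?_
  change ∫⁻ e, ‖d z e + d' z e‖ₑ ^ 2 ∂μ ≤ _
  rw [← lintegral_add_left ((hm z).enorm.pow_const 2), ← lintegral_const_mul' _ _ (by simp)]
  refine lintegral_mono fun e => ?_
  calc ‖d z e + d' z e‖ₑ ^ 2 ≤ (‖d z e‖ₑ + ‖d' z e‖ₑ) ^ 2 := by gcongr; exact enorm_add_le _ _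
    _ ≤ 2 * (‖d z e‖ₑ ^ 2 + ‖d' z e‖ₑ ^ 2) := by
      have := ENNReal.rpow_add_le_mul_rpow_add_rpow ‖d z e‖ₑ ‖d' z e‖ₑ (one_le_two (α := ℝ))
      norm_num at this
      exact this

lemma tendsto_lintegral_sq_sum {ι κ : Type*} {l : Filter ι} (S : Finset κ) {d : κ → ι → E → ℝ}
    (hm : ∀ k z, Measurable (d k z))
    (h : ∀ k, Tendsto (fun z => ∫⁻ e, ‖d k z e‖ₑ ^ 2 ∂μ) l (𝓝 0)) :
    Tendsto (fun z => ∫⁻ e, ‖∑ k ∈ S, d k z e‖ₑ ^ 2 ∂μ) l (𝓝 0) := by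
  classical
  induction S using Finset.induction_on with
  | empty => simpa using tendsto_const_nhds
  | insert a S ha ih =>
    simpa only [Finset.sum_insert ha] using tendsto_lintegral_sq_add (hm a) (h a) ih

lemma tendsto_lintegral_sq_mul_const {ι : Type*} {l : Filter ι} {d : ι → E → ℝ}
    (h : Tendsto (fun z => ∫⁻ e, ‖d z e‖ₑ ^ 2 ∂μ) l (𝓝 0)) (c : ℝ) :
    Tendsto (fun z => ∫⁻ e, ‖d z e * c‖ₑ ^ 2 ∂μ) l (𝓝 0) := by
  have := ENNReal.Tendsto.mul_const h (Or.inr (by finiteness : ‖c‖ₑ ^ 2 ≠ ⊤))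
  rw [zero_mul] at this
  refine this.congr fun z => ?_
  rw [← lintegral_mul_const' _ _ (by finiteness)]
  simp only [enorm_mul, mul_pow]

lemma tendsto_lintegral_sq_bdd_mul {ι : Type*} {l : Filter ι} {d : ι → E → ℝ} {B : ℝ≥0}
    (hB : ∀ᶠ z in l, ∫⁻ e, ‖d z e‖ₑ ^ 2 ∂μ ≤ B) {c : ι → ℝ} (hc : Tendsto c l (𝓝 0)) :
    Tendsto (fun z => ∫⁻ e, ‖d z e * c z‖ₑ ^ 2 ∂μ) l (𝓝 0) := by
  have hc' : Tendsto (fun z => (B : ℝ≥0∞) * ‖c z‖ₑ ^ 2) l (𝓝 0) := by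
    have h1 : Tendsto (fun z => ‖c z‖ₑ ^ 2) l (𝓝 0) := by
      have := ENNReal.Tendsto.pow (n := 2) ((continuous_enorm.tendsto (0 : ℝ)).comp hc)
      simpa using this
    simpa using ENNReal.Tendsto.const_mul h1 (Or.inr (ENNReal.coe_ne_top (r := B)))
  refine tendsto_of_tendsto_of_tendsto_of_le_of_le' tendsto_const_nhds hc'
    (Eventually.of_forall fun _ => zero_le) ?_
  filter_upwards [hB] with z hz
  simp only [enorm_mul, mul_pow]
  rw [lintegral_mul_const' _ _ (by finiteness)]
  gcongr

variable {p q : ℕ} [IsProbabilityMeasure μ]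
  {Y : ℝ → E → ℝ} {X : ℝ → E → Fin p → ℝ} {Z : ℝ → E → Fin q → ℝ}
  {β₀ : ℝ → Fin p → ℝ} {γ₀ : ℝ → Fin q → ℝ} {σ : ℝ → (Fin p → ℝ) → (Fin q → ℝ) → ℝ}
  {η : ℝ × ℝ → ℝ}

/-- A linear combination of the covariates. -/
def covComb (X : ℝ → E → Fin p → ℝ) (Z : ℝ → E → Fin q → ℝ) (w : Fin p ⊕ Fin q → ℝ) (z : ℝ × ℝ)
    (e : E) : ℝ :=
  ∑ a, cov X Z a z e * w a

omit [IsProbabilityMeasure μ] in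
lemma bddMoment_covComb {r : ℝ} (hr : 1 ≤ r) (hC : ∀ a, BddMoment μ r (cov X Z a))
    (w : Fin p ⊕ Fin q → ℝ) : BddMoment μ r (covComb X Z w) :=
  BddMoment.sum _ (fun c => (hC c).mul_const (by linarith) (w c)) hr

lemma memLp_two_mul {r : ℝ} (hr : 4 < r) {g g' : ℝ × ℝ → E → ℝ} (h : BddMoment μ r g)
    (h' : BddMoment μ r g') {z : ℝ × ℝ} (hz : z ∈ unitSq) :
    MemLp (fun e => g z e * g' z e) 2 μ :=
  ((h.mul h' (by linarith)).mono_exponent (by norm_num) (by linarith)).memLp_two hz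

/-- The second moment of the score on the diagonal. -/
lemma integral_sq_score_diag (hM : VaryingCoefficientModel μ Y X Z β₀ γ₀ σ)
    (hA2 : CovariateCondition μ X Z β₀ γ₀ σ η) {r : ℝ}
    (hr : 4 < r) (hY : BddMoment μ r (fun z => Y z.1)) (hC : ∀ a, BddMoment μ r (cov X Z a))
    (w : Fin p ⊕ Fin q → ℝ) {s : ℝ} (hs : s ∈ unitI) :
    ∫ e, (covComb X Z w (s, s) e * resid Y X Z (coef β₀ γ₀ s) (s, s) e) ^ 2 ∂μ
      = ∑ a, ∑ b, w a * w b * sigmaMoment μ X Z σ s a b := by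
  have hz : (s, s) ∈ unitSq := ⟨hs, hs⟩
  set Φ : E → (Fin p → ℝ) × (Fin q → ℝ) := fun e => (X s e, Z s e) with hΦ
  have hX : Measurable (X s) := hM.meas_X.comp measurable_prodMk_left
  have hZ : Measurable (Z s) := hM.meas_Z.comp measurable_prodMk_left
  have hle : MeasurableSpace.comap Φ inferInstance ≤ ‹MeasurableSpace E› := (hX.prodMk hZ).comap_le
  have hXm : Measurable[MeasurableSpace.comap Φ inferInstance] (X s) := measurable_fst.comp (comap_measurable Φ)
  have hZm : Measurable[MeasurableSpace.comap Φ inferInstance] (Z s) := measurable_snd.comp (comap_measurable Φ)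
  -- For `u = s` the triple generates the same σ-algebra as the pair, so the mean is available where
  -- the conditional variance is given.
  have hmm : MeasurableSpace.comap (fun e => (X s e, Z s e, Z s e)) inferInstance
      = MeasurableSpace.comap Φ inferInstance := by
    refine le_antisymm ?_ ?_
    · exact Measurable.comap_le (hXm.prodMk (hZm.prodMk hZm))
    · have hc := comap_measurable (m := inferInstance) fun e => (X s e, Z s e, Z s e)
      have h1 := measurable_fst.comp hc
      have h2 := (measurable_fst.comp measurable_snd).comp hc
      exact Measurable.comap_le (h1.prodMk h2)
  have hmean := hM.mean s hs s hs
  rw [hmm] at hmean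
  have hvar := hM.variance s hs
  rw [← hΦ] at hvar
  set W := covComb X Z w (s, s) with hW
  set ε := resid Y X Z (coef β₀ γ₀ s) (s, s) with hε
  have hεeq : ∀ e, ε e = Y s e - (X s e ⬝ᵥ β₀ s + Z s e ⬝ᵥ γ₀ s) := fun e => by
    rw [hε, resid, sum_cov_diag_mul]
  have hres : (Y s - μ[Y s | MeasurableSpace.comap Φ inferInstance]) ^ 2 =ᵐ[μ] ε ^ 2 := by
    filter_upwards [hmean] with e he
    simp only [Pi.pow_apply, Pi.sub_apply, he, hεeq]
  have hcv : μ[ε ^ 2 | MeasurableSpace.comap Φ inferInstance] =ᵐ[μ] fun e => σ s (X s e) (Z s e) ^ 2 :=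
    (condExp_congr_ae hres).symm.trans hvar
  have hWm : StronglyMeasurable[MeasurableSpace.comap Φ inferInstance] (W ^ 2) := by
    refine Measurable.stronglyMeasurable (Measurable.pow_const ?_ 2)
    refine Finset.measurable_sum _ fun a _ => Measurable.mul_const ?_ _
    rcases a with a | b
    · exact (measurable_pi_apply a).comp hXm
    · exact (measurable_pi_apply b).comp hZm
  have hεb := bddMoment_resid (by linarith) hY hC (coef β₀ γ₀ s)
  have hWb := bddMoment_covComb (by linarith) hC w
  have i1 : Integrable (W ^ 2 * ε ^ 2) μ := by
    have := (memLp_two_mul hr hWb hεb hz).integrable_sq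
    simpa only [mul_pow] using! this
  have i2 : Integrable (ε ^ 2) μ :=
    ((hεb.mono_exponent (s := 2) (by norm_num) (by linarith)).memLp_two hz).integrable_sq
  have h1 := condExp_mul_of_stronglyMeasurable_left hWm i1 i2
  calc ∫ e, (W e * ε e) ^ 2 ∂μ = ∫ e, (W ^ 2 * ε ^ 2) e ∂μ := by
        simp only [Pi.mul_apply, Pi.pow_apply, mul_pow]
    _ = ∫ e, (μ[W ^ 2 * ε ^ 2 | MeasurableSpace.comap Φ inferInstance]) e ∂μ := (integral_condExp hle).symm
    _ = ∫ e, ∑ a, ∑ b, w a * w b * (C X Z s e a * C X Z s e b * σ s (X s e) (Z s e) ^ 2) ∂μ := by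
        refine integral_congr_ae ?_
        filter_upwards [h1, hcv] with e he1 he2
        rw [he1, Pi.mul_apply, he2, Pi.pow_apply, hW, covComb, sq (∑ a, _), Finset.sum_mul_sum,
          Finset.sum_mul]
        refine Finset.sum_congr rfl fun a _ => ?_
        rw [Finset.sum_mul]
        refine Finset.sum_congr rfl fun b _ => ?_
        rw [cov_diag, cov_diag]; ring
    _ = _ := by
        have i3 : ∀ a b, Integrable (fun e => w a * w b *
            (C X Z s e a * C X Z s e b * σ s (X s e) (Z s e) ^ 2)) μ := fun a b =>
          (hA2.sigma_finite s hs a b).const_mul _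
        rw [integral_finsetSum _ fun a _ => integrable_finsetSum _ fun b _ => i3 a b]
        refine Finset.sum_congr rfl fun a _ => ?_
        rw [integral_finsetSum _ fun b _ => i3 a b]
        refine Finset.sum_congr rfl fun b _ => ?_
        rw [integral_const_mul]; rfl

/-- The second moment of the score is continuous at `(t, t)`. -/
lemma tendsto_integral_sq_score (hM : VaryingCoefficientModel μ Y X Z β₀ γ₀ σ)
    (hA2 : CovariateCondition μ X Z β₀ γ₀ σ η) {t : ℝ} (ht : t ∈ Ioo (0 : ℝ) 1)
    (hreg : RegularityCondition μ Y X Z σ t) {r : ℝ}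
    (hr : 4 < r) (hY : BddMoment μ r (fun z => Y z.1)) (hC : ∀ a, BddMoment μ r (cov X Z a))
    (w : Fin p ⊕ Fin q → ℝ) :
    Tendsto (fun z => ∫ e, (covComb X Z w z e * resid Y X Z (coef β₀ γ₀ t) z e) ^ 2 ∂μ)
      (𝓝 (t, t)) (𝓝 (∑ a, ∑ b, w a * w b * sigmaMoment μ X Z σ t a b)) := by
  have hn := unitSq_mem_nhds ht
  have hr1 : 1 ≤ r := by linarith
  have hW := bddMoment_covComb hr1 hC w
  have hε := bddMoment_resid hr1 hY hC (coef β₀ γ₀ t)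
  have hφ : Measurable fun z : ℝ × ℝ => (z.1, z.1) := by fun_prop
  have hC' : ∀ a, BddMoment μ r (fun z : ℝ × ℝ => cov X Z a (z.1, z.1)) := fun a =>
    (hC a).comp hφ fun z hz => diag_mem hz
  have hW' : BddMoment μ r (fun z : ℝ × ℝ => covComb X Z w (z.1, z.1)) :=
    hW.comp hφ fun z hz => diag_mem hz
  have hd : ∀ a, BddMoment μ r (fun z e => cov X Z a z e - cov X Z a (z.1, z.1) e) := fun a =>
    (hC a).sub (hC' a) hr1
  have hcoef : ∀ c, Tendsto (fun z : ℝ × ℝ => coef β₀ γ₀ z.1 c - coef β₀ γ₀ t c) (𝓝 (t, t))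
      (𝓝 0) := fun c => by
    have h1 : ContinuousAt (fun s => coef β₀ γ₀ s c) t :=
      (hA2.contDiffOn_coef c).continuousOn.continuousAt (Icc_mem_nhds ht.1 ht.2)
    have h2 : Tendsto (fun z : ℝ × ℝ => z.1) (𝓝 (t, t)) (𝓝 t) := continuous_fst.tendsto _
    simpa using (h1.tendsto.comp h2).sub_const (coef β₀ γ₀ t c)
  have hsum : ∀ u : Fin p ⊕ Fin q → ℝ, BddMoment μ r
      (fun z e => ∑ a, (cov X Z a z e - cov X Z a (z.1, z.1) e) * u a) := fun u =>
    BddMoment.sum _ (fun a => (hd a).mul_const (by linarith) (u a)) hr1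
  have hsum0 : ∀ u : Fin p ⊕ Fin q → ℝ, Tendsto (fun z : ℝ × ℝ =>
      ∫⁻ e, ‖∑ a, (cov X Z a z e - cov X Z a (z.1, z.1) e) * u a‖ₑ ^ 2 ∂μ) (𝓝 (t, t)) (𝓝 0) :=
    fun u => tendsto_lintegral_sq_sum _
      (fun a z => ((hd a).mul_const (by linarith) (u a)).measurable_apply z)
      fun a => tendsto_lintegral_sq_mul_const (tendsto_lintegral_sq_cov_sub hA2 ht hr (hC a)) _
  -- The reference is the score at the diagonal point `(z.1, z.1)` with the coefficients at `z.1`,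
  -- whose second moment is known. The difference comes from the weight (`t1`), from the covariates
  -- inside the residual (`t2`), and from the coefficients (`t3`).
  have t1 := tendsto_lintegral_sq_mul hr (hsum w) hε hn (hsum0 w)
  have t2 := tendsto_lintegral_sq_mul hr (hsum (fun c => -coef β₀ γ₀ t c)) hW' hn
    (hsum0 fun c => -coef β₀ γ₀ t c)
  have t3 : Tendsto (fun z : ℝ × ℝ => ∫⁻ e, ‖∑ c, (covComb X Z w (z.1, z.1) e *
      cov X Z c (z.1, z.1) e) * (coef β₀ γ₀ z.1 c - coef β₀ γ₀ t c)‖ₑ ^ 2 ∂μ) (𝓝 (t, t)) (𝓝 0) := by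
    refine tendsto_lintegral_sq_sum _
      (fun a z => ((hW'.measurable_apply z).mul ((hC' a).measurable_apply z)).mul_const _)
      fun c => ?_
    obtain ⟨B, hB⟩ := ((hW'.mul (hC' c) (by linarith)).mono_exponent (s := 2) (by norm_num)
      (by linarith)).exists_sq_bound
    exact tendsto_lintegral_sq_bdd_mul (by filter_upwards [hn] with z hz using hB z hz) (hcoef c)
  have t4 := tendsto_lintegral_sq_add
    (fun z => ((hsum w).measurable_apply z).mul (hε.measurable_apply z)) t1
    (tendsto_lintegral_sq_add
      (fun z => ((hsum _).measurable_apply z).mul (hW'.measurable_apply z)) t2 t3)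
  refine tendsto_integral_sq_of_tendsto_sub (G₀ := fun z e => covComb X Z w (z.1, z.1) e *
    resid Y X Z (coef β₀ γ₀ z.1) (z.1, z.1) e) ?_ ?_ ?_ ?_
  · filter_upwards [hn] with z hz using memLp_two_mul hr hW hε hz
  · filter_upwards [hn] with z hz
    exact memLp_two_mul hr hW (bddMoment_resid hr1 hY hC (coef β₀ γ₀ z.1)) (diag_mem hz)
  · refine t4.congr fun z => ?_
    congr 1 with e
    congr 2
    simp only [Pi.mul_apply]
    have e1 : ∑ a, (cov X Z a z e - cov X Z a (z.1, z.1) e) * w a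
        = covComb X Z w z e - covComb X Z w (z.1, z.1) e := by
      simp only [covComb, sub_mul, Finset.sum_sub_distrib]
    have e2 : ∑ c, (covComb X Z w (z.1, z.1) e * cov X Z c (z.1, z.1) e) *
        (coef β₀ γ₀ z.1 c - coef β₀ γ₀ t c) = covComb X Z w (z.1, z.1) e *
        ((∑ c, cov X Z c (z.1, z.1) e * coef β₀ γ₀ z.1 c)
          - ∑ c, cov X Z c (z.1, z.1) e * coef β₀ γ₀ t c) := by
      rw [← Finset.sum_sub_distrib, Finset.mul_sum]
      refine Finset.sum_congr rfl fun c _ => by ring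
    have e3 : ∑ a, (cov X Z a z e - cov X Z a (z.1, z.1) e) * -coef β₀ γ₀ t a
        = (∑ c, cov X Z c (z.1, z.1) e * coef β₀ γ₀ t c)
          - ∑ c, cov X Z c z e * coef β₀ γ₀ t c := by
      rw [← Finset.sum_sub_distrib]
      refine Finset.sum_congr rfl fun c _ => by ring
    rw [e1, e2, e3]
    simp only [resid]
    ring
  · have hσ : Tendsto (fun s => ∑ a, ∑ b, w a * w b * sigmaMoment μ X Z σ s a b) (𝓝 t)
        (𝓝 (∑ a, ∑ b, w a * w b * sigmaMoment μ X Z σ t a b)) := by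
      refine tendsto_finsetSum _ fun a _ => tendsto_finsetSum _ fun b _ => ?_
      exact (tendsto_pi_nhds.1 (tendsto_pi_nhds.1 hreg.sigma_cont.tendsto a) b).const_mul _
    have h2 : Tendsto (fun z : ℝ × ℝ => z.1) (𝓝 (t, t)) (𝓝 t) := continuous_fst.tendsto _
    refine (hσ.comp h2).congr' ?_
    filter_upwards [hn] with z hz
    exact (integral_sq_score_diag hM hA2 hr hY hC w hz.1).symm

end Variance

/-! ### Solutions of random linear equations -/

section LinearEquation

open scoped Matrix

variable {Ω : Type*} [MeasurableSpace Ω] {P : Measure Ω}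

lemma tendstoInMeasure_pi {κ F : Type*} [Fintype κ] [PseudoEMetricSpace F]
    {f : ℕ → Ω → κ → F} {c : κ → F}
    (h : ∀ k, TendstoInMeasure P (fun n ω => f n ω k) atTop (fun _ => c k)) :
    TendstoInMeasure P f atTop (fun _ => c) := by
  intro ε hε
  have hlim : Tendsto (fun n => ∑ k, P {ω | ε ≤ edist (f n ω k) (c k)}) atTop (𝓝 0) := by
    simpa using tendsto_finsetSum Finset.univ fun k _ => h k ε hε
  refine tendsto_of_tendsto_of_tendsto_of_le_of_le tendsto_const_nhds hlim
    (fun _ => zero_le) fun n => ?_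
  refine (measure_mono fun ω hω => ?_).trans (measure_iUnion_fintype_le P
    fun k => {ω | ε ≤ edist (f n ω k) (c k)})
  have hω' : ε ≤ edist (f n ω) c := hω
  rw [edist_pi_def, Finset.le_sup_iff hε] at hω'
  obtain ⟨k, -, hk⟩ := hω'
  exact mem_iUnion.2 ⟨k, hk⟩

lemma tendstoInMeasure_prodMk {F G : Type*} [PseudoEMetricSpace F] [PseudoEMetricSpace G]
    {f : ℕ → Ω → F} {g : ℕ → Ω → G} {c : F} {d : G}
    (hf : TendstoInMeasure P f atTop (fun _ => c)) (hg : TendstoInMeasure P g atTop (fun _ => d)) :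
    TendstoInMeasure P (fun n ω => (f n ω, g n ω)) atTop (fun _ => (c, d)) := by
  intro ε hε
  have hlim := (hf ε hε).add (hg ε hε)
  rw [add_zero] at hlim
  refine tendsto_of_tendsto_of_tendsto_of_le_of_le tendsto_const_nhds hlim
    (fun _ => zero_le) fun n => ?_
  refine (measure_mono fun ω hω => ?_).trans (measure_union_le _ _)
  exact le_max_iff.1 (show ε ≤ max (edist (f n ω) c) (edist (g n ω) d) from hω)

lemma tendsto_measure_notMem_of_tendstoInMeasure {F : Type*} [PseudoEMetricSpace F]
    {f : ℕ → Ω → F} {c : F} (hf : TendstoInMeasure P f atTop (fun _ => c)) {U : Set F}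
    (hU : U ∈ 𝓝 c) : Tendsto (fun n => P {ω | f n ω ∉ U}) atTop (𝓝 0) := by
  obtain ⟨δ, hδ, hball⟩ := EMetric.mem_nhds_iff.1 hU
  refine tendsto_of_tendsto_of_tendsto_of_le_of_le tendsto_const_nhds (hf δ hδ)
    (fun _ => zero_le) fun n => measure_mono fun ω hω => ?_
  exact not_lt.1 fun h => hω (hball (Metric.mem_eball.2 h))

lemma tendstoInMeasure_comp_of_continuousAt {F G : Type*} [PseudoEMetricSpace F]
    [PseudoEMetricSpace G] {f : ℕ → Ω → F} {c : F} (hf : TendstoInMeasure P f atTop (fun _ => c))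
    {φ : F → G} (hφ : ContinuousAt φ c) :
    TendstoInMeasure P (fun n ω => φ (f n ω)) atTop (fun _ => φ c) := by
  intro ε hε
  refine (tendsto_measure_notMem_of_tendstoInMeasure hf
    (hφ.preimage_mem_nhds (Metric.eball_mem_nhds (φ c) hε))).congr fun n => ?_
  congr 1 with ω
  simp

variable {I : Type*} [Fintype I] [DecidableEq I]

lemma continuous_det_of {J : Type*} [Fintype J] [DecidableEq J] :
    Continuous fun m : J → J → ℝ => (Matrix.of m).det :=
  Continuous.matrix_det continuous_id

/-- Cramer's formula makes the inverse continuous where the determinant is nonzero and measurable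
everywhere, with value zero at singular matrices. -/
lemma of_inv_apply {J : Type*} [Fintype J] [DecidableEq J] (m : J → J → ℝ) (i j : J) :
    (Matrix.of m)⁻¹ i j = (Matrix.of m).det⁻¹ * (Matrix.of m).adjugate i j := by
  rw [Matrix.inv_def, Ring.inverse_eq_inv', Matrix.smul_apply, smul_eq_mul]

lemma continuous_adjugate_of {J : Type*} [Fintype J] [DecidableEq J] (i j : J) :
    Continuous fun m : J → J → ℝ => (Matrix.of m).adjugate i j :=
  (Continuous.matrix_adjugate continuous_id).matrix_elem i j

lemma continuousAt_of_inv {J : Type*} [Fintype J] [DecidableEq J] {m₀ : J → J → ℝ}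
    (h : (Matrix.of m₀).det ≠ 0) (i j : J) :
    ContinuousAt (fun m : J → J → ℝ => (Matrix.of m)⁻¹ i j) m₀ := by
  simp only [of_inv_apply]
  exact (continuous_det_of.continuousAt.inv₀ h).mul (continuous_adjugate_of i j).continuousAt

lemma measurable_of_inv {J : Type*} [Fintype J] [DecidableEq J] :
    Measurable (fun (m : J → J → ℝ) i j => (Matrix.of m)⁻¹ i j) := by
  refine measurable_pi_lambda _ fun i => measurable_pi_lambda _ fun j => ?_
  simp only [of_inv_apply]
  exact continuous_det_of.measurable.inv.mul (continuous_adjugate_of i j).measurable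

lemma tendstoInMeasure_of_inv {J : Type*} [Fintype J] [DecidableEq J] {M : ℕ → Ω → J → J → ℝ}
    {m₀ : J → J → ℝ} (hM : TendstoInMeasure P M atTop (fun _ => m₀))
    (h : (Matrix.of m₀).det ≠ 0) :
    TendstoInMeasure P (fun n ω i j => (Matrix.of (M n ω))⁻¹ i j) atTop
      (fun _ i j => (Matrix.of m₀)⁻¹ i j) := by
  have h1 : ∀ i j, TendstoInMeasure P (fun n ω => (Matrix.of (M n ω))⁻¹ i j) atTop
      (fun _ => (Matrix.of m₀)⁻¹ i j) := fun i j =>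
    tendstoInMeasure_comp_of_continuousAt (φ := fun m : J → J → ℝ => (Matrix.of m)⁻¹ i j) hM
      (continuousAt_of_inv h i j)
  have h2 : ∀ i, TendstoInMeasure P (fun n ω j => (Matrix.of (M n ω))⁻¹ i j) atTop
      (fun _ j => (Matrix.of m₀)⁻¹ i j) := fun i => tendstoInMeasure_pi (h1 i)
  exact tendstoInMeasure_pi h2

/-- The first block of `B (A v, d)`. -/
def firstBlock (A : Matrix I I ℝ) (y : EuclideanSpace ℝ I × ((I ⊕ I → I ⊕ I → ℝ) × (I → ℝ))) :
    EuclideanSpace ℝ I :=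
  WithLp.toLp 2 fun a => (Matrix.of y.2.1 *ᵥ Sum.elim (A *ᵥ (WithLp.ofLp y.1)) y.2.2) (Sum.inl a)

omit [DecidableEq I] in
lemma continuous_firstBlock (A : Matrix I I ℝ) : Continuous (firstBlock A) := by
  refine (PiLp.continuous_toLp 2 _).comp (continuous_pi fun a => ?_)
  simp only [Matrix.mulVec, dotProduct, Matrix.of_apply, Fintype.sum_sum_type, Sum.elim_inl,
    Sum.elim_inr]
  fun_prop

/-- The right-hand side is parametrized by `v = A⁻¹ u` instead of `u`. At the limiting
block-diagonal matrix with `d = 0` the solution map is then the identity in `v`, and the limit law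
of `A⁻¹ u` passes through unchanged. -/
lemma firstBlock_inv {A : Matrix I I ℝ} {m : I ⊕ I → I ⊕ I → ℝ} (hm : (Matrix.of m).det ≠ 0)
    {x : I ⊕ I → ℝ} {v : EuclideanSpace ℝ I} {d : I → ℝ}
    (h : Matrix.of m *ᵥ x = Sum.elim (A *ᵥ (WithLp.ofLp v)) d) :
    firstBlock A (v, (fun i j => (Matrix.of m)⁻¹ i j, d)) = WithLp.toLp 2 fun a => x (Sum.inl a) := by
  have h1 : x = (Matrix.of m)⁻¹ *ᵥ Sum.elim (A *ᵥ (WithLp.ofLp v)) d := by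
    rw [← h, Matrix.mulVec_mulVec, Matrix.nonsing_inv_mul _ (isUnit_iff_ne_zero.2 hm),
      Matrix.one_mulVec]
  rw [h1]
  rfl

variable [IsProbabilityMeasure P] {ν' : Measure (EuclideanSpace ℝ I)} [IsProbabilityMeasure ν']

/-- Solutions `x` of random linear equations `M x = (u, d)`, where `M` converges in probability to
an invertible block-diagonal matrix, `d` to zero, and `A⁻¹ u` converges in distribution. -/
theorem tendstoInDistribution_solution {A D : Matrix I I ℝ} (hA : IsUnit A.det) (hD : IsUnit D.det)
    {M : ℕ → Ω → I ⊕ I → I ⊕ I → ℝ} (hMm : ∀ n, AEMeasurable (M n) P)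
    (hM : ∀ j k, TendstoInMeasure P (fun n ω => M n ω j k) atTop
      (fun _ => Matrix.fromBlocks A 0 0 D j k))
    {x : ℕ → Ω → I ⊕ I → ℝ} (hx : ∀ n, AEMeasurable (x n) P)
    {u d : ℕ → Ω → I → ℝ} (hdm : ∀ n, AEMeasurable (d n) P)
    (heq : ∀ᶠ n in atTop, ∀ᵐ ω ∂P, Matrix.of (M n ω) *ᵥ x n ω = Sum.elim (u n ω) (d n ω))
    (hu : TendstoInDistribution (fun n ω => WithLp.toLp 2 (A⁻¹ *ᵥ u n ω)) atTop id (fun _ => P) ν')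
    (hd : ∀ a, TendstoInMeasure P (fun n ω => d n ω a) atTop (fun _ => 0)) :
    TendstoInDistribution (fun n ω => WithLp.toLp 2 (fun a => x n ω (Sum.inl a))) atTop id
      (fun _ => P) ν' := by
  obtain ⟨ML, hMLof⟩ : ∃ ML : I ⊕ I → I ⊕ I → ℝ, Matrix.of ML = Matrix.fromBlocks A 0 0 D :=
    ⟨fun j k => Matrix.fromBlocks A 0 0 D j k, rfl⟩
  have hdet : (Matrix.of ML).det ≠ 0 := by
    rw [hMLof, Matrix.det_fromBlocks_zero₂₁]
    exact mul_ne_zero hA.ne_zero hD.ne_zero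
  have hMP : TendstoInMeasure P M atTop (fun _ => ML) :=
    tendstoInMeasure_pi fun j => tendstoInMeasure_pi fun k => by
      have := hM j k
      rwa [← hMLof] at this
  have hBm : ∀ n, AEMeasurable (fun ω i j => (Matrix.of (M n ω))⁻¹ i j) P := fun n =>
    measurable_of_inv.comp_aemeasurable (hMm n)
  have hBP := tendstoInMeasure_of_inv hMP hdet
  have hdP : TendstoInMeasure P d atTop (fun _ => 0) := tendstoInMeasure_pi hd
  -- Slutsky: `(M⁻¹, d)` converges in probability to a constant, so a continuous function of it and
  -- of `A⁻¹ u` converges in law.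
  have hS := hu.continuous_comp_prodMk_of_tendstoInMeasure_const (continuous_firstBlock A)
    (tendstoInMeasure_prodMk hBP hdP) fun n => (hBm n).prodMk (hdm n)
  have hid : (fun y : EuclideanSpace ℝ I => firstBlock A
      (id y, (fun i j => (Matrix.of ML)⁻¹ i j, 0))) = id := by
    funext y
    refine firstBlock_inv hdet (x := Sum.elim (WithLp.ofLp y) 0) ?_
    rw [hMLof, Matrix.fromBlocks_mulVec]
    congr 1 <;> simp
  rw [hid] at hS
  -- For large `n`, where `M` is invertible the solution coincides almost surely with its formula;
  -- the singular event has vanishing probability.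
  refine tendstoInDistribution_of_tendstoInMeasure_sub _ _ hS ?_ ?_
  · have hopen : {m : I ⊕ I → I ⊕ I → ℝ | (Matrix.of m).det ≠ 0} ∈ 𝓝 ML :=
      (isOpen_ne.preimage continuous_det_of).mem_nhds hdet
    have h0 := tendsto_measure_notMem_of_tendstoInMeasure hMP hopen
    intro ε hε
    refine tendsto_of_tendsto_of_tendsto_of_le_of_le' tendsto_const_nhds h0
      (Eventually.of_forall fun _ => zero_le) ?_
    filter_upwards [heq] with n hn
    refine measure_mono_ae ?_
    filter_upwards [hn] with ω hω hdist hmem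
    have hz := firstBlock_inv (A := A) (v := WithLp.toLp 2 (A⁻¹ *ᵥ u n ω)) (d := d n ω) hmem
      (x := x n ω) (by
        rw [hω]
        congr 1
        rw [Matrix.mulVec_mulVec, Matrix.mul_nonsing_inv _ hA, Matrix.one_mulVec])
    have h1 : ε ≤ edist ((WithLp.toLp 2 (fun a => x n ω (Sum.inl a)) : EuclideanSpace ℝ I)
      - firstBlock A (WithLp.toLp 2 (A⁻¹ *ᵥ u n ω),
        (fun i j => (Matrix.of (M n ω))⁻¹ i j, d n ω))) 0 := hdist
    rw [hz, sub_self, edist_self] at h1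
    exact hε.not_ge h1
  · intro n
    have h1 : AEMeasurable (fun ω a => x n ω (Sum.inl a)) P :=
      aemeasurable_pi_lambda _ fun a => (measurable_pi_apply _).comp_aemeasurable (hx n)
    exact (PiLp.continuous_toLp 2 _).measurable.comp_aemeasurable h1

end LinearEquation

/-! ### Bandwidths -/

namespace BandwidthCondition

variable {h₁ h₂ : ℕ → ℝ}

lemma tendsto_sqrt (h : BandwidthCondition h₁ h₂) :
    Tendsto (fun n : ℕ => √(n * h₁ n * h₂ n)) atTop atTop :=
  Real.tendsto_sqrt_atTop.comp h.rate

lemma tendsto_sqrt_sqrt (h : BandwidthCondition h₁ h₂) :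
    Tendsto (fun n : ℕ => √√(n * h₁ n * h₂ n)) atTop atTop :=
  Real.tendsto_sqrt_atTop.comp h.tendsto_sqrt

/-- The square is at most `2 √N (h₁² + h₂²)` with `N = n h₁ h₂`. Thus the condition on the
second-order bias at rate `√N` also removes a first-order bias at rate `N^{1/4}`. -/
lemma tendsto_sqrt_sqrt_mul_add (h : BandwidthCondition h₁ h₂) :
    Tendsto (fun n : ℕ => √√(n * h₁ n * h₂ n) * (h₁ n + h₂ n)) atTop (𝓝 0) := by
  have h1 := (Real.continuous_sqrt.tendsto _).comp (h.bias.const_mul 2)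
  rw [mul_zero, Real.sqrt_zero] at h1
  refine squeeze_zero (fun n => ?_) (fun n => ?_) h1
  · have := h.pos₁ n; have := h.pos₂ n; positivity
  · refine Real.le_sqrt_of_sq_le ?_
    rw [mul_pow, Real.sq_sqrt (Real.sqrt_nonneg _)]
    nlinarith [Real.sqrt_nonneg (n * h₁ n * h₂ n), sq_nonneg (h₁ n - h₂ n),
      mul_nonneg (Real.sqrt_nonneg (n * h₁ n * h₂ n)) (sq_nonneg (h₁ n - h₂ n))]

/-- Vanishing bandwidths are a consequence of the two rates: the factor `N^{1/4}` eventually exceeds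
one. -/
lemma tendsto_add (h : BandwidthCondition h₁ h₂) :
    Tendsto (fun n => h₁ n + h₂ n) atTop (𝓝 0) := by
  refine squeeze_zero' (Eventually.of_forall fun n => ?_) ?_ h.tendsto_sqrt_sqrt_mul_add
  · have := h.pos₁ n; have := h.pos₂ n; positivity
  · filter_upwards [h.tendsto_sqrt_sqrt.eventually_ge_atTop 1] with n hn
    exact le_mul_of_one_le_left (by have := h.pos₁ n; have := h.pos₂ n; positivity) hn

lemma tendsto_fst (h : BandwidthCondition h₁ h₂) : Tendsto h₁ atTop (𝓝 0) :=
  squeeze_zero (fun n => (h.pos₁ n).le) (fun n => by linarith [h.pos₂ n]) h.tendsto_add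

lemma tendsto_snd (h : BandwidthCondition h₁ h₂) : Tendsto h₂ atTop (𝓝 0) :=
  squeeze_zero (fun n => (h.pos₂ n).le) (fun n => by linarith [h.pos₁ n]) h.tendsto_add

lemma nonneg (h : BandwidthCondition h₁ h₂) (n : ℕ) : 0 ≤ n * h₁ n * h₂ n := by
  have := h.pos₁ n; have := h.pos₂ n; positivity

end BandwidthCondition

/-! ### Laws of large numbers for kernel-weighted averages -/

section Averages

variable {E : Type*} [MeasurableSpace E] {μ : Measure E} [IsProbabilityMeasure μ]
  {ν : Measure ObsTimes} [IsProbabilityMeasure ν] {η : ℝ × ℝ → ℝ}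
  {f : (ℝ × ℝ) × (ℝ × ℝ) → ℝ} {g : ℝ × ℝ → E → ℝ} {h₁ h₂ : ℕ → ℝ}
  {Ω : Type*} [MeasurableSpace Ω] {P : Measure Ω} [IsProbabilityMeasure P]
  {ζ : ℕ → Ω → E × ObsTimes} {K : ℝ × ℝ → ℝ} {F : ℝ × ℝ → ℝ} {t : ℝ}

/-- The average of a kernel-weighted sum over the first `n` subjects. -/
noncomputable def kernelAvg (κ : ℝ × ℝ → ℝ) (h₁ h₂ t : ℝ) (g : ℝ × ℝ → E → ℝ) (n : ℕ)
    (x : ℕ → E × ObsTimes) : ℝ :=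
  (n : ℝ)⁻¹ * ∑ i ∈ Finset.range n, kernelSum κ h₁ h₂ t g (x i)

omit [IsProbabilityMeasure P] in
lemma aemeasurable_kernelAvg {κ : ℝ × ℝ → ℝ} (hκ : Measurable κ) (h₁ h₂ t : ℝ)
    (hg : Measurable (Function.uncurry g)) (n : ℕ) (hζ : ∀ i, AEMeasurable (ζ i) P) :
    AEMeasurable (fun ω => kernelAvg κ h₁ h₂ t g n (fun i => ζ i ω)) P :=
  (Finset.aemeasurable_fun_sum _ fun i _ =>
    (measurable_kernelSum hκ h₁ h₂ t hg).comp_aemeasurable (hζ i)).const_mul _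

lemma etaExt_mul_eq_indicator {G : ℝ × ℝ → ℝ} (hFG : ∀ z ∈ unitSq, η z * G z = F z)
    (z : ℝ × ℝ) : etaExt η z * G z = unitSq.indicator F z := by
  by_cases hz : z ∈ unitSq
  · rw [etaExt, indicator_of_mem hz, indicator_of_mem hz, hFG z hz]
  · rw [etaExt, indicator_of_notMem hz, indicator_of_notMem hz, zero_mul]

lemma continuousAt_indicator_unitSq (hF : ContDiffOn ℝ 2 F unitSq) (ht : t ∈ Ioo (0 : ℝ) 1) :
    ContinuousAt (unitSq.indicator F) (t, t) := by
  have hn := unitSq_mem_nhds ht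
  refine (hF.continuousOn.continuousAt hn).congr ?_
  filter_upwards [hn] with z hz
  exact (indicator_of_mem hz F).symm

lemma KernelCondition.integrable_mul (hK : KernelCondition K) {p : ℝ × ℝ → ℝ} (hp : Measurable p)
    (hp2 : Integrable fun x => p x ^ 2 * K x) : Integrable fun x => p x * K x := by
  simpa using hK.integrable_mul_mul hp (q := fun _ => 1) measurable_const hp2
    (by simpa using hK.integrable)

/-- Law of large numbers for kernel-weighted averages. -/
lemma tendstoInMeasure_kernelAvg (hζ : ∀ i, HasLaw (ζ i) (μ.prod ν) P) (hind : iIndepFun ζ P)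
    (h : ObservationCondition ν η f) (hg : BddMoment μ 2 g) (hh : BandwidthCondition h₁ h₂)
    (ht : t ∈ Ioo (0 : ℝ) 1) (hF : ContDiffOn ℝ 2 F unitSq)
    (hFg : ∀ z ∈ unitSq, η z * ∫ e, g z e ∂μ = F z) {κ : ℝ × ℝ → ℝ} (hκ : Measurable κ)
    (hκi : Integrable κ) :
    TendstoInMeasure P (fun (n : ℕ) ω => kernelAvg κ (h₁ n) (h₂ n) t g n (fun i => ζ i ω)) atTop
      (fun _ => F (t, t) * ∫ x, κ x) := by
  obtain ⟨B, hB⟩ := hg.exists_sq_bound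
  obtain ⟨c, -, hc⟩ := exists_indicator_bound hF.continuousOn
  -- Since `κ` is only integrable, it is cut at height `√(n h₁ h₂)`.
  have hlim := tendstoInMeasure_kernelAverage hζ hind h hg.meas hB hκ hκi hh.pos₁ hh.pos₂ t
    (A := fun n => {x | |κ x| ≤ √(n * h₁ n * h₂ n)})
    (fun n => measurableSet_le (by fun_prop) measurable_const)
    (s := fun _ => 1) (fun _ => zero_le_one) (c := F (t, t) * ∫ x, κ x) ?_ ?_ ?_
  · simpa only [one_mul, kernelAvg] using hlim
  · refine (tendsto_ofReal_inv_mul_setLIntegral_sq hκi hκ hh.tendsto_sqrt).congr fun n => ?_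
    rw [Real.sq_sqrt (hh.nonneg n), one_pow, one_div]
  · simpa using tendsto_setLIntegral_compl_sublevel hκ hκ.enorm hκi.hasFiniteIntegral.ne
      hh.tendsto_sqrt
  · simp only [one_mul, etaExt_mul_eq_indicator hFg]
    have := tendsto_integral_mul_rescale hκi (measurable_indicator_unitSq hF.continuousOn) hc
      (continuousAt_indicator_unitSq hF ht) hh.tendsto_fst hh.tendsto_snd
    rwa [indicator_of_mem (mem_of_mem_nhds (unitSq_mem_nhds ht))] at this

/-- Rate of convergence of kernel-weighted averages for a kernel with vanishing integral. -/
lemma tendstoInMeasure_sqrt_sqrt_mul_kernelAvg (hζ : ∀ i, HasLaw (ζ i) (μ.prod ν) P)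
    (hind : iIndepFun ζ P) (h : ObservationCondition ν η f) (hg : BddMoment μ 2 g)
    (hh : BandwidthCondition h₁ h₂) (hK : KernelCondition K)
    (ht : t ∈ Ioo (0 : ℝ) 1) (hF : ContDiffOn ℝ 2 F unitSq)
    (hFg : ∀ z ∈ unitSq, η z * ∫ e, g z e ∂μ = F z) {p : ℝ × ℝ → ℝ} (hp : Measurable p)
    (hp2 : Integrable fun x => p x ^ 2 * K x) (hp0 : ∫ x, p x * K x = 0) :
    TendstoInMeasure P (fun (n : ℕ) ω => √√(n * h₁ n * h₂ n) *
      kernelAvg (fun x => p x * K x) (h₁ n) (h₂ n) t g n (fun i => ζ i ω)) atTop (fun _ => 0) := by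
  obtain ⟨B, hB⟩ := hg.exists_sq_bound
  have i0 := hK.integrable_mul hp hp2
  have i1 : Integrable fun x : ℝ × ℝ => x.1 * (p x * K x) := by
    simpa only [mul_assoc] using hK.integrable_mul_mul measurable_fst hp hK.integrable_fst_sq hp2
  have i2 : Integrable fun x : ℝ × ℝ => x.2 * (p x * K x) := by
    simpa only [mul_assoc] using hK.integrable_mul_mul measurable_snd hp hK.integrable_snd_sq hp2
  obtain ⟨c, hc⟩ := exists_abs_integral_mul_rescale_le i0 hp0 i1 i2 hF ht
  -- The truncation level of `p` equals the rate `s = N^{1/4}`: then `s² / N = 1 / s²` in the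
  -- variance part, and the tail part is controlled by `∫ p² K`. No second moment of `p K` is
  -- available.
  refine tendstoInMeasure_kernelAverage hζ hind h hg.meas hB (hp.mul hK.meas) i0 hh.pos₁ hh.pos₂ t
    (A := fun n => {x | |p x| ≤ √√(n * h₁ n * h₂ n)})
    (fun n => measurableSet_le (by fun_prop) measurable_const)
    (s := fun n => √√(n * h₁ n * h₂ n)) (fun _ => Real.sqrt_nonneg _) ?_ ?_ ?_
  · refine (tendsto_ofReal_inv_sq_mul_setLIntegral_sq hK.meas hK.integrable_sq hp
      hh.tendsto_sqrt_sqrt).congr' ?_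
    filter_upwards [hh.tendsto_sqrt.eventually_gt_atTop 0] with n hn
    congr 2
    rw [Real.sq_sqrt (Real.sqrt_nonneg _)]
    nth_rw 3 [← Real.sq_sqrt (hh.nonneg n)]
    field_simp
  · exact tendsto_ofReal_mul_setLIntegral_compl hK.meas hp hp2 hh.tendsto_sqrt_sqrt
  · simp only [etaExt_mul_eq_indicator hFg]
    refine squeeze_zero_norm (a := fun n => |c| * (√√(n * h₁ n * h₂ n) * (h₁ n + h₂ n)))
      (fun n => ?_) (by simpa using hh.tendsto_sqrt_sqrt_mul_add.const_mul |c|)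
    have q1 := hh.pos₁ n
    have q2 := hh.pos₂ n
    rw [norm_mul, Real.norm_of_nonneg (Real.sqrt_nonneg _), Real.norm_eq_abs]
    calc _ ≤ √√(n * h₁ n * h₂ n) * (|c| * (h₁ n + h₂ n)) := by
          refine mul_le_mul_of_nonneg_left ((hc _ _ q1 q2).trans ?_) (Real.sqrt_nonneg _)
          exact mul_le_mul_of_nonneg_right (le_abs_self c) (by positivity)
      _ = _ := by ring

omit [IsProbabilityMeasure μ] in
/-- The bias of a kernel-weighted average is negligible if the mean function vanishes at `t`. -/
lemma tendsto_sqrt_mul_bias (hh : BandwidthCondition h₁ h₂) (hK : KernelCondition K)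
    (ht : t ∈ Ioo (0 : ℝ) 1) (hF : ContDiffOn ℝ 2 F unitSq) (hF0 : F (t, t) = 0)
    (hFg : ∀ z ∈ unitSq, η z * ∫ e, g z e ∂μ = F z) :
    Tendsto (fun n : ℕ => √(n * h₁ n * h₂ n) * ∫ x, K x *
      (etaExt η (rescale t (h₁ n) (h₂ n) x) * ∫ e, g (rescale t (h₁ n) (h₂ n) x) e ∂μ))
      atTop (𝓝 0) := by
  obtain ⟨c, hc⟩ := exists_abs_integral_kernel_mul_rescale_le hK
    (hK.integrable_mul measurable_fst hK.integrable_fst_sq)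
    (hK.integrable_mul measurable_snd hK.integrable_snd_sq) hF ht hF0
  simp only [etaExt_mul_eq_indicator hFg]
  refine squeeze_zero_norm (a := fun n => |c| * (√(n * h₁ n * h₂ n) * (h₁ n ^ 2 + h₂ n ^ 2)))
    (fun n => ?_) (by simpa using hh.bias.const_mul |c|)
  rw [norm_mul, Real.norm_of_nonneg (Real.sqrt_nonneg _), Real.norm_eq_abs]
  calc _ ≤ √(n * h₁ n * h₂ n) * (|c| * (h₁ n ^ 2 + h₂ n ^ 2)) := by
        refine mul_le_mul_of_nonneg_left ((hc _ _ (hh.pos₁ n) (hh.pos₂ n)).trans ?_)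
          (Real.sqrt_nonneg _)
        exact mul_le_mul_of_nonneg_right (le_abs_self c) (by positivity)
    _ = _ := by ring

end Averages

/-! ### The normal equations -/

section NormalEquations

variable {E : Type*} {p q : ℕ} {Y : ℝ → E → ℝ} {X : ℝ → E → Fin p → ℝ} {Z : ℝ → E → Fin q → ℝ}
  {K : ℝ × ℝ → ℝ} {h₁ h₂ t : ℝ}

/-- Position in a local linear fit of the level or the slope of a covariate. -/
def pos : (Fin p ⊕ Fin q) ⊕ (Fin p ⊕ Fin q) → RIdx p q := Sum.elim lvl der

/-- The covariate that belongs to a level or slope. -/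
def base : (Fin p ⊕ Fin q) ⊕ (Fin p ⊕ Fin q) → Fin p ⊕ Fin q := Sum.elim id id

/-- The monomial that belongs to a level or slope. -/
def mono : (Fin p ⊕ Fin q) ⊕ (Fin p ⊕ Fin q) → ℝ × ℝ → ℝ := Sum.elim (fun _ _ => 1) time

/-- The bandwidth factor that belongs to a level or slope. -/
def scale (h₁ h₂ : ℝ) (j : (Fin p ⊕ Fin q) ⊕ (Fin p ⊕ Fin q)) : ℝ := mono j (h₁, h₂)

lemma scale_pos (p1 : 0 < h₁) (p2 : 0 < h₂) (j : (Fin p ⊕ Fin q) ⊕ (Fin p ⊕ Fin q)) :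
    0 < scale h₁ h₂ j := by
  rcases j with j | (j | j)
  · exact one_pos
  · exact p1
  · exact p2

/-- With the bandwidth factored out, the monomial depends on rescaled time only and can be absorbed
into the kernel. -/
lemma R_pos (p1 : 0 < h₁) (p2 : 0 < h₂) (j : (Fin p ⊕ Fin q) ⊕ (Fin p ⊕ Fin q)) (z : ℝ × ℝ)
    (e : E) : R X Z z.1 z.2 t e (pos j)
      = cov X Z (base j) z e * mono j ((z.1 - t) / h₁, (z.2 - t) / h₂) * scale h₁ h₂ j := by
  rcases j with a | a
  · rw [pos, Sum.elim_inl, R_lvl]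
    simp [base, mono, scale]
  · rw [pos, Sum.elim_inr, R_der]
    rcases a with a | a
    · simp [base, mono, scale, time, mul_assoc, div_mul_cancel₀ _ p1.ne']
    · simp [base, mono, scale, time, mul_assoc, div_mul_cancel₀ _ p2.ne']

lemma sum_pos (φ : RIdx p q → ℝ) : ∑ l, φ l = ∑ j, φ (pos j) := by
  simp only [Fintype.sum_sum_type, pos, Sum.elim_inl, Sum.elim_inr, lvl, der, Sum.map_inl,
    Sum.map_inr]
  ring

lemma criterion_eq (n : ℕ) (x : ℕ → E × ObsTimes) (ρ : RIdx p q → ℝ) :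
    criterion Y X Z K h₁ h₂ t n (fun i => (x i).1) (fun i => (x i).2) ρ
      = ∑ i ∈ Finset.range n, pointSum (x i).2 fun z => kern K h₁ h₂ t z *
        (Y z.1 (x i).1 - R X Z z.1 z.2 t (x i).1 ⬝ᵥ ρ) ^ 2 := by
  refine Finset.sum_congr rfl fun i _ => ?_
  rw [integral_dNstar]
  rfl

/-- The normal equations of the least-squares criterion. -/
lemma normal_equation {n : ℕ} {x : ℕ → E × ObsTimes} {ρ : RIdx p q → ℝ}
    (h : IsMinOn (criterion Y X Z K h₁ h₂ t n (fun i => (x i).1) (fun i => (x i).2)) univ ρ)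
    (l : RIdx p q) :
    ∑ i ∈ Finset.range n, pointSum (x i).2 (fun z => kern K h₁ h₂ t z *
      ((Y z.1 (x i).1 - R X Z z.1 z.2 t (x i).1 ⬝ᵥ ρ) * R X Z z.1 z.2 t (x i).1 l)) = 0 := by
  set b := ∑ i ∈ Finset.range n, pointSum (x i).2 (fun z => kern K h₁ h₂ t z *
      ((Y z.1 (x i).1 - R X Z z.1 z.2 t (x i).1 ⬝ᵥ ρ) * R X Z z.1 z.2 t (x i).1 l)) with hb
  set a := ∑ i ∈ Finset.range n, pointSum (x i).2 (fun z => kern K h₁ h₂ t z *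
      R X Z z.1 z.2 t (x i).1 l ^ 2) with ha
  -- Moving the minimizer by `s` along one coordinate changes the criterion by `a s² - 2 b s`.
  -- Nonnegativity for all `s` forces the discriminant `4 b²` to be nonpositive.
  have key : ∀ s : ℝ, 0 ≤ a * (s * s) + (-2 * b) * s + 0 := by
    intro s
    have h1 := h (mem_univ (ρ + Pi.single l s))
    simp only [mem_ofPred_eq] at h1
    rw [criterion_eq, criterion_eq] at h1
    have h2 : ∑ i ∈ Finset.range n, pointSum (x i).2 (fun z => kern K h₁ h₂ t z *
        (Y z.1 (x i).1 - R X Z z.1 z.2 t (x i).1 ⬝ᵥ (ρ + Pi.single l s)) ^ 2)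
        = (∑ i ∈ Finset.range n, pointSum (x i).2 (fun z => kern K h₁ h₂ t z *
        (Y z.1 (x i).1 - R X Z z.1 z.2 t (x i).1 ⬝ᵥ ρ) ^ 2)) + a * (s * s) + (-2 * b) * s := by
      rw [ha, hb]
      simp only [pointSum, Finset.mul_sum, Finset.sum_mul, ← Finset.sum_add_distrib]
      refine Finset.sum_congr rfl fun i _ => Finset.sum_congr rfl fun k _ => ?_
      rw [dotProduct_add, dotProduct_single]
      ring
    rw [h2] at h1
    linarith
  have := discrim_le_zero key
  rw [discrim] at this
  nlinarith [sq_nonneg b]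

/-- The normal equations in rescaled form. -/
lemma normal_equation_rescaled (p1 : 0 < h₁) (p2 : 0 < h₂) {n : ℕ} {x : ℕ → E × ObsTimes}
    {ρ : RIdx p q → ℝ}
    (h : IsMinOn (criterion Y X Z K h₁ h₂ t n (fun i => (x i).1) (fun i => (x i).2)) univ ρ)
    (θ : Fin p ⊕ Fin q → ℝ) (j : (Fin p ⊕ Fin q) ⊕ (Fin p ⊕ Fin q)) :
    ∑ k, kernelAvg (fun y => mono j y * mono k y * K y) h₁ h₂ t
        (fun z e => cov X Z (base j) z e * cov X Z (base k) z e) n x *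
        (scale h₁ h₂ k * (ρ (pos k) - Sum.elim θ 0 k))
      = kernelAvg (fun y => mono j y * K y) h₁ h₂ t
        (fun z e => cov X Z (base j) z e * resid Y X Z θ z e) n x := by
  have h1 := normal_equation h (pos j)
  have hs := scale_pos p1 p2 j
  -- Levels are centred at `θ` and slopes at zero, which leaves the residual of a fit with constant
  -- coefficients.
  have hres : ∀ (z : ℝ × ℝ) (e : E), Y z.1 e - R X Z z.1 z.2 t e ⬝ᵥ ρ = resid Y X Z θ z e
      - ∑ k, R X Z z.1 z.2 t e (pos k) * (ρ (pos k) - Sum.elim θ 0 k) := by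
    intro z e
    have e1 : ∑ k, R X Z z.1 z.2 t e (pos k) * Sum.elim θ 0 k = ∑ c, cov X Z c z e * θ c := by
      rw [Fintype.sum_sum_type]
      simp [pos, R_lvl]
    simp only [mul_sub, Finset.sum_sub_distrib, e1, resid, dotProduct]
    rw [sum_pos]
    ring
  have h2 : ∑ i ∈ Finset.range n, pointSum (x i).2 (fun z => kern K h₁ h₂ t z *
      ((Y z.1 (x i).1 - R X Z z.1 z.2 t (x i).1 ⬝ᵥ ρ) * R X Z z.1 z.2 t (x i).1 (pos j)))
      = scale h₁ h₂ j * ((∑ i ∈ Finset.range n, kernelSum (fun y => mono j y * K y) h₁ h₂ t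
        (fun z e => cov X Z (base j) z e * resid Y X Z θ z e) (x i))
        - ∑ k, (∑ i ∈ Finset.range n, kernelSum (fun y => mono j y * mono k y * K y) h₁ h₂ t
        (fun z e => cov X Z (base j) z e * cov X Z (base k) z e) (x i)) *
        (scale h₁ h₂ k * (ρ (pos k) - Sum.elim θ 0 k))) := by
    simp_rw [Finset.sum_mul]
    rw [Finset.sum_comm, ← Finset.sum_sub_distrib, Finset.mul_sum]
    refine Finset.sum_congr rfl fun i _ => ?_
    simp only [kernelSum, pointSum, Finset.sum_mul]
    rw [Finset.sum_comm, ← Finset.sum_sub_distrib, Finset.mul_sum]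
    refine Finset.sum_congr rfl fun i' _ => ?_
    rw [hres, sub_mul, mul_sub, mul_sub, Finset.sum_mul, Finset.mul_sum, Finset.mul_sum]
    congr 1
    · rw [R_pos p1 p2]
      simp only [kern, scaledKernel]
      ring
    · refine Finset.sum_congr rfl fun k _ => ?_
      rw [R_pos p1 p2, R_pos p1 p2]
      simp only [kern, scaledKernel]
      ring
  rw [h2] at h1
  have h3 := sub_eq_zero.1 ((mul_eq_zero.1 h1).resolve_left hs.ne')
  simp only [kernelAvg]
  rw [h3, Finset.mul_sum]
  refine Finset.sum_congr rfl fun k _ => ?_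
  ring

end NormalEquations

/-! ### The limit of the slope block -/

section SlopeBlock

open scoped Matrix

variable {p q : ℕ} {K : ℝ × ℝ → ℝ}

lemma measurable_mono (j : (Fin p ⊕ Fin q) ⊕ (Fin p ⊕ Fin q)) : Measurable (mono j) := by
  rcases j with j | (j | j)
  · exact measurable_const
  · exact measurable_fst
  · exact measurable_snd

lemma KernelCondition.integrable_mono_sq (hK : KernelCondition K)
    (j : (Fin p ⊕ Fin q) ⊕ (Fin p ⊕ Fin q)) : Integrable fun x => mono j x ^ 2 * K x := by
  rcases j with j | (j | j)
  · simpa [mono] using hK.integrable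
  · exact hK.integrable_fst_sq
  · exact hK.integrable_snd_sq

lemma KernelCondition.integrable_mono_mul_mono (hK : KernelCondition K)
    (j k : (Fin p ⊕ Fin q) ⊕ (Fin p ⊕ Fin q)) : Integrable fun x => mono j x * mono k x * K x :=
  hK.integrable_mul_mul (measurable_mono j) (measurable_mono k) (hK.integrable_mono_sq j)
    (hK.integrable_mono_sq k)

lemma KernelCondition.integral_time (hK : KernelCondition K) (a : Fin p ⊕ Fin q) :
    ∫ x, time a x * K x = 0 := by
  rcases a with a | a
  · exact hK.integral_fst
  · exact hK.integral_snd

lemma ae_time_ne_zero (a : Fin p ⊕ Fin q) : ∀ᵐ x : ℝ × ℝ, time a x ≠ 0 := by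
  rw [ae_iff]
  rcases a with a | a
  · have : {x : ℝ × ℝ | ¬ time (Sum.inl a : Fin p ⊕ Fin q) x ≠ 0} = {0} ×ˢ univ := by
      ext x; simp [time]
    rw [this, Measure.volume_eq_prod, Measure.prod_prod]; simp
  · have : {x : ℝ × ℝ | ¬ time (Sum.inr a : Fin p ⊕ Fin q) x ≠ 0} = univ ×ˢ {0} := by
      ext x; simp [time]
    rw [this, Measure.volume_eq_prod, Measure.prod_prod]; simp

/-- The limit of the rescaled second-moment matrix of the slope regressors. -/
noncomputable def slopeMatrix (K : ℝ × ℝ → ℝ) (A : Matrix (Fin p ⊕ Fin q) (Fin p ⊕ Fin q) ℝ) :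
    Matrix (Fin p ⊕ Fin q) (Fin p ⊕ Fin q) ℝ :=
  Matrix.of fun a b => A a b * ∫ x, time a x * time b x * K x

/-- The quadratic form at `v` is `∫ K yᵀ A y` with `y_a = v_a * time a`. For a null vector `v ≠ 0`,
positive definiteness of `A` makes `K` vanish wherever `y ≠ 0`, hence almost everywhere, against `∫
K = 1`. -/
lemma isUnit_det_slopeMatrix (hK : KernelCondition K)
    {A : Matrix (Fin p ⊕ Fin q) (Fin p ⊕ Fin q) ℝ} (hA : A.PosDef) :
    IsUnit (slopeMatrix K A).det := by
  rw [isUnit_iff_ne_zero]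
  intro hdet
  obtain ⟨v, hv0, hv⟩ := Matrix.exists_mulVec_eq_zero_iff.2 hdet
  obtain ⟨a, ha⟩ := Function.ne_iff.1 hv0
  set y : ℝ × ℝ → Fin p ⊕ Fin q → ℝ := fun x a => v a * time a x with hy
  have hint : ∀ a b, Integrable fun x => v a * v b * A a b * (time a x * time b x * K x) :=
    fun a b => (hK.integrable_mono_mul_mono (Sum.inr a) (Sum.inr b)).const_mul _
  have hq : ∀ x, K x * (y x ⬝ᵥ A *ᵥ y x)
      = ∑ a, ∑ b, v a * v b * A a b * (time a x * time b x * K x) := by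
    intro x
    simp only [dotProduct, Matrix.mulVec, Finset.mul_sum, hy]
    refine Finset.sum_congr rfl fun a _ => Finset.sum_congr rfl fun b _ => ?_
    ring
  have hqi : Integrable fun x => K x * (y x ⬝ᵥ A *ᵥ y x) := by
    simp_rw [hq]
    exact integrable_finsetSum _ fun a _ => integrable_finsetSum _ fun b _ => hint a b
  have hq0 : ∫ x, K x * (y x ⬝ᵥ A *ᵥ y x) = 0 := by
    simp_rw [hq]
    rw [integral_finsetSum _ fun a _ => integrable_finsetSum _ fun b _ => hint a b]
    have h0 : v ⬝ᵥ slopeMatrix K A *ᵥ v = 0 := by rw [hv, dotProduct_zero]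
    rw [← h0]
    simp only [dotProduct, Matrix.mulVec, Finset.mul_sum, slopeMatrix, Matrix.of_apply]
    refine Finset.sum_congr rfl fun a _ => ?_
    rw [integral_finsetSum _ fun b _ => hint a b]
    refine Finset.sum_congr rfl fun b _ => ?_
    rw [integral_const_mul]
    ring
  have hpos : ∀ u : Fin p ⊕ Fin q → ℝ, 0 ≤ u ⬝ᵥ A *ᵥ u := fun u => by
    simpa using hA.posSemidef.dotProduct_mulVec_nonneg u
  have hae := (integral_eq_zero_iff_of_nonneg (fun x => mul_nonneg (hK.nonneg x) (hpos _)) hqi).1 hq0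
  have hK0 : K =ᵐ[volume] 0 := by
    filter_upwards [hae, ae_time_ne_zero a] with x hx hxa
    have hx : K x * (y x ⬝ᵥ A *ᵥ y x) = 0 := hx
    refine (mul_eq_zero.1 hx).resolve_right (ne_of_gt ?_)
    have hyx : y x ≠ 0 := fun h0 => mul_ne_zero ha hxa (congrFun h0 a)
    simpa using hA.dotProduct_mulVec_pos hyx
  have := hK.integral_eq_one
  rw [integral_congr_ae hK0] at this
  simp at this

end SlopeBlock

/-! ### Limits of the terms of the normal equations -/

section Limits

open scoped Matrix

variable {E : Type*} [MeasurableSpace E] {μ : Measure E} [IsProbabilityMeasure μ]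
  {ν : Measure ObsTimes} [IsProbabilityMeasure ν] {η : ℝ × ℝ → ℝ}
  {f : (ℝ × ℝ) × (ℝ × ℝ) → ℝ} {h₁ h₂ : ℕ → ℝ}
  {Ω : Type*} [MeasurableSpace Ω] {P : Measure Ω} [IsProbabilityMeasure P]
  {ζ : ℕ → Ω → E × ObsTimes} {K : ℝ × ℝ → ℝ} {t r : ℝ} {p q : ℕ}
  {Y : ℝ → E → ℝ} {X : ℝ → E → Fin p → ℝ} {Z : ℝ → E → Fin q → ℝ}
  {β₀ : ℝ → Fin p → ℝ} {γ₀ : ℝ → Fin q → ℝ} {σ : ℝ → (Fin p → ℝ) → (Fin q → ℝ) → ℝ}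

/-- The rate at which the equation for a level or slope is scaled; `s` is the fourth root of the
effective sample size. -/
def rate (s : ℝ) : (Fin p ⊕ Fin q) ⊕ (Fin p ⊕ Fin q) → ℝ := Sum.elim (fun _ => s ^ 2) fun _ => s

/-- The ratio of two rates. -/
noncomputable def rateRatio (s : ℝ) : (Fin p ⊕ Fin q) ⊕ (Fin p ⊕ Fin q) →
    (Fin p ⊕ Fin q) ⊕ (Fin p ⊕ Fin q) → ℝ :=
  Sum.elim (fun _ => Sum.elim (fun _ => 1) fun _ => s) fun _ => Sum.elim (fun _ => s⁻¹) fun _ => 1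

/-- Scaling equation `j` and unknown `k` by their rates leaves this ratio on the matrix entry. The
delicate case is a level equation with a slope unknown: the ratio `s` grows, but the entry is `o(1 /
s)` in probability. -/
lemma rateRatio_mul {s : ℝ} (hs : s ≠ 0) (j k : (Fin p ⊕ Fin q) ⊕ (Fin p ⊕ Fin q)) :
    rateRatio s j k * rate s k = rate s j := by
  rcases j with j | j <;> rcases k with k | k <;> simp [rateRatio, rate, sq, hs]

lemma BddMoment.mul_two {g g' : ℝ × ℝ → E → ℝ} (hr : 4 < r) (h : BddMoment μ r g)
    (h' : BddMoment μ r g') : BddMoment μ 2 (fun z e => g z e * g' z e) :=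
  (h.mul h' (by linarith)).mono_exponent (by norm_num) (by linarith)

omit [IsProbabilityMeasure μ] [IsProbabilityMeasure ν] in
lemma contDiffOn_design_mean (h : ObservationCondition ν η f)
    (hA2 : CovariateCondition μ X Z β₀ γ₀ σ η) (a b : Fin p ⊕ Fin q) :
    ContDiffOn ℝ 2 (fun z => η z * covMoment μ X Z a b (z, z)) unitSq := by
  refine h.eta_smooth.mul ((hA2.contDiffOn_covMoment a b).comp (f := fun z : ℝ × ℝ => (z, z)) ?_ ?_)
  · exact ContDiff.contDiffOn (by fun_prop)
  · exact fun z hz => ⟨hz, hz⟩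

/-- The rescaled design matrix converges in probability. -/
lemma tendstoInMeasure_design (hζ : ∀ i, HasLaw (ζ i) (μ.prod ν) P) (hind : iIndepFun ζ P)
    (h : ObservationCondition ν η f) (hA2 : CovariateCondition μ X Z β₀ γ₀ σ η)
    (hK : KernelCondition K) (hh : BandwidthCondition h₁ h₂) (ht : t ∈ Ioo (0 : ℝ) 1) (hr : 4 < r)
    (hC : ∀ a, BddMoment μ r (cov X Z a)) (j k : (Fin p ⊕ Fin q) ⊕ (Fin p ⊕ Fin q)) :
    TendstoInMeasure P (fun (n : ℕ) ω => rateRatio √√(n * h₁ n * h₂ n) j k *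
      kernelAvg (fun y => mono j y * mono k y * K y) (h₁ n) (h₂ n) t
        (fun z e => cov X Z (base j) z e * cov X Z (base k) z e) n (fun i => ζ i ω)) atTop
      (fun _ => Matrix.fromBlocks (AStar μ X Z η t) 0 0 (slopeMatrix K (AStar μ X Z η t)) j k) := by
  have hg := fun a b => BddMoment.mul_two hr (hC a) (hC b)
  have hF := contDiffOn_design_mean h hA2 (μ := μ) (X := X) (Z := Z)
  have hA : ∀ a b, η (t, t) * covMoment μ X Z a b ((t, t), (t, t)) = AStar μ X Z η t a b :=
    fun a b => mul_comm _ _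
  have hκm : ∀ j k : (Fin p ⊕ Fin q) ⊕ (Fin p ⊕ Fin q),
      Measurable fun y => mono j y * mono k y * K y := fun j k =>
    ((measurable_mono j).mul (measurable_mono k)).mul hK.meas
  have hrate : ∀ c a b : Fin p ⊕ Fin q, TendstoInMeasure P (fun (n : ℕ) ω =>
      √√(n * h₁ n * h₂ n) * kernelAvg (fun y => time c y * K y) (h₁ n) (h₂ n) t
        (fun z e => cov X Z a z e * cov X Z b z e) n (fun i => ζ i ω)) atTop (fun _ => 0) :=
    fun c a b => tendstoInMeasure_sqrt_sqrt_mul_kernelAvg hζ hind h (hg a b) hh hK ht (hF a b)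
      (fun _ _ => rfl) (measurable_mono (Sum.inr c)) (hK.integrable_mono_sq (Sum.inr c))
      (hK.integral_time c)
  rcases j with a | a <;> rcases k with b | b
  · have := tendstoInMeasure_kernelAvg hζ hind h (hg a b) hh ht (hF a b) (fun _ _ => rfl) hK.meas
      hK.integrable
    simpa [rateRatio, mono, base, hA, hK.integral_eq_one] using! this
  · simpa [rateRatio, mono, base] using! hrate b a b
  · have h0 : TendstoInMeasure P (fun (n : ℕ) ω =>
        (√√(n * h₁ n * h₂ n))⁻¹ * kernelAvg (fun y => time a y * K y) (h₁ n) (h₂ n) t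
        (fun z e => cov X Z a z e * cov X Z b z e) n (fun i => ζ i ω)) atTop (fun _ => 0) := by
      intro ε hε
      refine tendsto_of_tendsto_of_tendsto_of_le_of_le' tendsto_const_nhds (hrate a a b ε hε)
        (Eventually.of_forall fun _ => zero_le) ?_
      filter_upwards [hh.tendsto_sqrt_sqrt.eventually_ge_atTop 1] with n hn
      refine measure_mono fun ω hω => le_trans (α := ℝ≥0∞) hω ?_
      simp only [edist_zero_right, enorm_mul]
      gcongr
      rw [Real.enorm_eq_ofReal (by positivity), Real.enorm_eq_ofReal (by positivity)]
      exact ENNReal.ofReal_le_ofReal ((inv_le_one_of_one_le₀ hn).trans hn)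
    simpa [rateRatio, mono, base] using! h0
  · have := tendstoInMeasure_kernelAvg hζ hind h (hg a b) hh ht (hF a b) (fun _ _ => rfl)
      (hκm (Sum.inr a) (Sum.inr b)) (hK.integrable_mono_mul_mono (Sum.inr a) (Sum.inr b))
    simpa [rateRatio, mono, base, hA, slopeMatrix] using! this

omit [IsProbabilityMeasure μ] [IsProbabilityMeasure ν] in
lemma contDiffOn_score_mean (h : ObservationCondition ν η f)
    (hA2 : CovariateCondition μ X Z β₀ γ₀ σ η) (w θ : Fin p ⊕ Fin q → ℝ) :
    ContDiffOn ℝ 2 (fun z : ℝ × ℝ => η z * ∑ a, w a *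
      ((∑ c, covMoment μ X Z a c (z, (z.1, z.1)) * coef β₀ γ₀ z.1 c)
        - ∑ c, covMoment μ X Z a c (z, z) * θ c)) unitSq :=
  h.eta_smooth.mul (ContDiffOn.sum fun a _ => contDiffOn_const.mul
    (hA2.contDiffOn_score_mean a θ))

/-- The mean of a linear combination of the scores. -/
lemma integral_covComb_mul_resid (hM : VaryingCoefficientModel μ Y X Z β₀ γ₀ σ)
    (hr : 4 < r) (hY : BddMoment μ r (fun z => Y z.1)) (hC : ∀ a, BddMoment μ r (cov X Z a))
    (w θ : Fin p ⊕ Fin q → ℝ) {z : ℝ × ℝ} (hz : z ∈ unitSq) :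
    ∫ e, covComb X Z w z e * resid Y X Z θ z e ∂μ = ∑ a, w a *
      ((∑ c, covMoment μ X Z a c (z, (z.1, z.1)) * coef β₀ γ₀ z.1 c)
        - ∑ c, covMoment μ X Z a c (z, z) * θ c) := by
  have hε := bddMoment_resid (by linarith) hY hC θ
  have hi : ∀ a, Integrable (fun e => w a * (cov X Z a z e * resid Y X Z θ z e)) μ := fun a =>
    (((BddMoment.mul_two hr (hC a) hε).memLp_two hz).integrable (by norm_num)).const_mul _
  have e1 : ∀ e, covComb X Z w z e * resid Y X Z θ z e
      = ∑ a, w a * (cov X Z a z e * resid Y X Z θ z e) := fun e => by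
    rw [covComb, Finset.sum_mul]
    exact Finset.sum_congr rfl fun a _ => by ring
  simp_rw [e1]
  rw [integral_finsetSum _ fun a _ => hi a]
  refine Finset.sum_congr rfl fun a _ => ?_
  rw [integral_const_mul, integral_cov_mul_resid hM hr hY hC a θ hz]

/-- The score for the slopes is negligible. -/
lemma tendstoInMeasure_slope_score (hζ : ∀ i, HasLaw (ζ i) (μ.prod ν) P) (hind : iIndepFun ζ P)
    (hM : VaryingCoefficientModel μ Y X Z β₀ γ₀ σ)
    (h : ObservationCondition ν η f) (hA2 : CovariateCondition μ X Z β₀ γ₀ σ η)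
    (hK : KernelCondition K) (hh : BandwidthCondition h₁ h₂) (ht : t ∈ Ioo (0 : ℝ) 1) (hr : 4 < r)
    (hY : BddMoment μ r (fun z => Y z.1)) (hC : ∀ a, BddMoment μ r (cov X Z a))
    (θ : Fin p ⊕ Fin q → ℝ) (a : Fin p ⊕ Fin q) :
    TendstoInMeasure P (fun (n : ℕ) ω => √√(n * h₁ n * h₂ n) *
      kernelAvg (fun y => time a y * K y) (h₁ n) (h₂ n) t
        (fun z e => cov X Z a z e * resid Y X Z θ z e) n (fun i => ζ i ω)) atTop (fun _ => 0) := by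
  refine tendstoInMeasure_sqrt_sqrt_mul_kernelAvg hζ hind h
    (BddMoment.mul_two hr (hC a) (bddMoment_resid (by linarith) hY hC θ)) hh hK ht
    (h.eta_smooth.mul (hA2.contDiffOn_score_mean a θ)) (fun z hz => ?_)
    (measurable_mono (Sum.inr a)) (hK.integrable_mono_sq (Sum.inr a)) (hK.integral_time a)
  rw [integral_cov_mul_resid hM hr hY hC a θ hz]

/-- Characteristic functions of linear combinations of the scores. -/
lemma tendsto_charFun_score (hζ : ∀ i, HasLaw (ζ i) (μ.prod ν) P) (hind : iIndepFun ζ P)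
    (hM : VaryingCoefficientModel μ Y X Z β₀ γ₀ σ)
    (h : ObservationCondition ν η f) (hA2 : CovariateCondition μ X Z β₀ γ₀ σ η)
    (hK : KernelCondition K) (hh : BandwidthCondition h₁ h₂) (ht : t ∈ Ioo (0 : ℝ) 1)
    (hreg : RegularityCondition μ Y X Z σ t) (hr : 4 < r) (hr6 : r ≤ 6)
    (hY : BddMoment μ r (fun z => Y z.1)) (hC : ∀ a, BddMoment μ r (cov X Z a))
    (w : Fin p ⊕ Fin q → ℝ) :
    Tendsto (fun n : ℕ => ∫ ω, Complex.exp ((√(n * h₁ n * h₂ n) *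
        kernelAvg K (h₁ n) (h₂ n) t (fun z e => covComb X Z w z e *
          resid Y X Z (coef β₀ γ₀ t) z e) n (fun i => ζ i ω) : ℝ) * Complex.I) ∂P) atTop
      (𝓝 (Complex.exp ((-(w ⬝ᵥ SigmaStar μ X Z σ η K t *ᵥ w) / 2 : ℝ) : ℂ))) := by
  have hε := bddMoment_resid (by linarith) hY hC (coef β₀ γ₀ t)
  have hW := bddMoment_covComb (by linarith) hC w
  obtain ⟨B, hB⟩ := (BddMoment.mul_two hr hW hε).exists_sq_bound
  obtain ⟨B', hB'⟩ := (hW.mul hε (by linarith)).bound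
  have htt : (t, t) ∈ unitSq := mem_of_mem_nhds (unitSq_mem_nhds ht)
  -- At `(t, t)` the two sums in the mean cancel because `θ` is the true coefficient there; this is
  -- the zero that a second-order bias requires.
  have hbias := tendsto_sqrt_mul_bias (μ := μ)
    (g := fun z e => covComb X Z w z e * resid Y X Z (coef β₀ γ₀ t) z e) hh hK ht
    (contDiffOn_score_mean h hA2 w (coef β₀ γ₀ t)) (by simp)
    (fun z hz => by rw [integral_covComb_mul_resid hM hr hY hC w _ hz])
  have hlim := tendsto_charFun_kernelAverage hζ hind h (hW.mul hε (by linarith)).meas hB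
    (by linarith) (by linarith) hB' hK hh.pos₁ hh.pos₂ hh.tendsto_fst hh.tendsto_snd hh.rate ht
    (tendsto_integral_sq_score hM hA2 ht hreg hr hY hC w) hbias
  have hval : η (t, t) * (∫ x, K x ^ 2) * ∑ a, ∑ b, w a * w b * sigmaMoment μ X Z σ t a b
      = w ⬝ᵥ SigmaStar μ X Z σ η K t *ᵥ w := by
    simp only [SigmaStar, dotProduct, Matrix.mulVec, Finset.mul_sum, Matrix.smul_apply, smul_eq_mul]
    refine Finset.sum_congr rfl fun a _ => Finset.sum_congr rfl fun b _ => by ring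
  rw [hval] at hlim
  exact hlim

-- The form of `sigmaMoment` is the second moment of the score on the diagonal, hence nonnegative.
-- Semidefiniteness identifies the characteristic function of the limiting Gaussian law.
omit [IsProbabilityMeasure ν] in
lemma posSemidef_SigmaStar (hM : VaryingCoefficientModel μ Y X Z β₀ γ₀ σ)
    (h : ObservationCondition ν η f) (hA2 : CovariateCondition μ X Z β₀ γ₀ σ η)
    (ht : t ∈ Ioo (0 : ℝ) 1) (hr : 4 < r)
    (hY : BddMoment μ r (fun z => Y z.1)) (hC : ∀ a, BddMoment μ r (cov X Z a)) :
    (SigmaStar μ X Z σ η K t).PosSemidef := by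
  have ht' : t ∈ unitI := ⟨ht.1.le, ht.2.le⟩
  have hs : (sigmaMoment μ X Z σ t).PosSemidef := by
    refine Matrix.PosSemidef.of_dotProduct_mulVec_nonneg ?_ fun w => ?_
    · ext a b
      simp only [sigmaMoment, Matrix.conjTranspose_apply, Matrix.of_apply, star_trivial]
      congr 1 with e
      ring
    · have h1 : star w ⬝ᵥ sigmaMoment μ X Z σ t *ᵥ w
          = ∑ a, ∑ b, w a * w b * sigmaMoment μ X Z σ t a b := by
        simp only [star_trivial, dotProduct, Matrix.mulVec, Finset.mul_sum]
        refine Finset.sum_congr rfl fun a _ => Finset.sum_congr rfl fun b _ => by ring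
      rw [h1, ← integral_sq_score_diag hM hA2 hr hY hC w ht']
      exact integral_nonneg fun _ => sq_nonneg _
  exact hs.smul (mul_nonneg (integral_nonneg fun _ => sq_nonneg _) (h.eta_nonneg _ ⟨ht', ht'⟩))

omit [MeasurableSpace E] in
lemma kernelAvg_covComb_mul (κ : ℝ × ℝ → ℝ) (b₁ b₂ t : ℝ) (w : Fin p ⊕ Fin q → ℝ)
    (ε : ℝ × ℝ → E → ℝ) (n : ℕ) (x : ℕ → E × ObsTimes) :
    kernelAvg κ b₁ b₂ t (fun z e => covComb X Z w z e * ε z e) n x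
      = ∑ a, w a * kernelAvg κ b₁ b₂ t (fun z e => cov X Z a z e * ε z e) n x := by
  have h : ∀ y : E × ObsTimes, kernelSum κ b₁ b₂ t (fun z e => covComb X Z w z e * ε z e) y
      = ∑ a, w a * kernelSum κ b₁ b₂ t (fun z e => cov X Z a z e * ε z e) y := fun y => by
    simp only [kernelSum, pointSum, covComb, Finset.sum_mul, Finset.mul_sum]
    rw [Finset.sum_comm]
    exact Finset.sum_congr rfl fun a _ => Finset.sum_congr rfl fun i _ => by ring
  simp only [kernelAvg, h, Finset.mul_sum]
  rw [Finset.sum_comm]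
  exact Finset.sum_congr rfl fun a _ => Finset.sum_congr rfl fun i _ => by ring

/-- The normalized score converges in distribution. -/
lemma tendstoInDistribution_score (hζ : ∀ i, HasLaw (ζ i) (μ.prod ν) P) (hind : iIndepFun ζ P)
    (hM : VaryingCoefficientModel μ Y X Z β₀ γ₀ σ)
    (h : ObservationCondition ν η f) (hA2 : CovariateCondition μ X Z β₀ γ₀ σ η)
    (hK : KernelCondition K) (hh : BandwidthCondition h₁ h₂) (ht : t ∈ Ioo (0 : ℝ) 1)
    (hreg : RegularityCondition μ Y X Z σ t) (hr : 4 < r) (hr6 : r ≤ 6)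
    (hY : BddMoment μ r (fun z => Y z.1)) (hC : ∀ a, BddMoment μ r (cov X Z a)) :
    TendstoInDistribution (fun (n : ℕ) ω => (WithLp.toLp 2 ((AStar μ X Z η t)⁻¹ *ᵥ fun a =>
        √(n * h₁ n * h₂ n) * kernelAvg K (h₁ n) (h₂ n) t (fun z e => cov X Z a z e *
          resid Y X Z (coef β₀ γ₀ t) z e) n (fun i => ζ i ω)) : EuclideanSpace ℝ (Fin p ⊕ Fin q)))
      atTop id (fun _ => P) (multivariateGaussian 0
        ((AStar μ X Z η t)⁻¹ * SigmaStar μ X Z σ η K t * (AStar μ X Z η t)⁻¹)) := by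
  have ht' : t ∈ unitI := ⟨ht.1.le, ht.2.le⟩
  have hAsymm : ((AStar μ X Z η t)⁻¹)ᵀ = (AStar μ X Z η t)⁻¹ := by
    have := (hA2.posDef t ht').isHermitian.inv
    rwa [Matrix.IsHermitian, Matrix.conjTranspose_eq_transpose_of_trivial] at this
  have hS : ((AStar μ X Z η t)⁻¹ * SigmaStar μ X Z σ η K t * (AStar μ X Z η t)⁻¹).PosSemidef := by
    have := (posSemidef_SigmaStar (K := K) hM h hA2 ht hr hY hC).mul_mul_conjTranspose_same
      (AStar μ X Z η t)⁻¹
    rwa [Matrix.conjTranspose_eq_transpose_of_trivial, hAsymm] at this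
  have hε := bddMoment_resid (by linarith) hY hC (coef β₀ γ₀ t)
  have hm : ∀ n : ℕ, AEMeasurable (fun ω => (WithLp.toLp 2 ((AStar μ X Z η t)⁻¹ *ᵥ fun a =>
        √(n * h₁ n * h₂ n) * kernelAvg K (h₁ n) (h₂ n) t (fun z e => cov X Z a z e *
          resid Y X Z (coef β₀ γ₀ t) z e) n (fun i => ζ i ω)) :
        EuclideanSpace ℝ (Fin p ⊕ Fin q))) P := by
    intro n
    refine (PiLp.continuous_toLp 2 _).measurable.comp_aemeasurable
      ((continuous_const.matrix_mulVec continuous_id).measurable.comp_aemeasurable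
        (aemeasurable_pi_lambda _ fun a => AEMeasurable.const_mul ?_ _))
    exact aemeasurable_kernelAvg hK.meas _ _ _ (BddMoment.mul_two hr (hC a) hε).meas n
      fun i => (hζ i).aemeasurable
  refine ⟨hm, aemeasurable_id, ?_⟩
  refine ProbabilityMeasure.tendsto_iff_tendsto_charFun.2 fun w => ?_
  simp only [ProbabilityMeasure.coe_mk, Measure.map_id]
  rw [charFun_multivariateGaussian hS]
  -- Cramér–Wold: since `A*` is symmetric, testing `(A*)⁻¹ u` against `w` is testing `u` against
  -- `(A*)⁻¹ w`.
  set w' := (AStar μ X Z η t)⁻¹ *ᵥ (WithLp.ofLp w) with hw'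
  have hlim := tendsto_charFun_score hζ hind hM h hA2 hK hh ht hreg hr hr6 hY hC w'
  have hq : WithLp.ofLp w ⬝ᵥ ((AStar μ X Z η t)⁻¹ * SigmaStar μ X Z σ η K t *
      (AStar μ X Z η t)⁻¹) *ᵥ WithLp.ofLp w = w' ⬝ᵥ SigmaStar μ X Z σ η K t *ᵥ w' := by
    rw [← Matrix.mulVec_mulVec, ← Matrix.mulVec_mulVec, Matrix.dotProduct_mulVec,
      ← Matrix.mulVec_transpose, hAsymm]
  rw [hq, inner_zero_right]
  have hlim' : Complex.exp (((0 : ℝ) : ℂ) * Complex.I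
      - ((w' ⬝ᵥ SigmaStar μ X Z σ η K t *ᵥ w' : ℝ) : ℂ) / 2)
      = Complex.exp ((-(w' ⬝ᵥ SigmaStar μ X Z σ η K t *ᵥ w') / 2 : ℝ) : ℂ) := by
    congr 1
    push_cast
    ring
  rw [hlim']
  refine hlim.congr fun n => ?_
  rw [charFun_apply, integral_map (hm n) (by fun_prop)]
  congr 1 with ω
  congr 3
  rw [EuclideanSpace.inner_eq_star_dotProduct, star_trivial, Matrix.dotProduct_mulVec,
    ← Matrix.mulVec_transpose, hAsymm, ← hw']
  rw [kernelAvg_covComb_mul, dotProduct, Finset.mul_sum]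
  exact Finset.sum_congr rfl fun a _ => by ring

end Limits

end AsyncVC

/-! ### Assembly: normal equations, design limit and score limit -/

theorem theorem1 {Ω E : Type*} [MeasurableSpace Ω] [MeasurableSpace E]
    (P : Measure Ω) [IsProbabilityMeasure P]
    (μ : Measure E) [IsProbabilityMeasure μ]
    (ν : Measure AsyncVC.ObsTimes) [IsProbabilityMeasure ν]
    {p q : ℕ}
    -- response and covariate processes of a generic subject, as functions of its trajectory in `E`
    (Y : ℝ → E → ℝ) (X : ℝ → E → Fin p → ℝ) (Z : ℝ → E → Fin q → ℝ)
    -- true regression functions and conditional standard deviation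
    (β₀ : ℝ → Fin p → ℝ) (γ₀ : ℝ → Fin q → ℝ) (σ : ℝ → (Fin p → ℝ) → (Fin q → ℝ) → ℝ)
    -- intensity and conditional intensity of the observation process
    (η : ℝ × ℝ → ℝ) (f : (ℝ × ℝ) × (ℝ × ℝ) → ℝ)
    -- kernel and bandwidths
    (K : ℝ × ℝ → ℝ) (h₁ h₂ : ℕ → ℝ)
    -- i.i.d. subjects with trajectories `ξ i` and observation times `τ i`
    (ξ : ℕ → Ω → E) (τ : ℕ → Ω → AsyncVC.ObsTimes)
    (hξ : ∀ i, Measurable (ξ i)) (hτ : ∀ i, Measurable (τ i))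
    (hξμ : ∀ i, HasLaw (ξ i) μ P) (hτν : ∀ i, HasLaw (τ i) ν P)
    (hsubjects : iIndepFun (fun i ω => (ξ i ω, τ i ω)) P)
    -- the observation times are independent of the processes
    (hindep : ∀ i, IndepFun (τ i) (ξ i) P)
    (hmodel : AsyncVC.VaryingCoefficientModel μ Y X Z β₀ γ₀ σ)
    (hA1 : AsyncVC.ObservationCondition ν η f)
    (hA2 : AsyncVC.CovariateCondition μ X Z β₀ γ₀ σ η)
    (hA3 : AsyncVC.KernelCondition K)
    (hA4 : AsyncVC.BandwidthCondition h₁ h₂)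
    (t : ℝ) (ht : t ∈ Ioo (0 : ℝ) 1)
    (hreg : AsyncVC.RegularityCondition μ Y X Z σ t)
    -- the estimator: a measurable minimizer of the local linear criterion
    (ρhat : ℕ → Ω → AsyncVC.RIdx p q → ℝ) (hρm : ∀ n, AEMeasurable (ρhat n) P)
    (hρ : ∀ n, ∀ᵐ ω ∂P, IsMinOn
      (AsyncVC.criterion Y X Z K (h₁ n) (h₂ n) t n (fun i => ξ i ω) (fun i => τ i ω))
      univ (ρhat n ω)) :
    TendstoInDistribution
      (fun (n : ℕ) (ω : Ω) => (WithLp.toLp 2 (Sum.elim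
        (fun a : Fin p => √(n * h₁ n * h₂ n) * (ρhat n ω (Sum.inl (Sum.inl a)) - β₀ t a))
        (fun b : Fin q => √(n * h₁ n * h₂ n) * (ρhat n ω (Sum.inr (Sum.inl b)) - γ₀ t b))) :
          EuclideanSpace ℝ (Fin p ⊕ Fin q)))
      atTop id (fun _ => P)
      (multivariateGaussian 0
        ((AsyncVC.AStar μ X Z η t)⁻¹ * AsyncVC.SigmaStar μ X Z σ η K t *
          (AsyncVC.AStar μ X Z η t)⁻¹)) := by
  have hζ : ∀ i, HasLaw (fun ω => (ξ i ω, τ i ω)) (μ.prod ν) P := fun i =>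
    (indepFun_iff_hasLaw_prodMk_prod (hξμ i) (hτν i)).1 (hindep i).symm
  obtain ⟨r, hr, hr6, hY, hC⟩ := AsyncVC.exists_bddMoment hmodel hreg
  have ht' : t ∈ AsyncVC.unitI := ⟨ht.1.le, ht.2.le⟩
  have hA := hA2.posDef t ht'
  have hε := AsyncVC.bddMoment_resid (by linarith) hY hC (AsyncVC.coef β₀ γ₀ t)
  have hζm := fun i => (hζ i).aemeasurable
  -- The unknown is rate times bandwidth factor times error. On the levels the bandwidth factor is
  -- one and the rate is the square of the fourth root, that is `√(n h₁ h₂)`, which gives the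
  -- normalized error of the theorem.
  have hsol := AsyncVC.tendstoInDistribution_solution (P := P)
    (x := fun (n : ℕ) ω k => AsyncVC.rate √√(n * h₁ n * h₂ n) k *
      (AsyncVC.scale (h₁ n) (h₂ n) k *
        (ρhat n ω (AsyncVC.pos k) - Sum.elim (AsyncVC.coef β₀ γ₀ t) 0 k)))
    hA.det_pos.ne'.isUnit (AsyncVC.isUnit_det_slopeMatrix hA3 hA)
    (fun n => aemeasurable_pi_lambda _ fun j => aemeasurable_pi_lambda _ fun k =>
      (AsyncVC.aemeasurable_kernelAvg
        (((AsyncVC.measurable_mono j).fun_mul (AsyncVC.measurable_mono k)).fun_mul hA3.meas) _ _ _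
        (AsyncVC.BddMoment.mul_two hr (hC (AsyncVC.base j)) (hC (AsyncVC.base k))).meas n
        hζm).const_mul _)
    (AsyncVC.tendstoInMeasure_design hζ hsubjects hA1 hA2 hA3 hA4 ht hr hC)
    (fun n => aemeasurable_pi_lambda _ fun k =>
      ((((measurable_pi_apply _).comp_aemeasurable (hρm n)).sub_const _).const_mul _).const_mul _)
    (fun n => aemeasurable_pi_lambda _ fun a =>
      (AsyncVC.aemeasurable_kernelAvg
        ((AsyncVC.measurable_mono (Sum.inr a)).fun_mul hA3.meas) _ _ _
        (AsyncVC.BddMoment.mul_two hr (hC a) hε).meas n hζm).const_mul _)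
    ?_
    (AsyncVC.tendstoInDistribution_score hζ hsubjects hmodel hA1 hA2 hA3 hA4 ht hreg hr hr6 hY hC)
    (AsyncVC.tendstoInMeasure_slope_score hζ hsubjects hmodel hA1 hA2 hA3 hA4 ht hr hY hC _)
  · convert hsol using 4 with n ω
    funext a
    rcases a with a | a <;>
      simp [AsyncVC.rate, AsyncVC.scale, AsyncVC.mono, AsyncVC.pos, AsyncVC.lvl, AsyncVC.coef,
        Real.sq_sqrt]
  · filter_upwards [hA4.tendsto_sqrt_sqrt.eventually_gt_atTop 0] with n hn
    filter_upwards [hρ n] with ω hω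
    funext j
    have hne := AsyncVC.normal_equation_rescaled (x := fun i => (ξ i ω, τ i ω)) (hA4.pos₁ n)
      (hA4.pos₂ n) hω (AsyncVC.coef β₀ γ₀ t) j
    have hj : ∀ k, AsyncVC.rateRatio √√(n * h₁ n * h₂ n) j k *
        AsyncVC.rate √√(n * h₁ n * h₂ n) k = AsyncVC.rate √√(n * h₁ n * h₂ n) j :=
      AsyncVC.rateRatio_mul hn.ne' j
    -- Row `j` of the normal equations is multiplied by its own rate, and `hj` trades that rate for
    -- the rates of the unknowns.
    have hmul := congrArg (AsyncVC.rate √√(n * h₁ n * h₂ n) j * ·) hne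
    simp only [Finset.mul_sum] at hmul
    simp only [Matrix.mulVec, dotProduct, Matrix.of_apply]
    refine Eq.trans (Finset.sum_congr rfl fun k _ => ?_) (hmul.trans ?_)
    · rw [← hj k]
      ring
    · rcases j with a | a
      · simp [AsyncVC.rate, AsyncVC.mono, AsyncVC.base, Real.sq_sqrt]
      · simp [AsyncVC.rate, AsyncVC.mono, AsyncVC.base]
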